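/- Let $n\ge 3$, $\kappa\in\mathbb R$, and let $U\subset\mathbb R^n$ be a connected open set on which $1+\kappa|x|^2>0$, with the metric of constant curvature $\kappa$ $$\alpha=\alpha_\kappa=\frac{\sqrt{(1+\kappa|x|^2)|y|^2-\kappa\langle x,y\rangle^2}}{1+\kappa|x|^2}.$$ Let $\beta=b_i(x)y^i$ be a smooth 1-form on $U$ that is not parallel with respect to $\alpha$, put $b=\|\beta_x\|_\alpha$, $D=\{(b^2(x),s): x\in U,\ |s|\le b(x)\}$, and let $\phi=\phi(b^2,s)$ be $C^\infty$ on a neighbourhood of $D$; subscripts 1, 2 on $\phi$ denote partial derivatives in $b^2$ and $s$. Suppose that $F=\alpha\,\phi(b^2,\beta/\alpha)$ is a non-Riemannian Finsler metric on $U$, that $\phi_1(b^2(x),0)\ne0$ for every $x\in U$ (in particular this holds if $\phi_1$ has no zero on $D$), and that $\phi_{22}$ is not identically zero on $D$. Let $G^i$ and ${}^\alpha G^i$ be the geodesic coefficients of $F$ and $\alpha$, $G^i=\frac14 g^{il}\{[F^2]_{x^my^l}y^m-[F^2]_{x^l}\}$; $F$ is called projectively flat if $G^i=Py^i$ with $P=F_{x^k}y^k/(2F)$.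 Consider the following explicit form: there are a function $c=c(b^2)$, $C^\infty$ on an open set $I\supset b^2(U)$, antiderivatives $\Lambda=\int\frac{c-1}{b^2}\,d(b^2)$ and $\mu=-\int c\,\nu\,d(b^2)$ on $I$, where $\nu=-e^{\Lambda}$ (if $0\in I$, the first means $b^2\,\Lambda'(b^2)=c(b^2)-1$), a $C^\infty$ function $g$ on $I$, $C^\infty$ functions $f_+,f_-$ on an open set containing all values $\mu(b^2)+\nu(b^2)s^2$ with $(b^2,s)\in D$, a constant $\varepsilon$ and a constant vector $a$, such that on $D$ $$\phi(b^2,s)=f(\mu+\nu s^2)-2\nu s\int_0^s f'(\mu+\nu z^2)\,dz+g(b^2)\,s,\qquad f=f_+\ \text{for } s\ge0,\quad f=f_-\ \text{for } s\le0, \tag{1}$$ and on $U$ $$\beta=e^{-\Lambda(b^2)/2}\;\frac{\varepsilon\langle x,y\rangle+(1+\kappa|x|^2)\langle a,y\rangle-\kappa\langle a,x\rangle\langle x,y\rangle}{(1+\kappa|x|^2)^{3/2}}. \tag{2}$$ Then: (i) $F$ is projectively flat on $U$ if and only if $\phi$ and $\beta$ have the form (1), (2) for some such data. (ii) Suppose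 that $b$ takes arbitrarily small values on $U$ and that $\phi-s\phi_2$ has a limit as $(b^2,s)\to(0,0)$ in $D$ (both hold, for instance, if $\beta$ vanishes somewhere in $U$). Then $F$ is projectively flat on $U$ if and only if $\phi$ and $\beta$ have the form (1), (2) with one function $f=f_+=f_-$. (iii) Whenever (1) and (2) hold, then at every $x\in U$ with $\beta_x\ne0$ one has $c(b^2)\neq0$ and, with $s=\beta/\alpha$, for all $y\neq0$ $$G^i={}^\alpha G^i+e^{-\Lambda(b^2)/2}\,\frac{\varepsilon-\kappa\langle a,x\rangle}{c\,b^2\sqrt{1+\kappa|x|^2}}\;\alpha\left\{(c-1)\frac{(b^2-s^2)\phi_2}{2\phi}+\frac{b^2(2s\phi_1+\phi_2)}{2\phi}\right\}y^i .$$ -/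

import Mathlib

open scoped ContDiff
open Filter Topology

noncomputable section

namespace GeneralAlphaBeta

variable {n : ℕ}

/-- The `i`-th coordinate vector of `ℝⁿ`. -/
def e (i : Fin n) : EuclideanSpace ℝ (Fin n) := EuclideanSpace.single i 1

/-! ### Finsler metrics on an open subset of `ℝⁿ`

A function on the tangent bundle is written `F x y`, with `x` the base point and `y` the vector. -/

/-- `F_{xᵏ}`: the partial derivative in the `k`-th coordinate of the base point. -/
def dx (k : Fin n) (F : EuclideanSpace ℝ (Fin n) → EuclideanSpace ℝ (Fin n) → ℝ)
    (x y : EuclideanSpace ℝ (Fin n)) : ℝ :=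
  fderiv ℝ (fun x' => F x' y) x (e k)

/-- `F_{yᵏ}`: the partial derivative in the `k`-th coordinate of the vector. -/
def dy (k : Fin n) (F : EuclideanSpace ℝ (Fin n) → EuclideanSpace ℝ (Fin n) → ℝ)
    (x y : EuclideanSpace ℝ (Fin n)) : ℝ :=
  fderiv ℝ (fun y' => F x y') y (e k)

/-- The function `F²`. -/
def sqr (F : EuclideanSpace ℝ (Fin n) → EuclideanSpace ℝ (Fin n) → ℝ)
    (x y : EuclideanSpace ℝ (Fin n)) : ℝ :=
  F x y ^ 2

/-- The fundamental tensor `g_{ij} = ½ [F²]_{yⁱ yʲ}`. -/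
def fundamentalTensor (F : EuclideanSpace ℝ (Fin n) → EuclideanSpace ℝ (Fin n) → ℝ)
    (x y : EuclideanSpace ℝ (Fin n)) : Matrix (Fin n) (Fin n) ℝ :=
  Matrix.of fun i j => (1 / 2) * dy j (dy i (sqr F)) x y

/-- `F` is a Finsler metric on `U`: smooth and positive off the zero section, positively
homogeneous of degree one, with positive definite fundamental tensor. -/
structure IsFinslerMetric (U : Set (EuclideanSpace ℝ (Fin n)))
    (F : EuclideanSpace ℝ (Fin n) → EuclideanSpace ℝ (Fin n) → ℝ) : Prop where
  smooth : ContDiffOn ℝ ∞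
    (fun p : EuclideanSpace ℝ (Fin n) × EuclideanSpace ℝ (Fin n) => F p.1 p.2) (U ×ˢ {0}ᶜ)
  pos : ∀ x ∈ U, ∀ y, y ≠ 0 → 0 < F x y
  homogeneous : ∀ x ∈ U, ∀ y, ∀ t : ℝ, 0 < t → F x (t • y) = t * F x y
  posDef : ∀ x ∈ U, ∀ y, y ≠ 0 → (fundamentalTensor F x y).PosDef

/-- `F` is Riemannian on `U`: at each point of `U`, `F²` is a quadratic form in `y`. -/
def IsRiemannian (U : Set (EuclideanSpace ℝ (Fin n)))
    (F : EuclideanSpace ℝ (Fin n) → EuclideanSpace ℝ (Fin n) → ℝ) : Prop :=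
  ∀ x ∈ U, ∃ Q : QuadraticForm ℝ (EuclideanSpace ℝ (Fin n)), ∀ y, F x y ^ 2 = Q y

/-- The geodesic coefficients `Gⁱ = ¼ gⁱˡ ([F²]_{xᵐ yˡ} yᵐ - [F²]_{xˡ})`. -/
def geodesicCoeff (F : EuclideanSpace ℝ (Fin n) → EuclideanSpace ℝ (Fin n) → ℝ)
    (x y : EuclideanSpace ℝ (Fin n)) (i : Fin n) : ℝ :=
  (1 / 4) * ∑ l, (fundamentalTensor F x y)⁻¹ i l *
    ((∑ m, dy l (dx m (sqr F)) x y * y m) - dx l (sqr F) x y)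

/-- `F` is projectively flat on `U`: `Gⁱ = P yⁱ` with `P = F_{xᵏ} yᵏ / (2F)`. -/
def IsProjectivelyFlat (U : Set (EuclideanSpace ℝ (Fin n)))
    (F : EuclideanSpace ℝ (Fin n) → EuclideanSpace ℝ (Fin n) → ℝ) : Prop :=
  ∀ x ∈ U, ∀ y, y ≠ 0 → ∀ i,
    geodesicCoeff F x y i = (∑ k, dx k F x y * y k) / (2 * F x y) * y i

/-! ### The metric `α_κ` of constant curvature `κ`, and one-forms -/

/-- `α_κ = √((1 + κ|x|²)|y|² - κ⟨x,y⟩²) / (1 + κ|x|²)`. -/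
def alpha (κ : ℝ) (x y : EuclideanSpace ℝ (Fin n)) : ℝ :=
  Real.sqrt ((1 + κ * ‖x‖ ^ 2) * ‖y‖ ^ 2 - κ * inner ℝ x y ^ 2) / (1 + κ * ‖x‖ ^ 2)

/-- The matrix `a_{ij}` with `α_κ² = a_{ij} yⁱ yʲ`. -/
def metricMatrix (κ : ℝ) (x : EuclideanSpace ℝ (Fin n)) : Matrix (Fin n) (Fin n) ℝ :=
  Matrix.of fun i j =>
    (if i = j then 1 else 0) / (1 + κ * ‖x‖ ^ 2) - κ * x i * x j / (1 + κ * ‖x‖ ^ 2) ^ 2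

/-- The Christoffel symbols `Γᵏ_{ij} = ½ aᵏˡ (∂ᵢ a_{jl} + ∂ⱼ a_{il} - ∂ₗ a_{ij})` of `α_κ`. -/
def christoffel (κ : ℝ) (x : EuclideanSpace ℝ (Fin n)) (k i j : Fin n) : ℝ :=
  (1 / 2) * ∑ l, (metricMatrix κ x)⁻¹ k l *
    (fderiv ℝ (fun x' => metricMatrix κ x' j l) x (e i)
      + fderiv ℝ (fun x' => metricMatrix κ x' i l) x (e j)
      - fderiv ℝ (fun x' => metricMatrix κ x' i j) x (e l))

/-- The covariant derivative `b_{i|j} = ∂ⱼ bᵢ - Γᵏ_{ij} b_k` of `β = bᵢ yⁱ` with respect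
to `α_κ`. -/
def covDeriv (κ : ℝ) (β : EuclideanSpace ℝ (Fin n) → (EuclideanSpace ℝ (Fin n) →L[ℝ] ℝ))
    (x : EuclideanSpace ℝ (Fin n)) (i j : Fin n) : ℝ :=
  fderiv ℝ (fun x' => β x' (e i)) x (e j) - ∑ k, christoffel κ x k i j * β x (e k)

/-- `β` is parallel on `U` with respect to `α_κ`. -/
def IsParallel (κ : ℝ) (U : Set (EuclideanSpace ℝ (Fin n)))
    (β : EuclideanSpace ℝ (Fin n) → (EuclideanSpace ℝ (Fin n) →L[ℝ] ℝ)) : Prop :=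
  ∀ x ∈ U, ∀ i j, covDeriv κ β x i j = 0

/-- `b² = ‖β_x‖²_α = aⁱʲ bᵢ bⱼ`. -/
def bSq (κ : ℝ) (β : EuclideanSpace ℝ (Fin n) → (EuclideanSpace ℝ (Fin n) →L[ℝ] ℝ))
    (x : EuclideanSpace ℝ (Fin n)) : ℝ :=
  ∑ i, ∑ j, (metricMatrix κ x)⁻¹ i j * β x (e i) * β x (e j)

/-! ### General `(α, β)`-metrics -/

/-- `F = α φ(b², β / α)` with `α = α_κ`. -/
def generalMetric (κ : ℝ) (β : EuclideanSpace ℝ (Fin n) → (EuclideanSpace ℝ (Fin n) →L[ℝ] ℝ))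
    (φ : ℝ → ℝ → ℝ) (x y : EuclideanSpace ℝ (Fin n)) : ℝ :=
  alpha κ x y * φ (bSq κ β x) (β x y / alpha κ x y)

/-- The set of all `(b²(x), s)` with `x ∈ U` and `|s| ≤ b(x)`. -/
def valueSet (κ : ℝ) (U : Set (EuclideanSpace ℝ (Fin n)))
    (β : EuclideanSpace ℝ (Fin n) → (EuclideanSpace ℝ (Fin n) →L[ℝ] ℝ)) : Set (ℝ × ℝ) :=
  {p | ∃ x ∈ U, p.1 = bSq κ β x ∧ p.2 ^ 2 ≤ bSq κ β x}

/-- `φ₁`, the partial derivative in the first variable `b²`. -/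
def d1 (φ : ℝ → ℝ → ℝ) (B s : ℝ) : ℝ := deriv (fun B' => φ B' s) B

/-- `φ₂`, the partial derivative in the second variable `s`. -/
def d2 (φ : ℝ → ℝ → ℝ) (B s : ℝ) : ℝ := deriv (fun s' => φ B s') s

/-- The one-form `(ε⟨x,y⟩ + (1 + κ|x|²)⟨a,y⟩ - κ⟨a,x⟩⟨x,y⟩) / (1 + κ|x|²)^{3/2}`. -/
def conformalForm (κ ε : ℝ) (a x y : EuclideanSpace ℝ (Fin n)) : ℝ :=
  (ε * inner ℝ x y + (1 + κ * ‖x‖ ^ 2) * inner ℝ a y - κ * inner ℝ a x * inner ℝ x y)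
    / (1 + κ * ‖x‖ ^ 2) ^ (3 / 2 : ℝ)

/-- The expression `f(μ + ν s²) - 2 ν s ∫₀ˢ f'(μ + ν z²) dz + g s`, for numbers `μ`, `ν`, `g`. -/
def explicitPhi (f : ℝ → ℝ) (μ ν g s : ℝ) : ℝ :=
  f (μ + ν * s ^ 2) - 2 * ν * s * (∫ z in (0 : ℝ)..s, deriv f (μ + ν * z ^ 2)) + g * s

/-- The explicit form of `φ` and `β`. Here `Λ = ∫ (c-1)/b² d(b²)`, `ν = -exp Λ` and
`μ = -∫ c ν d(b²)` are antiderivatives in the variable `b²` on an open set `I` of values of `b²`.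
The function `f` of the formula is `fp` where `s ≥ 0` and `fm` where `s ≤ 0`. -/
def IsExplicit (κ : ℝ) (U : Set (EuclideanSpace ℝ (Fin n)))
    (β : EuclideanSpace ℝ (Fin n) → (EuclideanSpace ℝ (Fin n) →L[ℝ] ℝ)) (φ : ℝ → ℝ → ℝ)
    (c Λ μ fp fm g : ℝ → ℝ) (ε : ℝ) (a : EuclideanSpace ℝ (Fin n)) : Prop :=
  ∃ I T : Set ℝ, IsOpen I ∧ IsOpen T ∧ (∀ x ∈ U, bSq κ β x ∈ I) ∧
    (∀ p ∈ valueSet κ U β, μ p.1 + (-Real.exp (Λ p.1)) * p.2 ^ 2 ∈ T) ∧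
    ContDiffOn ℝ ∞ c I ∧ ContDiffOn ℝ ∞ g I ∧ ContDiffOn ℝ ∞ fp T ∧ ContDiffOn ℝ ∞ fm T ∧
    (∀ B ∈ I, DifferentiableAt ℝ Λ B ∧ B * deriv Λ B = c B - 1) ∧
    (∀ B ∈ I, HasDerivAt μ (-(c B * -Real.exp (Λ B))) B) ∧
    (∀ p ∈ valueSet κ U β,
      (0 ≤ p.2 → φ p.1 p.2 = explicitPhi fp (μ p.1) (-Real.exp (Λ p.1)) (g p.1) p.2) ∧
      (p.2 ≤ 0 → φ p.1 p.2 = explicitPhi fm (μ p.1) (-Real.exp (Λ p.1)) (g p.1) p.2)) ∧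
    (∀ x ∈ U, ∀ y, β x y = Real.exp (-(Λ (bSq κ β x) / 2)) * conformalForm κ ε a x y)

/-- `b` takes arbitrarily small values on `U`, and `φ - s φ₂` extends continuously to the
vertex `(0, 0)` of the region `|s| ≤ b`. -/
def ReachesVertex (κ : ℝ) (U : Set (EuclideanSpace ℝ (Fin n)))
    (β : EuclideanSpace ℝ (Fin n) → (EuclideanSpace ℝ (Fin n) →L[ℝ] ℝ)) (φ : ℝ → ℝ → ℝ) : Prop :=
  (∀ δ > 0, ∃ x ∈ U, bSq κ β x < δ) ∧
    ∃ L : ℝ, Tendsto (fun p : ℝ × ℝ => φ p.1 p.2 - p.2 * d2 φ p.1 p.2)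
      (𝓝[valueSet κ U β] (0, 0)) (𝓝 L)

end GeneralAlphaBeta

end

/-!
By Hamel's criterion (`isProjectivelyFlat_iff`) the metric `F` is projectively flat exactly when
`F_{x^k y^l} y^k = F_{x^l}`. For `F = α φ(b², β/α)`, and because `α` itself is projectively flat,
this is an equation at each point that involves only `φ` and its derivatives, the metric `α` and the
covariant derivative `b_{i|j}` (`hamel_generalMetric`). Both implications read this equation.

*From flatness to the explicit form.* At a point with `β ≠ 0` the equation is linear algebra in
dimension at least three (`HamelSystem`). The unit vectors of `ker β`, where `s = 0` and `φ₁ ≠ 0`,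
show that `d(b²)` is a multiple of `β` and give the diagonal of `b_{i|j}` on `ker β`; the other unit
vectors show that `β` is closed. Hence `b_{i|j}` is a multiple of
`c a_{ij} + (1 - c) bᵢ bⱼ / b²` with `c = 2 φ₁ / φ₂₂` at `s = 0` (`Setting.cov_eq`), and `φ`
satisfies a linear partial differential equation in `(b², s)` (`Setting.pde`). This requires that
`φ₂₂(b², 0)` has no zero (`Setting.d22_zero_ne`). If it had one with `b > 0`, then
`|d(b²)| ≤ C |b² - b₀²|` near that level set, and Grönwall's inequality would make `b²` constant; but
constant `b²` would make `β` parallel (`Setting.bSq_not_const`). At a zero of `β` the equation for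
`φ` forces `c = 1`.

With `Λ = ∫ (c - 1) / b² d(b²)`, the differential equation says that `φ - s φ₂` is constant along the
curves `e^Λ (b² - s²) = σ` (`LevelSystem.legendre_eq`), so it is a function `f` of `σ`, and
integrating in `s` gives the explicit form (`LevelSystem.eq_explicitPhi`). The half-planes `s ≥ 0`
and `s ≤ 0` are treated separately, as a level curve need not cross the axis `s = 0`. If it does not,
it runs towards the vertex `(0, 0)` when `b` takes small values, and a limit of `φ - s φ₂` there
makes the two functions `f` agree (`LevelSystem.legendre_neg`). On the axis `φ(b², 0) = f(μ)`
exhibits `f` as smooth away from `σ = 0`, and the function `φ - s φ₂` on a vertical segment as smooth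
near `σ = 0` (`LevelSystem.exists_profile`).

The form `γ = e^{Λ/2} β` has the covariant derivative `k a_{ij}`. Such forms are integrated by hand
(`exists_eq_conformalForm`), which needs only one derivative of `γ` and uses dimension at least three.

*From the explicit form to flatness.* The explicit one-forms have the covariant derivative described
above (`Setting.cov_of_conformalData`), the explicit profiles satisfy the differential equation
(`ProfileData.pde`), and `c(b²) ≠ 0` since `φ₁(b², 0) = c e^Λ f'(μ)` is nonzero
(`Setting.coeff_ne_zero`). Then Hamel's expression vanishes (`Setting.hamel_eq_zero`), and
contracting the first derivatives of `F` with `y` gives the geodesic coefficients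
(`Setting.geodesicCoeff_eq_of_hamel_eq_zero`).
-/

open scoped ContDiff
open Filter Topology

noncomputable section

namespace GeneralAlphaBeta

variable {n : ℕ}

/-! ### The metric `α_κ` in coordinate-free form -/

/-- The Euclidean space `ℝⁿ` with its standard norm. -/
abbrev Vec (n : ℕ) := EuclideanSpace ℝ (Fin n)

/-- The inner product `a_{ij} uⁱ vʲ` of the metric `α_κ` at the point `x`. -/
def metricForm (κ : ℝ) (x u v : Vec n) : ℝ :=
  inner ℝ u v / (1 + κ * ‖x‖ ^ 2) - κ * inner ℝ x u * inner ℝ x v / (1 + κ * ‖x‖ ^ 2) ^ 2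

/-- The covariant derivative `b_{i|j} uⁱ vʲ` of the one-form `β` with respect to `α_κ`, with the
Christoffel symbols already evaluated (see `covDeriv_eq_cov`); the direction of differentiation is
`v`. -/
def cov (κ : ℝ) (β : Vec n → (Vec n →L[ℝ] ℝ)) (x u v : Vec n) : ℝ :=
  fderiv ℝ β x v u
    + κ / (1 + κ * ‖x‖ ^ 2) * (inner ℝ x v * β x u + inner ℝ x u * β x v)

/-- The vector with coordinates `bᵢ`. -/
def coeffVec (β : Vec n → (Vec n →L[ℝ] ℝ)) (x : Vec n) : Vec n :=
  ∑ i, β x (e i) • e i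

/-- The vector dual to `β` with respect to `α_κ`: `metricForm κ x (sharp κ β x) v = β x v`. -/
def sharp (κ : ℝ) (β : Vec n → (Vec n →L[ℝ] ℝ)) (x : Vec n) : Vec n :=
  (1 + κ * ‖x‖ ^ 2) • (coeffVec β x + (κ * β x x) • x)

theorem inner_e (x : Vec n) (i : Fin n) : inner ℝ x (e i) = x i := by
  simp [e, EuclideanSpace.inner_single_right]

theorem sum_e (y : Vec n) : ∑ i, y i • (e i : Vec n) = y := by
  have := (EuclideanSpace.basisFun (Fin n) ℝ).sum_repr y
  simpa [e] using this

theorem sum_mul_apply_e (L : Vec n →L[ℝ] ℝ) (y : Vec n) : ∑ i, L (e i) * y i = L y := by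
  conv_rhs => rw [← sum_e y]
  simp [mul_comm]

theorem inner_coeffVec (β : Vec n → (Vec n →L[ℝ] ℝ)) (x v : Vec n) :
    inner ℝ (coeffVec β x) v = β x v := by
  rw [coeffVec, sum_inner]
  simp only [real_inner_smul_right, real_inner_comm v, inner_e]
  exact sum_mul_apply_e (β x) v

theorem metricForm_comm (κ : ℝ) (x u v : Vec n) : metricForm κ x u v = metricForm κ x v u := by
  simp only [metricForm, real_inner_comm u v]; ring

theorem metricForm_add_left (κ : ℝ) (x u u' v : Vec n) :
    metricForm κ x (u + u') v = metricForm κ x u v + metricForm κ x u' v := by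
  simp only [metricForm, inner_add_left, inner_add_right]; ring

theorem metricForm_smul_left (κ : ℝ) (x u v : Vec n) (t : ℝ) :
    metricForm κ x (t • u) v = t * metricForm κ x u v := by
  simp only [metricForm, real_inner_smul_left, real_inner_smul_right]; ring

theorem metricForm_add_right (κ : ℝ) (x u v v' : Vec n) :
    metricForm κ x u (v + v') = metricForm κ x u v + metricForm κ x u v' := by
  simp only [metricForm, inner_add_right]; ring

theorem metricForm_smul_right (κ : ℝ) (x u v : Vec n) (t : ℝ) :
    metricForm κ x u (t • v) = t * metricForm κ x u v := by
  simp only [metricForm, real_inner_smul_right]; ring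

theorem metricForm_pos {κ : ℝ} {x y : Vec n} (hx : 0 < 1 + κ * ‖x‖ ^ 2) (hy : y ≠ 0) :
    0 < metricForm κ x y y := by
  have h : metricForm κ x y y
      = ((1 + κ * ‖x‖ ^ 2) * ‖y‖ ^ 2 - κ * inner ℝ x y ^ 2) / (1 + κ * ‖x‖ ^ 2) ^ 2 := by
    rw [metricForm, real_inner_self_eq_norm_sq]; field_simp
  rw [h]
  have hy' : 0 < ‖y‖ ^ 2 := by positivity
  have hcs : inner ℝ x y ^ 2 ≤ ‖x‖ ^ 2 * ‖y‖ ^ 2 := by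
    rw [← mul_pow]; exact sq_le_sq' (by linarith [neg_le_of_abs_le (abs_real_inner_le_norm x y)])
      (real_inner_le_norm x y)
  apply div_pos _ (by positivity)
  rcases le_total 0 κ with hk | hk
  · nlinarith [mul_le_mul_of_nonneg_left hcs hk]
  · nlinarith [mul_pos hx hy', mul_nonneg (neg_nonneg.2 hk) (sq_nonneg (inner ℝ x y))]

theorem metricForm_self_nonneg {κ : ℝ} {x : Vec n} (hx : 0 < 1 + κ * ‖x‖ ^ 2) (y : Vec n) :
    0 ≤ metricForm κ x y y := by
  rcases eq_or_ne y 0 with rfl | hy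
  · simp [metricForm]
  · exact (metricForm_pos hx hy).le

theorem alpha_eq_sqrt {κ : ℝ} {x : Vec n} (hx : 0 < 1 + κ * ‖x‖ ^ 2) (y : Vec n) :
    alpha κ x y = Real.sqrt (metricForm κ x y y) := by
  have h : metricForm κ x y y
      = ((1 + κ * ‖x‖ ^ 2) * ‖y‖ ^ 2 - κ * inner ℝ x y ^ 2) / (1 + κ * ‖x‖ ^ 2) ^ 2 := by
    rw [metricForm, real_inner_self_eq_norm_sq]; field_simp
  rw [h, Real.sqrt_div' _ (by positivity), Real.sqrt_sq hx.le, alpha]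

theorem alpha_sq {κ : ℝ} {x : Vec n} (hx : 0 < 1 + κ * ‖x‖ ^ 2) (y : Vec n) :
    alpha κ x y ^ 2 = metricForm κ x y y := by
  rw [alpha_eq_sqrt hx, Real.sq_sqrt (metricForm_self_nonneg hx y)]

theorem alpha_pos {κ : ℝ} {x y : Vec n} (hx : 0 < 1 + κ * ‖x‖ ^ 2) (hy : y ≠ 0) :
    0 < alpha κ x y := by
  rw [alpha_eq_sqrt hx]; exact Real.sqrt_pos.2 (metricForm_pos hx hy)

theorem norm_sq_eq_sum (x : Vec n) : ‖x‖ ^ 2 = ∑ i, x i ^ 2 := by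
  rw [EuclideanSpace.norm_sq_eq]; simp

theorem metricMatrix_inv {κ : ℝ} {x : Vec n} (hx : 0 < 1 + κ * ‖x‖ ^ 2) (i j : Fin n) :
    (metricMatrix κ x)⁻¹ i j
      = (1 + κ * ‖x‖ ^ 2) * ((if i = j then 1 else 0) + κ * x i * x j) := by
  have h : metricMatrix κ x * Matrix.of (fun i j : Fin n =>
      (1 + κ * ‖x‖ ^ 2) * ((if i = j then (1 : ℝ) else 0) + κ * x i * x j)) = 1 := by
    ext i j
    rw [Matrix.mul_apply]
    have h0 := norm_sq_eq_sum x
    have key : ∀ l, metricMatrix κ x i l * Matrix.of (fun i j : Fin n =>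
      (1 + κ * ‖x‖ ^ 2) * ((if i = j then (1 : ℝ) else 0) + κ * x i * x j)) l j
        = (if i = l then (if l = j then 1 else 0) + κ * x l * x j else 0)
          - κ * x i / (1 + κ * ‖x‖ ^ 2) * ((if l = j then x l else 0) + κ * x l ^ 2 * x j) := by
      intro l
      simp only [metricMatrix, Matrix.of_apply]
      split_ifs <;> field_simp <;> ring
    simp only [key, Finset.sum_sub_distrib, ← Finset.mul_sum, Finset.sum_add_distrib,
      ← Finset.sum_mul, Finset.sum_ite_eq, Finset.sum_ite_eq', Finset.mem_univ, if_true, ← h0,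
      Matrix.one_apply]
    field_simp
    ring
  rw [Matrix.inv_eq_right_inv h]; rfl

theorem bSq_eq_apply_sharp {κ : ℝ} {x : Vec n} (hx : 0 < 1 + κ * ‖x‖ ^ 2)
    (β : Vec n → (Vec n →L[ℝ] ℝ)) : bSq κ β x = β x (sharp κ β x) := by
  have hb : ∀ i, β x (e i) = coeffVec β x i := fun i => by
    rw [← inner_coeffVec, inner_e]
  have h1 : ∑ i, coeffVec β x i * coeffVec β x i = β x (coeffVec β x) := by
    rw [← sum_mul_apply_e]; simp [hb]
  have h2 : ∑ i, coeffVec β x i * x i = β x x := by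
    rw [← sum_mul_apply_e]; simp [hb]
  simp only [bSq, metricMatrix_inv hx, hb]
  have : ∀ i j, (1 + κ * ‖x‖ ^ 2) * ((if i = j then 1 else 0) + κ * x i * x j)
      * coeffVec β x i * coeffVec β x j
      = (if i = j then (1 + κ * ‖x‖ ^ 2) * (coeffVec β x i * coeffVec β x j) else 0)
        + (1 + κ * ‖x‖ ^ 2) * κ * (coeffVec β x i * x i) * (coeffVec β x j * x j) := by
    intro i j; split_ifs <;> ring
  simp only [this, Finset.sum_add_distrib, ← Finset.mul_sum, Finset.sum_ite_eq, Finset.mem_univ,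
    if_true, h1, h2, ← Finset.sum_mul]
  simp [sharp]; ring

theorem metricForm_sharp {κ : ℝ} {x : Vec n} (hx : 0 < 1 + κ * ‖x‖ ^ 2)
    (β : Vec n → (Vec n →L[ℝ] ℝ)) (v : Vec n) :
    metricForm κ x (sharp κ β x) v = β x v := by
  simp only [metricForm, sharp, real_inner_smul_left, inner_add_left, inner_coeffVec,
    real_inner_comm _ x, real_inner_self_eq_norm_sq]
  field_simp; ring

theorem bSq_eq_metricForm {κ : ℝ} {x : Vec n} (hx : 0 < 1 + κ * ‖x‖ ^ 2)
    (β : Vec n → (Vec n →L[ℝ] ℝ)) :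
    bSq κ β x = metricForm κ x (sharp κ β x) (sharp κ β x) := by
  rw [metricForm_sharp hx, bSq_eq_apply_sharp hx]

theorem bSq_nonneg {κ : ℝ} {x : Vec n} (hx : 0 < 1 + κ * ‖x‖ ^ 2)
    (β : Vec n → (Vec n →L[ℝ] ℝ)) : 0 ≤ bSq κ β x := by
  rw [bSq_eq_metricForm hx]; exact metricForm_self_nonneg hx _

theorem bSq_eq_zero_iff {κ : ℝ} {x : Vec n} (hx : 0 < 1 + κ * ‖x‖ ^ 2)
    (β : Vec n → (Vec n →L[ℝ] ℝ)) : bSq κ β x = 0 ↔ β x = 0 := by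
  constructor
  · intro h
    have h1 : sharp κ β x = 0 := by
      by_contra hne
      exact (metricForm_pos hx hne).ne' (by rw [← bSq_eq_metricForm hx, h])
    ext v
    rw [← metricForm_sharp hx, h1]; simp [metricForm]
  · intro h
    rw [bSq_eq_apply_sharp hx, h]; rfl

theorem bSq_pos {κ : ℝ} {x : Vec n} (hx : 0 < 1 + κ * ‖x‖ ^ 2)
    {β : Vec n → (Vec n →L[ℝ] ℝ)} (h : β x ≠ 0) : 0 < bSq κ β x :=
  lt_of_le_of_ne (bSq_nonneg hx β) fun h0 => h ((bSq_eq_zero_iff hx β).1 h0.symm)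

/-- The Cauchy-Schwarz inequality `β(u)² ≤ b² α(u)²`, so that `(b², β / α)` lies in the set `|s| ≤ b`. -/
theorem sq_apply_le {κ : ℝ} {x : Vec n} (hx : 0 < 1 + κ * ‖x‖ ^ 2)
    (β : Vec n → (Vec n →L[ℝ] ℝ)) (u : Vec n) :
    β x u ^ 2 ≤ bSq κ β x * metricForm κ x u u := by
  rcases eq_or_ne (β x) 0 with h | h
  · rw [(bSq_eq_zero_iff hx β).2 h, h]; simp
  have hB := bSq_pos hx h
  have h1 := metricForm_self_nonneg hx (bSq κ β x • u + (-β x u) • sharp κ β x)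
  simp only [metricForm_add_left, metricForm_add_right, metricForm_smul_left,
    metricForm_smul_right, metricForm_sharp hx, metricForm_comm κ x u (sharp κ β x),
    ← bSq_eq_apply_sharp hx] at h1
  have h2 : 0 ≤ bSq κ β x * (bSq κ β x * metricForm κ x u u - β x u ^ 2) := by
    nlinarith
  nlinarith [nonneg_of_mul_nonneg_right h2 hB]

theorem eventually_conf_pos {κ : ℝ} {x : Vec n} (hx : 0 < 1 + κ * ‖x‖ ^ 2) :
    ∀ᶠ z in 𝓝 x, 0 < 1 + κ * ‖z‖ ^ 2 := by
  have : Continuous fun z : Vec n => 1 + κ * ‖z‖ ^ 2 := by fun_prop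
  exact this.continuousAt.eventually (lt_mem_nhds hx)

theorem differentiableAt_coeffVec {β : Vec n → (Vec n →L[ℝ] ℝ)} {x : Vec n}
    (hβ : DifferentiableAt ℝ β x) : DifferentiableAt ℝ (coeffVec β) x := by
  unfold coeffVec
  exact DifferentiableAt.fun_sum fun i _ =>
    (hβ.clm_apply (differentiableAt_const _)).smul_const _

theorem differentiableAt_sharp {κ : ℝ} {β : Vec n → (Vec n →L[ℝ] ℝ)} {x : Vec n}
    (hβ : DifferentiableAt ℝ β x) : DifferentiableAt ℝ (sharp κ β) x := by
  have h := differentiableAt_coeffVec hβ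
  unfold sharp
  have h2 : DifferentiableAt ℝ (fun z => β z z) x := hβ.clm_apply differentiableAt_id
  have h3 : DifferentiableAt ℝ (fun z : Vec n => 1 + κ * ‖z‖ ^ 2) x :=
    (((differentiable_id.norm_sq ℝ).const_mul κ).const_add 1) x
  exact h3.smul (h.add ((h2.const_mul κ).smul differentiableAt_id))

theorem differentiableAt_bSq {κ : ℝ} {β : Vec n → (Vec n →L[ℝ] ℝ)} {x : Vec n}
    (hx : 0 < 1 + κ * ‖x‖ ^ 2) (hβ : DifferentiableAt ℝ β x) :
    DifferentiableAt ℝ (bSq κ β) x := by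
  have h : bSq κ β =ᶠ[𝓝 x] fun z => β z (sharp κ β z) := by
    filter_upwards [eventually_conf_pos hx] with z hz using bSq_eq_apply_sharp hz β
  exact (hβ.clm_apply (differentiableAt_sharp hβ)).congr_of_eventuallyEq h

/-- `d(b²) = 2 b^i b_{i|j} dxʲ`, because `α_κ` is parallel. -/
theorem fderiv_bSq {κ : ℝ} {β : Vec n → (Vec n →L[ℝ] ℝ)} {x : Vec n}
    (hx : 0 < 1 + κ * ‖x‖ ^ 2) (hβ : DifferentiableAt ℝ β x) (v : Vec n) :
    fderiv ℝ (bSq κ β) x v = 2 * cov κ β x (sharp κ β x) v := by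
  have hline : HasDerivAt (fun t : ℝ => x + t • v) v 0 := by
    simpa using ((hasDerivAt_id (0 : ℝ)).smul_const v).const_add x
  have hx0 : x + (0 : ℝ) • v = x := by simp
  have hB : HasDerivAt (fun t : ℝ => bSq κ β (x + t • v)) (fderiv ℝ (bSq κ β) x v) 0 := by
    have h1 : HasFDerivAt (bSq κ β) (fderiv ℝ (bSq κ β) x) (x + (0 : ℝ) • v) := by
      rw [hx0]; exact (differentiableAt_bSq hx hβ).hasFDerivAt
    exact h1.comp_hasDerivAt 0 hline
  have hb : HasDerivAt (fun t : ℝ => coeffVec β (x + t • v)) (fderiv ℝ (coeffVec β) x v) 0 := by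
    have h1 : HasFDerivAt (coeffVec β) (fderiv ℝ (coeffVec β) x) (x + (0 : ℝ) • v) := by
      rw [hx0]; exact (differentiableAt_coeffVec hβ).hasFDerivAt
    exact h1.comp_hasDerivAt 0 hline
  have hF : HasDerivAt (fun t : ℝ => (1 + κ * inner ℝ (x + t • v) (x + t • v)) *
      (inner ℝ (coeffVec β (x + t • v)) (coeffVec β (x + t • v))
        + κ * inner ℝ (coeffVec β (x + t • v)) (x + t • v)
            * inner ℝ (coeffVec β (x + t • v)) (x + t • v))) _ 0 :=
    (((hline.inner ℝ hline).const_mul κ).const_add 1).mul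
      ((hb.inner ℝ hb).add (((hb.inner ℝ hline).const_mul κ).mul (hb.inner ℝ hline)))
  have heq : (fun t : ℝ => bSq κ β (x + t • v)) =ᶠ[𝓝 0]
      (fun t : ℝ => (1 + κ * inner ℝ (x + t • v) (x + t • v)) *
      (inner ℝ (coeffVec β (x + t • v)) (coeffVec β (x + t • v))
        + κ * inner ℝ (coeffVec β (x + t • v)) (x + t • v)
            * inner ℝ (coeffVec β (x + t • v)) (x + t • v))) := by
    have hev : ∀ᶠ t in 𝓝 (0 : ℝ), 0 < 1 + κ * ‖x + t • v‖ ^ 2 := by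
      have := hline.continuousAt.eventually (p := fun z => 0 < 1 + κ * ‖z‖ ^ 2)
      simp only [hx0] at this
      exact this (eventually_conf_pos hx)
    filter_upwards [hev] with t ht
    rw [bSq_eq_apply_sharp ht]
    simp only [sharp, inner_coeffVec, map_smul, map_add, smul_eq_mul, real_inner_self_eq_norm_sq]
    rw [← real_inner_self_eq_norm_sq (coeffVec β (x + t • v)), inner_coeffVec]
  rw [hB.unique (hF.congr_of_eventuallyEq heq)]
  have hd : ∀ w, inner ℝ (fderiv ℝ (coeffVec β) x v) w = fderiv ℝ β x v w := fun w => by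
    have h1 : (fun z => inner ℝ (coeffVec β z) w) = fun z => β z w := by
      ext z; exact inner_coeffVec β z w
    have h2 := ((differentiableAt_coeffVec hβ).hasFDerivAt.inner ℝ (hasFDerivAt_const w x))
    have h3 := hβ.hasFDerivAt.clm_apply (hasFDerivAt_const w x)
    rw [h1] at h2
    have := congrArg (fun L => L v) (h2.unique h3)
    simpa [fderivInnerCLM_apply] using this
  have hd' : ∀ w, inner ℝ w (fderiv ℝ (coeffVec β) x v) = fderiv ℝ β x v w := fun w => by
    rw [real_inner_comm, hd]
  have hBx : bSq κ β x = (1 + κ * ‖x‖ ^ 2) * (β x (coeffVec β x) + κ * β x x * β x x) := by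
    rw [bSq_eq_apply_sharp hx]; simp [sharp]; ring
  have hs : inner ℝ x (sharp κ β x) = (1 + κ * ‖x‖ ^ 2) * (β x x + κ * β x x * ‖x‖ ^ 2) := by
    rw [sharp, real_inner_smul_right, inner_add_right, real_inner_smul_right, real_inner_comm,
      inner_coeffVec, real_inner_self_eq_norm_sq]
  have hf : fderiv ℝ β x v (sharp κ β x) = (1 + κ * ‖x‖ ^ 2) *
      (fderiv ℝ β x v (coeffVec β x) + κ * β x x * fderiv ℝ β x v x) := by
    simp [sharp]; ring
  have hbs : β x (sharp κ β x) = bSq κ β x := (bSq_eq_apply_sharp hx β).symm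
  simp only [zero_smul, add_zero, hd, hd', inner_coeffVec, real_inner_comm x v, cov, hs, hf, hbs,
    hBx]
  rw [real_inner_self_eq_norm_sq]
  field_simp
  ring

theorem fderiv_metricMatrix {κ : ℝ} {x : Vec n} (hx : 0 < 1 + κ * ‖x‖ ^ 2) (i j l : Fin n) :
    fderiv ℝ (fun x' => metricMatrix κ x' j l) x (e i)
      = -2 * κ * x i * (if j = l then 1 else 0) / (1 + κ * ‖x‖ ^ 2) ^ 2
        - κ * ((if i = j then 1 else 0) * x l + (if i = l then 1 else 0) * x j)
            / (1 + κ * ‖x‖ ^ 2) ^ 2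
        + 4 * κ ^ 2 * x i * x j * x l / (1 + κ * ‖x‖ ^ 2) ^ 3 := by
  have hc : ∀ m : Fin n, HasFDerivAt (fun z : Vec n => z m)
      (EuclideanSpace.proj m : Vec n →L[ℝ] ℝ) x := fun m =>
    (EuclideanSpace.proj m : Vec n →L[ℝ] ℝ).hasFDerivAt
  have hW : HasFDerivAt (fun z : Vec n => 1 + κ * ‖z‖ ^ 2) (κ • (2 • (innerSL ℝ x))) x := by
    have := (((hasStrictFDerivAt_norm_sq x).hasFDerivAt).const_mul κ).const_add 1
    simpa using this
  have h1 := (hasFDerivAt_const (if j = l then (1 : ℝ) else 0) x).mul ((hasDerivAt_inv hx.ne').comp_hasFDerivAt x hW)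
  have h2 := (((hc j).const_mul κ).mul (hc l)).mul
    ((hasDerivAt_inv (pow_pos hx 2).ne').comp_hasFDerivAt x (hW.pow 2))
  have h3 := h1.sub h2
  have hfun : (fun x' => metricMatrix κ x' j l) =
      (fun z : Vec n => (if j = l then (1 : ℝ) else 0) * (1 + κ * ‖z‖ ^ 2)⁻¹
        - κ * z j * z l * ((1 + κ * ‖z‖ ^ 2) ^ 2)⁻¹) := by
    funext z
    simp only [metricMatrix, Matrix.of_apply, div_eq_mul_inv]
  rw [hfun]
  refine (congrArg (fun L => L (e i)) h3.fderiv).trans ?_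
  have he : ∀ m : Fin n, (e i : Vec n) m = if i = m then 1 else 0 := fun m => by
    simp [e, eq_comm]
  have hp : ∀ m : Fin n, (EuclideanSpace.proj m : Vec n →L[ℝ] ℝ) (e i) = if i = m then 1 else 0 :=
    fun m => he m
  simp only [sub_apply, add_apply,
    smul_apply, smul_eq_mul, innerSL_apply_apply, inner_e, hp,
    zero_apply, Pi.mul_apply, Function.comp_apply, nsmul_eq_mul]
  have hW0 := hx.ne'
  generalize 1 + κ * ‖x‖ ^ 2 = w at hW0 ⊢
  push_cast
  field_simp
  ring

/-- In these coordinates the geodesics of `α_κ` are straight lines, which is why the Christoffel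
symbols have the form `-(θᵢ δᵏⱼ + θⱼ δᵏᵢ)`. -/
theorem christoffel_eq {κ : ℝ} {x : Vec n} (hx : 0 < 1 + κ * ‖x‖ ^ 2) (k i j : Fin n) :
    christoffel κ x k i j = -(κ / (1 + κ * ‖x‖ ^ 2))
      * (x i * (if k = j then 1 else 0) + x j * (if k = i then 1 else 0)) := by
  have hL : ∀ l, fderiv ℝ (fun x' => metricMatrix κ x' j l) x (e i)
      + fderiv ℝ (fun x' => metricMatrix κ x' i l) x (e j)
      - fderiv ℝ (fun x' => metricMatrix κ x' i j) x (e l)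
      = -2 * κ / (1 + κ * ‖x‖ ^ 2) ^ 2 *
          ((if j = l then 1 else 0) * x i + (if i = l then 1 else 0) * x j)
        + 4 * κ ^ 2 * x i * x j * x l / (1 + κ * ‖x‖ ^ 2) ^ 3 := by
    intro l
    rw [fderiv_metricMatrix hx, fderiv_metricMatrix hx, fderiv_metricMatrix hx]
    have e1 : (if j = i then (1 : ℝ) else 0) = if i = j then 1 else 0 := by simp [eq_comm]
    have e2 : (if l = i then (1 : ℝ) else 0) = if i = l then 1 else 0 := by simp [eq_comm]
    have e3 : (if l = j then (1 : ℝ) else 0) = if j = l then 1 else 0 := by simp [eq_comm]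
    rw [e1, e2, e3]
    ring
  have hterm : ∀ l, (metricMatrix κ x)⁻¹ k l *
      (fderiv ℝ (fun x' => metricMatrix κ x' j l) x (e i)
      + fderiv ℝ (fun x' => metricMatrix κ x' i l) x (e j)
      - fderiv ℝ (fun x' => metricMatrix κ x' i j) x (e l))
      = (if k = l then -2 * κ / (1 + κ * ‖x‖ ^ 2) *
            ((if j = l then 1 else 0) * x i + (if i = l then 1 else 0) * x j)
          + 4 * κ ^ 2 * x i * x j * x l / (1 + κ * ‖x‖ ^ 2) ^ 2 else 0)
        + κ * x k * ((if j = l then -2 * κ / (1 + κ * ‖x‖ ^ 2) * x i * x l else 0)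
          + (if i = l then -2 * κ / (1 + κ * ‖x‖ ^ 2) * x j * x l else 0)
          + 4 * κ ^ 2 * x i * x j / (1 + κ * ‖x‖ ^ 2) ^ 2 * x l ^ 2) := by
    intro l
    rw [hL, metricMatrix_inv hx]
    split_ifs <;> field_simp <;> ring
  have h0 := norm_sq_eq_sum x
  rw [christoffel]
  simp only [hterm, Finset.sum_add_distrib, ← Finset.mul_sum, Finset.sum_ite_eq, Finset.mem_univ,
    if_true, ← h0]
  have e1 : (if j = k then (1 : ℝ) else 0) = if k = j then 1 else 0 := by simp [eq_comm]
  have e2 : (if i = k then (1 : ℝ) else 0) = if k = i then 1 else 0 := by simp [eq_comm]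
  rw [e1, e2]
  field_simp
  ring

theorem covDeriv_eq_cov {κ : ℝ} {x : Vec n} (hx : 0 < 1 + κ * ‖x‖ ^ 2)
    {β : Vec n → (Vec n →L[ℝ] ℝ)} (hβ : DifferentiableAt ℝ β x) (i j : Fin n) :
    covDeriv κ β x i j = cov κ β x (e i) (e j) := by
  have h1 : fderiv ℝ (fun x' => β x' (e i)) x (e j) = fderiv ℝ β x (e j) (e i) := by
    have := (hβ.hasFDerivAt.clm_apply (hasFDerivAt_const (e i) x)).fderiv
    rw [this]; simp
  rw [covDeriv, h1, cov, inner_e, inner_e]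
  simp only [christoffel_eq hx]
  have : ∀ k, -(κ / (1 + κ * ‖x‖ ^ 2))
      * (x i * (if k = j then 1 else 0) + x j * (if k = i then 1 else 0)) * β x (e k)
      = (if k = j then -(κ / (1 + κ * ‖x‖ ^ 2)) * x i * β x (e k) else 0)
        + (if k = i then -(κ / (1 + κ * ‖x‖ ^ 2)) * x j * β x (e k) else 0) := by
    intro k; split_ifs <;> ring
  simp only [this, Finset.sum_add_distrib, Finset.sum_ite_eq', Finset.mem_univ, if_true]
  ring

/-! ### Hamel's criterion for projective flatness -/

/-- Hamel's expression `F_{xᵏ yˡ} yᵏ vˡ - F_{xˡ} vˡ`, the Euler-Lagrange form of `F` evaluated along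
straight lines. -/
def hamel (F : Vec n → Vec n → ℝ) (x y v : Vec n) : ℝ :=
  fderiv ℝ (fun y' => fderiv ℝ (fun x' => F x' y') x y) y v - fderiv ℝ (fun x' => F x' y) x v

section
variable {U : Set (Vec n)} {F : Vec n → Vec n → ℝ} {x y : Vec n}

theorem contDiffAt_of_smooth (hU : IsOpen U)
    (hs : ContDiffOn ℝ ∞ (fun p : Vec n × Vec n => F p.1 p.2) (U ×ˢ {0}ᶜ)) (hx : x ∈ U)
    (hy : y ≠ 0) : ContDiffAt ℝ ∞ (fun p : Vec n × Vec n => F p.1 p.2) (x, y) :=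
  hs.contDiffAt ((hU.prod isOpen_compl_singleton).mem_nhds ⟨hx, hy⟩)

theorem hasFDerivAt_fst (hU : IsOpen U)
    (hs : ContDiffOn ℝ ∞ (fun p : Vec n × Vec n => F p.1 p.2) (U ×ˢ {0}ᶜ)) (hx : x ∈ U)
    (hy : y ≠ 0) : HasFDerivAt (fun x' => F x' y)
      ((fderiv ℝ (fun p : Vec n × Vec n => F p.1 p.2) (x, y)).comp
        (ContinuousLinearMap.inl ℝ (Vec n) (Vec n))) x :=
  HasFDerivAt.comp (g := fun p : Vec n × Vec n => F p.1 p.2) (f := fun x' => (x', y)) x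
    ((contDiffAt_of_smooth hU hs hx hy).differentiableAt (by simp)).hasFDerivAt
    (hasFDerivAt_prodMk_left x y)

theorem hasFDerivAt_snd (hU : IsOpen U)
    (hs : ContDiffOn ℝ ∞ (fun p : Vec n × Vec n => F p.1 p.2) (U ×ˢ {0}ᶜ)) (hx : x ∈ U)
    (hy : y ≠ 0) : HasFDerivAt (fun y' => F x y')
      ((fderiv ℝ (fun p : Vec n × Vec n => F p.1 p.2) (x, y)).comp
        (ContinuousLinearMap.inr ℝ (Vec n) (Vec n))) y :=
  HasFDerivAt.comp (g := fun p : Vec n × Vec n => F p.1 p.2) (f := fun y' => (x, y')) y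
    ((contDiffAt_of_smooth hU hs hx hy).differentiableAt (by simp)).hasFDerivAt
    (hasFDerivAt_prodMk_right x y)

theorem contDiffAt_snd (hU : IsOpen U)
    (hs : ContDiffOn ℝ ∞ (fun p : Vec n × Vec n => F p.1 p.2) (U ×ˢ {0}ᶜ)) (hx : x ∈ U)
    (hy : y ≠ 0) : ContDiffAt ℝ ∞ (fun y' => F x y') y :=
  (contDiffAt_of_smooth hU hs hx hy).comp y (contDiffAt_const.prodMk contDiffAt_id)

theorem differentiableAt_fderiv_fst (hU : IsOpen U)
    (hs : ContDiffOn ℝ ∞ (fun p : Vec n × Vec n => F p.1 p.2) (U ×ˢ {0}ᶜ)) (hx : x ∈ U)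
    (hy : y ≠ 0) (u : Vec n) :
    DifferentiableAt ℝ (fun y' => fderiv ℝ (fun x' => F x' y') x u) y := by
  have h : (fun y' => fderiv ℝ (fun x' => F x' y') x u) =ᶠ[𝓝 y]
      fun y' => fderiv ℝ (fun p : Vec n × Vec n => F p.1 p.2) (x, y') (u, 0) := by
    filter_upwards [isOpen_compl_singleton.mem_nhds hy] with y' hy'
    rw [(hasFDerivAt_fst hU hs hx hy').fderiv]; simp
  refine DifferentiableAt.congr_of_eventuallyEq ?_ h
  have h1 : ContDiffAt ℝ ∞ (fderiv ℝ (fun p : Vec n × Vec n => F p.1 p.2)) (x, y) :=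
    (contDiffAt_of_smooth hU hs hx hy).fderiv_right (by simp)
  have h2 : DifferentiableAt ℝ
      (fun y' => fderiv ℝ (fun p : Vec n × Vec n => F p.1 p.2) (x, y')) y :=
    DifferentiableAt.comp (g := fderiv ℝ (fun p : Vec n × Vec n => F p.1 p.2))
      (f := fun y' => (x, y')) y (h1.differentiableAt (by simp))
      ((differentiableAt_const x).prodMk differentiableAt_id)
  exact h2.clm_apply (differentiableAt_const _)

theorem sum_dx (F : Vec n → Vec n → ℝ) (x y u : Vec n) :
    ∑ k, dx k F x y * u k = fderiv ℝ (fun x' => F x' y) x u :=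
  sum_mul_apply_e _ u

theorem sum_dy_dx (hU : IsOpen U)
    (hs : ContDiffOn ℝ ∞ (fun p : Vec n × Vec n => F p.1 p.2) (U ×ˢ {0}ᶜ)) (hx : x ∈ U)
    (hy : y ≠ 0) (l : Fin n) :
    ∑ m, dy l (dx m F) x y * y m - dx l F x y = hamel F x y (e l) := by
  unfold hamel
  congr 1
  have h : (fun y' => fderiv ℝ (fun x' => F x' y') x y) =
      fun y' => ∑ m, dx m F x y' * y m := by
    funext y'; rw [sum_dx]
  rw [h]
  have h2 : HasFDerivAt (fun y' => ∑ m, dx m F x y' * y m)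
      (∑ m, y m • fderiv ℝ (fun y' => dx m F x y') y) y :=
    HasFDerivAt.fun_sum fun m _ =>
      (differentiableAt_fderiv_fst hU hs hx hy (e m)).hasFDerivAt.mul_const (y m)
  rw [h2.fderiv]
  simp [dy, mul_comm]

theorem dx_sqr (hU : IsOpen U)
    (hs : ContDiffOn ℝ ∞ (fun p : Vec n × Vec n => F p.1 p.2) (U ×ˢ {0}ᶜ)) (hx : x ∈ U)
    (hy : y ≠ 0) (m : Fin n) : dx m (sqr F) x y = 2 * F x y * dx m F x y := by
  have h := (hasFDerivAt_fst hU hs hx hy).differentiableAt.hasFDerivAt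
  simp only [dx, sqr]
  rw [(h.pow 2).fderiv]
  simp

theorem dy_sqr (hU : IsOpen U)
    (hs : ContDiffOn ℝ ∞ (fun p : Vec n × Vec n => F p.1 p.2) (U ×ˢ {0}ᶜ)) (hx : x ∈ U)
    (hy : y ≠ 0) (m : Fin n) : dy m (sqr F) x y = 2 * F x y * dy m F x y := by
  have h := (hasFDerivAt_snd hU hs hx hy).differentiableAt.hasFDerivAt
  simp only [dy, sqr]
  rw [(h.pow 2).fderiv]
  simp

theorem dy_dx_sqr (hU : IsOpen U)
    (hs : ContDiffOn ℝ ∞ (fun p : Vec n × Vec n => F p.1 p.2) (U ×ˢ {0}ᶜ)) (hx : x ∈ U)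
    (hy : y ≠ 0) (l m : Fin n) : dy l (dx m (sqr F)) x y
      = 2 * dy l F x y * dx m F x y + 2 * F x y * dy l (dx m F) x y := by
  have h : (fun y' => dx m (sqr F) x y') =ᶠ[𝓝 y] fun y' => 2 * F x y' * dx m F x y' := by
    filter_upwards [isOpen_compl_singleton.mem_nhds hy] with y' hy'
    exact dx_sqr hU hs hx hy' m
  have h1 := (hasFDerivAt_snd hU hs hx hy).differentiableAt.hasFDerivAt
  have h2 := (differentiableAt_fderiv_fst hU hs hx hy (e m)).hasFDerivAt
  have h3 := (h1.const_mul 2).mul h2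
  rw [dy, h.fderiv_eq]
  refine (congrArg (fun L => L (e l)) h3.fderiv).trans ?_
  simp only [add_apply, smul_apply, smul_eq_mul, dy, dx]
  ring

/-- Euler's relation for the derivative of a function that is homogeneous of degree two. -/
theorem dy_homogeneous {G : Vec n → ℝ} {y : Vec n} (hG : ContDiffAt ℝ ∞ G y) (hy : y ≠ 0)
    (hh : ∀ z, z ≠ 0 → ∀ t : ℝ, 0 < t → G (t • z) = t ^ 2 * G z) (i : Fin n)
    (hd : ∀ z, z ≠ 0 → DifferentiableAt ℝ G z) :
    fderiv ℝ (fun z => fderiv ℝ G z (e i)) y y = fderiv ℝ G y (e i) := by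
  have hline : HasDerivAt (fun t : ℝ => t • y) y 1 := by
    simpa using (hasDerivAt_id (1 : ℝ)).smul_const y
  have h1 : HasFDerivAt (fun z => fderiv ℝ G z (e i))
      (fderiv ℝ (fun z => fderiv ℝ G z (e i)) y) ((1 : ℝ) • y) := by
    rw [one_smul]
    have : ContDiffAt ℝ ∞ (fderiv ℝ G) y := hG.fderiv_right (by simp)
    exact ((this.differentiableAt (by simp)).clm_apply (differentiableAt_const _)).hasFDerivAt
  have h2 := h1.comp_hasDerivAt 1 hline
  have h3 : ∀ t : ℝ, 0 < t → fderiv ℝ G (t • y) (e i) = t * fderiv ℝ G y (e i) := by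
    intro t ht
    have hty : t • y ≠ 0 := smul_ne_zero ht.ne' hy
    have hA : HasFDerivAt (fun z => G (t • z)) (t • fderiv ℝ G (t • y)) y := by
      have := (hd _ hty).hasFDerivAt.comp y ((hasFDerivAt_id y).const_smul t)
      refine this.congr_fderiv ?_
      ext v; simp
    have hB : HasFDerivAt (fun z => G (t • z)) (t ^ 2 • fderiv ℝ G y) y := by
      refine ((hd y hy).hasFDerivAt.const_mul (t ^ 2)).congr_of_eventuallyEq ?_
      filter_upwards [isOpen_compl_singleton.mem_nhds hy] with z hz using hh z hz t ht
    have := congrArg (fun L => L (e i)) (hA.unique hB)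
    simp only [smul_apply, smul_eq_mul] at this
    have ht' := ht.ne'
    field_simp at this
    linarith
  have h4 : HasDerivAt (fun t : ℝ => t * fderiv ℝ G y (e i)) (fderiv ℝ G y (e i)) 1 := by
    simpa using (hasDerivAt_id (1 : ℝ)).mul_const (fderiv ℝ G y (e i))
  have h5 : ((fun z => fderiv ℝ G z (e i)) ∘ fun t : ℝ => t • y) =ᶠ[𝓝 1]
      fun t : ℝ => t * fderiv ℝ G y (e i) := by
    filter_upwards [lt_mem_nhds (zero_lt_one' ℝ)] with t ht using h3 t ht
  exact h2.unique (h4.congr_of_eventuallyEq h5)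

/-- `g_{ij} yʲ = F F_{yⁱ}`. -/
theorem fundamentalTensor_mulVec (hU : IsOpen U) (hF : IsFinslerMetric U F) (hx : x ∈ U)
    (hy : y ≠ 0) : (fundamentalTensor F x y).mulVec (fun j => y j) =
      fun i => F x y * dy i F x y := by
  have hs := hF.smooth
  funext i
  have h1 : (fundamentalTensor F x y).mulVec (fun j => y j) i
      = (1 / 2) * fderiv ℝ (fun y' => dy i (sqr F) x y') y y := by
    rw [← sum_mul_apply_e, Finset.mul_sum]
    simp only [Matrix.mulVec, dotProduct, fundamentalTensor, Matrix.of_apply]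
    exact Finset.sum_congr rfl fun j _ => by simp only [dy]; ring
  have h2 := dy_homogeneous (G := fun z => sqr F x z) (y := y)
    ((contDiffAt_snd hU hs hx hy).pow 2) hy
    (fun z _ t ht => by simp only [sqr]; rw [hF.homogeneous x hx z t ht]; ring) i
    (fun z hz => ((contDiffAt_snd hU hs hx hz).pow 2).differentiableAt (by simp))
  rw [h1]
  have h3 := dy_sqr hU hs hx hy i
  simp only [dy] at h2 h3 ⊢
  rw [h2, h3]; ring

/-- The geodesic coefficients split into a multiple of `y` and the contribution of Hamel's
expression, so that projective flatness is the vanishing of the latter. -/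
theorem geodesicCoeff_eq (hU : IsOpen U) (hF : IsFinslerMetric U F) (hx : x ∈ U)
    (hy : y ≠ 0) (i : Fin n) : geodesicCoeff F x y i =
      fderiv ℝ (fun x' => F x' y) x y / (2 * F x y) * y i
        + F x y / 2 * ((fundamentalTensor F x y)⁻¹.mulVec fun l => hamel F x y (e l)) i := by
  have hs := hF.smooth
  have hpos := hF.pos x hx y hy
  have hdet : IsUnit (fundamentalTensor F x y).det := (hF.posDef x hx y hy).det_pos.ne'.isUnit
  have h1 : (fundamentalTensor F x y)⁻¹.mulVec (fun l => F x y * dy l F x y) = fun j => y j := by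
    rw [← fundamentalTensor_mulVec hU hF hx hy, Matrix.mulVec_mulVec, Matrix.nonsing_inv_mul _ hdet,
      Matrix.one_mulVec]
  have h1i : ∑ l, (fundamentalTensor F x y)⁻¹ i l * (F x y * dy l F x y) = y i :=
    congrFun h1 i
  have h2 : ∀ l, (∑ m, dy l (dx m (sqr F)) x y * y m) - dx l (sqr F) x y
      = 2 * fderiv ℝ (fun x' => F x' y) x y / F x y * (F x y * dy l F x y)
        + 2 * F x y * hamel F x y (e l) := by
    intro l
    rw [← sum_dy_dx hU hs hx hy, dx_sqr hU hs hx hy, ← sum_dx F x y y]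
    simp only [dy_dx_sqr hU hs hx hy, add_mul, Finset.sum_add_distrib, mul_assoc,
      ← Finset.mul_sum]
    field_simp
    ring
  rw [geodesicCoeff]
  simp only [h2, mul_add, Finset.sum_add_distrib, Matrix.mulVec, dotProduct]
  have h3 : ∑ l, (fundamentalTensor F x y)⁻¹ i l *
      (2 * fderiv ℝ (fun x' => F x' y) x y / F x y * (F x y * dy l F x y))
      = 2 * fderiv ℝ (fun x' => F x' y) x y / F x y * y i := by
    rw [← h1i, Finset.mul_sum]; exact Finset.sum_congr rfl fun l _ => by ring
  have h4 : ∑ l, (fundamentalTensor F x y)⁻¹ i l * (2 * F x y * hamel F x y (e l))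
      = 2 * F x y * ∑ l, (fundamentalTensor F x y)⁻¹ i l * hamel F x y (e l) := by
    rw [Finset.mul_sum]; exact Finset.sum_congr rfl fun l _ => by ring
  rw [h3, h4]
  field_simp
  ring

theorem geodesicCoeff_eq_iff (hU : IsOpen U) (hF : IsFinslerMetric U F) (hx : x ∈ U)
    (hy : y ≠ 0) : (∀ i, geodesicCoeff F x y i =
      fderiv ℝ (fun x' => F x' y) x y / (2 * F x y) * y i) ↔ ∀ v, hamel F x y v = 0 := by
  have hpos := hF.pos x hx y hy
  have hdet : IsUnit (fundamentalTensor F x y).det := (hF.posDef x hx y hy).det_pos.ne'.isUnit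
  constructor
  · intro h v
    have h1 : (fundamentalTensor F x y)⁻¹.mulVec (fun l => hamel F x y (e l)) = 0 := by
      funext i
      have := h i
      rw [geodesicCoeff_eq hU hF hx hy, add_eq_left] at this
      exact (mul_eq_zero.1 this).resolve_left (by positivity)
    have h2 : (fun l => hamel F x y (e l)) = 0 := by
      have := congrArg (fundamentalTensor F x y).mulVec h1
      rwa [Matrix.mulVec_mulVec, Matrix.mul_nonsing_inv _ hdet, Matrix.one_mulVec,
        Matrix.mulVec_zero] at this
    have h3 : hamel F x y v = ∑ l, hamel F x y (e l) * v l := by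
      simp only [hamel, sub_mul, Finset.sum_sub_distrib, sum_mul_apply_e]
    rw [h3]
    exact Finset.sum_eq_zero fun l _ => by rw [show hamel F x y (e l) = 0 from congrFun h2 l]; simp
  · intro h i
    rw [geodesicCoeff_eq hU hF hx hy, show (fun l => hamel F x y (e l)) = 0 from funext fun l => h _]
    simp

theorem isProjectivelyFlat_iff (hU : IsOpen U) (hF : IsFinslerMetric U F) :
    IsProjectivelyFlat U F ↔ ∀ x ∈ U, ∀ y, y ≠ 0 → ∀ v, hamel F x y v = 0 := by
  unfold IsProjectivelyFlat
  simp only [sum_dx]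
  exact forall₂_congr fun x hx => forall₂_congr fun y hy => geodesicCoeff_eq_iff hU hF hx hy

end

/-! ### Partial derivatives of `φ` -/
section
variable {φ : ℝ → ℝ → ℝ} {Ω : Set (ℝ × ℝ)}

theorem hasFDerivAt_uncurry (hΩ : IsOpen Ω)
    (hφ : ContDiffOn ℝ ∞ (fun p : ℝ × ℝ => φ p.1 p.2) Ω) {B s : ℝ} (h : (B, s) ∈ Ω) :
    HasFDerivAt (fun p : ℝ × ℝ => φ p.1 p.2) (fderiv ℝ (fun p : ℝ × ℝ => φ p.1 p.2) (B, s)) (B, s) :=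
  ((hφ.contDiffAt (hΩ.mem_nhds h)).differentiableAt (by simp)).hasFDerivAt

theorem hasDerivAt_d1 (hΩ : IsOpen Ω)
    (hφ : ContDiffOn ℝ ∞ (fun p : ℝ × ℝ => φ p.1 p.2) Ω) {B s : ℝ} (h : (B, s) ∈ Ω) :
    HasDerivAt (fun B' => φ B' s) (d1 φ B s) B := by
  have := (hasFDerivAt_uncurry hΩ hφ h).comp_hasDerivAt (f := fun B' => (B', s)) B
    ((hasDerivAt_id B).prodMk (hasDerivAt_const B s))
  exact this.differentiableAt.hasDerivAt

theorem hasDerivAt_d2 (hΩ : IsOpen Ω)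
    (hφ : ContDiffOn ℝ ∞ (fun p : ℝ × ℝ => φ p.1 p.2) Ω) {B s : ℝ} (h : (B, s) ∈ Ω) :
    HasDerivAt (fun s' => φ B s') (d2 φ B s) s := by
  have := (hasFDerivAt_uncurry hΩ hφ h).comp_hasDerivAt (f := fun s' => (B, s')) s
    ((hasDerivAt_const s B).prodMk (hasDerivAt_id s))
  exact this.differentiableAt.hasDerivAt

theorem d1_eq (hΩ : IsOpen Ω)
    (hφ : ContDiffOn ℝ ∞ (fun p : ℝ × ℝ => φ p.1 p.2) Ω) {B s : ℝ} (h : (B, s) ∈ Ω) :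
    d1 φ B s = fderiv ℝ (fun p : ℝ × ℝ => φ p.1 p.2) (B, s) (1, 0) :=
  (hasDerivAt_d1 hΩ hφ h).unique ((hasFDerivAt_uncurry hΩ hφ h).comp_hasDerivAt
    (f := fun B' => (B', s)) B ((hasDerivAt_id B).prodMk (hasDerivAt_const B s)))

theorem d2_eq (hΩ : IsOpen Ω)
    (hφ : ContDiffOn ℝ ∞ (fun p : ℝ × ℝ => φ p.1 p.2) Ω) {B s : ℝ} (h : (B, s) ∈ Ω) :
    d2 φ B s = fderiv ℝ (fun p : ℝ × ℝ => φ p.1 p.2) (B, s) (0, 1) :=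
  (hasDerivAt_d2 hΩ hφ h).unique ((hasFDerivAt_uncurry hΩ hφ h).comp_hasDerivAt
    (f := fun s' => (B, s')) s ((hasDerivAt_const s B).prodMk (hasDerivAt_id s)))

theorem hasDerivAt_comp_uncurry (hΩ : IsOpen Ω)
    (hφ : ContDiffOn ℝ ∞ (fun p : ℝ × ℝ => φ p.1 p.2) Ω) {b s : ℝ → ℝ} {b' s' t : ℝ}
    (h : (b t, s t) ∈ Ω) (hb : HasDerivAt b b' t) (hs : HasDerivAt s s' t) :
    HasDerivAt (fun r => φ (b r) (s r)) (d1 φ (b t) (s t) * b' + d2 φ (b t) (s t) * s') t := by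
  have := (hasFDerivAt_uncurry hΩ hφ h).comp_hasDerivAt (f := fun r => (b r, s r)) t (hb.prodMk hs)
  refine this.congr_deriv ?_
  have e1 : (b', s') = b' • ((1 : ℝ), (0 : ℝ)) + s' • ((0 : ℝ), (1 : ℝ)) := by simp
  rw [e1, map_add, map_smul, map_smul, ← d1_eq hΩ hφ h, ← d2_eq hΩ hφ h]
  simp only [smul_eq_mul]; ring

theorem contDiffOn_d1 (hΩ : IsOpen Ω)
    (hφ : ContDiffOn ℝ ∞ (fun p : ℝ × ℝ => φ p.1 p.2) Ω) :
    ContDiffOn ℝ ∞ (fun p : ℝ × ℝ => d1 φ p.1 p.2) Ω :=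
  ((hφ.fderiv_of_isOpen hΩ (by simp)).clm_apply contDiffOn_const).congr
    fun _ hp => d1_eq hΩ hφ hp

theorem contDiffOn_d2 (hΩ : IsOpen Ω)
    (hφ : ContDiffOn ℝ ∞ (fun p : ℝ × ℝ => φ p.1 p.2) Ω) :
    ContDiffOn ℝ ∞ (fun p : ℝ × ℝ => d2 φ p.1 p.2) Ω :=
  ((hφ.fderiv_of_isOpen hΩ (by simp)).clm_apply contDiffOn_const).congr
    fun _ hp => d2_eq hΩ hφ hp

theorem d1_d2_comm (hΩ : IsOpen Ω)
    (hφ : ContDiffOn ℝ ∞ (fun p : ℝ × ℝ => φ p.1 p.2) Ω) {B s : ℝ} (h : (B, s) ∈ Ω) :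
    d1 (d2 φ) B s = d2 (d1 φ) B s := by
  have hsym := (hφ.contDiffAt (hΩ.mem_nhds h)).isSymmSndFDerivAt (by
    rw [minSmoothness_of_isRCLikeNormedField]; exact WithTop.coe_le_coe.2 le_top)
  have hdd : DifferentiableAt ℝ (fderiv ℝ (fun p : ℝ × ℝ => φ p.1 p.2)) (B, s) :=
    ((hφ.contDiffAt (hΩ.mem_nhds h)).fderiv_right (m := ∞) (by simp)).differentiableAt (by simp)
  have h1 : (fun p : ℝ × ℝ => d1 φ p.1 p.2) =ᶠ[𝓝 (B, s)]
      fun p => fderiv ℝ (fun p : ℝ × ℝ => φ p.1 p.2) p (1, 0) := by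
    filter_upwards [hΩ.mem_nhds h] with p hp using d1_eq hΩ hφ hp
  have h2 : (fun p : ℝ × ℝ => d2 φ p.1 p.2) =ᶠ[𝓝 (B, s)]
      fun p => fderiv ℝ (fun p : ℝ × ℝ => φ p.1 p.2) p (0, 1) := by
    filter_upwards [hΩ.mem_nhds h] with p hp using d2_eq hΩ hφ hp
  rw [d1_eq hΩ (contDiffOn_d2 hΩ hφ) h, d2_eq hΩ (contDiffOn_d1 hΩ hφ) h, h1.fderiv_eq,
    h2.fderiv_eq, (hdd.hasFDerivAt.clm_apply (hasFDerivAt_const _ _)).fderiv,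
    (hdd.hasFDerivAt.clm_apply (hasFDerivAt_const _ _)).fderiv]
  simpa using hsym (1, 0) (0, 1)

end

/-! ### Derivatives of `α_κ` -/

/-- The derivative of `α_κ(x, y)²` in the variable `x`, in the direction `v`. -/
def dxForm (κ : ℝ) (x y v : Vec n) : ℝ :=
  -2 * κ * inner ℝ x v * ‖y‖ ^ 2 / (1 + κ * ‖x‖ ^ 2) ^ 2
    - 2 * κ * inner ℝ x y * inner ℝ v y / (1 + κ * ‖x‖ ^ 2) ^ 2
    + 4 * κ ^ 2 * inner ℝ x v * inner ℝ x y ^ 2 / (1 + κ * ‖x‖ ^ 2) ^ 3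

theorem hasDerivAt_line {G : Vec n → ℝ} {x : Vec n} (h : DifferentiableAt ℝ G x) (v : Vec n) :
    HasDerivAt (fun t : ℝ => G (x + t • v)) (fderiv ℝ G x v) 0 := by
  have hline : HasDerivAt (fun t : ℝ => x + t • v) v 0 := by
    simpa using ((hasDerivAt_id (0 : ℝ)).smul_const v).const_add x
  have h1 : HasFDerivAt G (fderiv ℝ G x) (x + (0 : ℝ) • v) := by
    simpa using h.hasFDerivAt
  exact h1.comp_hasDerivAt 0 hline

theorem eventually_line {p : Vec n → Prop} {x : Vec n} (h : ∀ᶠ z in 𝓝 x, p z) (v : Vec n) :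
    ∀ᶠ t in 𝓝 (0 : ℝ), p (x + t • v) := by
  have hc : ContinuousAt (fun t : ℝ => x + t • v) 0 := by fun_prop
  have := hc.eventually (p := p)
  simp only [zero_smul, add_zero] at this
  exact this h

theorem hasDerivAt_metricForm_fst {κ : ℝ} {x : Vec n} (hx : 0 < 1 + κ * ‖x‖ ^ 2) (y v : Vec n) :
    HasDerivAt (fun t : ℝ => metricForm κ (x + t • v) y y) (dxForm κ x y v) 0 := by
  have hline : HasDerivAt (fun t : ℝ => x + t • v) v 0 := by
    simpa using ((hasDerivAt_id (0 : ℝ)).smul_const v).const_add x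
  have hW : HasDerivAt (fun t : ℝ => 1 + κ * ‖x + t • v‖ ^ 2) (κ * (2 * inner ℝ x v)) 0 := by
    have := (hline.norm_sq.const_mul κ).const_add 1
    simpa using this
  have hi : HasDerivAt (fun t : ℝ => inner ℝ (x + t • v) y) (inner ℝ v y) 0 := by
    simpa using hline.inner ℝ (hasDerivAt_const 0 y)
  have hx0 : (1 + κ * ‖x + (0 : ℝ) • v‖ ^ 2) ≠ 0 := by simpa using hx.ne'
  have := ((hasDerivAt_const (0 : ℝ) (inner ℝ y y)).div hW hx0).sub
    (((hi.const_mul κ).mul hi).div (hW.pow 2) (pow_ne_zero 2 hx0))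
  refine this.congr_deriv ?_
  simp only [zero_smul, add_zero, real_inner_self_eq_norm_sq, dxForm, Pi.mul_apply, Pi.pow_apply]
  have hW0 := hx.ne'
  generalize 1 + κ * ‖x‖ ^ 2 = w at hW0 ⊢
  push_cast
  field_simp
  simp
  ring

theorem hasDerivAt_metricForm_snd (κ : ℝ) (x y v : Vec n) :
    HasDerivAt (fun t : ℝ => metricForm κ x (y + t • v) (y + t • v)) (2 * metricForm κ x y v) 0 := by
  have h : (fun t : ℝ => metricForm κ x (y + t • v) (y + t • v)) =
      fun t => metricForm κ x y y + (t * (2 * metricForm κ x y v) + t * t * metricForm κ x v v) := by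
    funext t
    simp only [metricForm_add_left, metricForm_add_right, metricForm_smul_left,
      metricForm_smul_right, metricForm_comm κ x v y]
    ring
  rw [h]
  have h1 := hasDerivAt_id (0 : ℝ)
  have := ((h1.mul_const (2 * metricForm κ x y v)).add ((h1.mul h1).mul_const
    (metricForm κ x v v))).const_add (metricForm κ x y y)
  refine this.congr_deriv ?_
  simp

theorem hasDerivAt_metricForm_left (κ : ℝ) (x y v w : Vec n) :
    HasDerivAt (fun t : ℝ => metricForm κ x (y + t • v) w) (metricForm κ x v w) 0 := by
  simp only [metricForm_add_left, metricForm_smul_left]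
  simpa using ((hasDerivAt_id (0 : ℝ)).mul_const (metricForm κ x v w)).const_add (metricForm κ x y w)

theorem differentiable_metricForm (κ : ℝ) (x : Vec n) :
    Differentiable ℝ fun y => metricForm κ x y y := by
  have h : Differentiable ℝ fun y : Vec n => inner ℝ x y :=
    (differentiable_const x).inner ℝ differentiable_id
  simp only [metricForm, div_eq_mul_inv]
  exact ((differentiable_id.inner ℝ differentiable_id).mul_const _).fun_sub
    (((h.const_mul κ).fun_mul h).mul_const _)

theorem dy_sqr_alpha {κ : ℝ} {x : Vec n} (hx : 0 < 1 + κ * ‖x‖ ^ 2) (y : Vec n) (i : Fin n) :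
    dy i (sqr (alpha κ)) x y = 2 * metricForm κ x y (e i) := by
  have h : (fun y' => sqr (alpha κ) x y') = fun y' => metricForm κ x y' y' := by
    funext y'; exact alpha_sq hx y'
  rw [dy, h]
  exact (hasDerivAt_line (differentiable_metricForm κ x y) (e i)).unique
    (hasDerivAt_metricForm_snd κ x y (e i))

theorem fundamentalTensor_alpha {κ : ℝ} {x : Vec n} (hx : 0 < 1 + κ * ‖x‖ ^ 2) (y : Vec n)
    (i j : Fin n) : fundamentalTensor (alpha κ) x y i j = metricForm κ x (e i) (e j) := by
  have h : (fun y' => dy i (sqr (alpha κ)) x y') = fun y' => 2 * metricForm κ x y' (e i) := by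
    funext y'; exact dy_sqr_alpha hx y' i
  have hd : Differentiable ℝ fun y' => 2 * metricForm κ x y' (e i) := by
    have h1 : ∀ w : Vec n, Differentiable ℝ fun y : Vec n => inner ℝ y w := fun w =>
      differentiable_id.inner ℝ (differentiable_const w)
    have h2 : Differentiable ℝ fun y : Vec n => inner ℝ x y :=
      (differentiable_const x).inner ℝ differentiable_id
    simp only [metricForm, div_eq_mul_inv]
    exact (((h1 _).mul_const _).fun_sub (((h2.const_mul κ).mul_const _).mul_const _)).const_mul 2
  simp only [fundamentalTensor, Matrix.of_apply]
  rw [dy, h, (hasDerivAt_line (hd y) (e j)).unique ((hasDerivAt_metricForm_left κ x y (e j) (e i)).const_mul 2),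
    metricForm_comm]
  ring

theorem metricForm_sum (κ : ℝ) (x : Vec n) (v : Vec n) :
    ∑ i, ∑ j, v i * (metricForm κ x (e i) (e j) * v j) = metricForm κ x v v := by
  have h1 : ∀ u : Vec n, ∑ j, metricForm κ x u (e j) * v j = metricForm κ x u v := by
    intro u
    have := sum_mul_apply_e ((1 / (1 + κ * ‖x‖ ^ 2)) • innerSL ℝ u
      - (κ * inner ℝ x u / (1 + κ * ‖x‖ ^ 2) ^ 2) • innerSL ℝ x) v
    simp only [sub_apply, smul_apply, smul_eq_mul,
      innerSL_apply_apply] at this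
    simp only [metricForm]
    convert this using 1
    · exact Finset.sum_congr rfl fun j _ => by ring
    · ring
  simp only [← Finset.mul_sum, h1]
  rw [← h1 v]
  exact Finset.sum_congr rfl fun j _ => by rw [metricForm_comm, mul_comm]

theorem isFinslerMetric_alpha {κ : ℝ} {U : Set (Vec n)}
    (hκ : ∀ x ∈ U, 0 < 1 + κ * ‖x‖ ^ 2) : IsFinslerMetric U (alpha κ) where
  smooth := by
    intro p hp
    have hx := hκ p.1 hp.1
    have hy : p.2 ≠ 0 := hp.2
    have hN : (1 + κ * ‖p.1‖ ^ 2) * ‖p.2‖ ^ 2 - κ * inner ℝ p.1 p.2 ^ 2 ≠ 0 := by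
      have h : metricForm κ p.1 p.2 p.2 = ((1 + κ * ‖p.1‖ ^ 2) * ‖p.2‖ ^ 2
          - κ * inner ℝ p.1 p.2 ^ 2) / (1 + κ * ‖p.1‖ ^ 2) ^ 2 := by
        rw [metricForm, real_inner_self_eq_norm_sq]; field_simp
      intro h0
      have := metricForm_pos hx hy
      rw [h, h0] at this
      simp at this
    have h1 : ContDiff ℝ ∞ fun p : Vec n × Vec n => 1 + κ * ‖p.1‖ ^ 2 :=
      contDiff_const.add (contDiff_const.mul (contDiff_fst.norm_sq ℝ))
    have h2 : ContDiff ℝ ∞ fun p : Vec n × Vec n =>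
        (1 + κ * ‖p.1‖ ^ 2) * ‖p.2‖ ^ 2 - κ * inner ℝ p.1 p.2 ^ 2 :=
      (h1.mul (contDiff_snd.norm_sq ℝ)).sub
        (contDiff_const.mul ((contDiff_fst.inner ℝ contDiff_snd).pow 2))
    exact ((h2.contDiffAt.sqrt hN).div h1.contDiffAt hx.ne').contDiffWithinAt
  pos := fun x hx y hy => alpha_pos (hκ x hx) hy
  homogeneous := fun x hx y t ht => by
    rw [alpha_eq_sqrt (hκ x hx), alpha_eq_sqrt (hκ x hx), metricForm_smul_left,
      metricForm_smul_right, ← mul_assoc, Real.sqrt_mul (by positivity), Real.sqrt_mul_self ht.le]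
  posDef := fun x hx y _ => by
    refine Matrix.PosDef.of_dotProduct_mulVec_pos ?_ ?_
    · ext i j
      simp [fundamentalTensor_alpha (hκ x hx), metricForm_comm κ x (e i)]
    · intro v hv
      have hv' : (WithLp.toLp 2 v : Vec n) ≠ 0 := by simpa using hv
      have := metricForm_pos (hκ x hx) hv'
      rw [← metricForm_sum] at this
      simpa [dotProduct, Matrix.mulVec, Finset.mul_sum, fundamentalTensor_alpha (hκ x hx)] using this

section
variable {κ : ℝ} {U : Set (Vec n)} {x y : Vec n}

theorem fderiv_alpha_fst (hU : IsOpen U) (hκ : ∀ x ∈ U, 0 < 1 + κ * ‖x‖ ^ 2) (hx : x ∈ U)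
    (hy : y ≠ 0) (v : Vec n) :
    fderiv ℝ (fun x' => alpha κ x' y) x v = dxForm κ x y v / (2 * alpha κ x y) := by
  have hd := (hasFDerivAt_fst hU (isFinslerMetric_alpha hκ).smooth hx hy).differentiableAt
  have h1 := (hasDerivAt_line hd v).pow 2
  have h2 : (fun t : ℝ => alpha κ (x + t • v) y ^ 2) =ᶠ[𝓝 0]
      fun t => metricForm κ (x + t • v) y y := by
    filter_upwards [eventually_line (eventually_conf_pos (hκ x hx)) v] with t ht using alpha_sq ht y
  have h3 := h1.unique ((hasDerivAt_metricForm_fst (hκ x hx) y v).congr_of_eventuallyEq h2)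
  have := alpha_pos (hκ x hx) hy
  simp only [zero_smul, add_zero] at h3
  rw [← h3]
  field_simp
  simp

theorem fderiv_alpha_snd (hU : IsOpen U) (hκ : ∀ x ∈ U, 0 < 1 + κ * ‖x‖ ^ 2) (hx : x ∈ U)
    (hy : y ≠ 0) (v : Vec n) :
    fderiv ℝ (fun y' => alpha κ x y') y v = metricForm κ x y v / alpha κ x y := by
  have hd := (hasFDerivAt_snd hU (isFinslerMetric_alpha hκ).smooth hx hy).differentiableAt
  have h1 := (hasDerivAt_line hd v).pow 2
  have h2 : (fun t : ℝ => alpha κ x (y + t • v) ^ 2) =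
      fun t => metricForm κ x (y + t • v) (y + t • v) := by
    funext t; exact alpha_sq (hκ x hx) _
  have h3 := h1.unique (h2 ▸ hasDerivAt_metricForm_snd κ x y v)
  have := alpha_pos (hκ x hx) hy
  simp only [zero_smul, add_zero] at h3
  field_simp
  simp at h3
  linarith

theorem hamel_eq_of_hasDerivAt {F : Vec n → Vec n → ℝ} (hU : IsOpen U)
    (hs : ContDiffOn ℝ ∞ (fun p : Vec n × Vec n => F p.1 p.2) (U ×ˢ {0}ᶜ)) (hx : x ∈ U)
    (hy : y ≠ 0) {v : Vec n} {D : ℝ}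
    (h : HasDerivAt (fun t : ℝ => fderiv ℝ (fun x' => F x' (y + t • v)) x y) D 0) :
    hamel F x y v = D - fderiv ℝ (fun x' => F x' y) x v := by
  rw [hamel, (hasDerivAt_line (differentiableAt_fderiv_fst hU hs hx hy y) v).unique h]

theorem dxForm_self (hx : 0 < 1 + κ * ‖x‖ ^ 2) (y : Vec n) : dxForm κ x y y
    = -4 * κ * inner ℝ x y / (1 + κ * ‖x‖ ^ 2) * metricForm κ x y y := by
  rw [dxForm, metricForm, real_inner_self_eq_norm_sq]
  field_simp
  ring

/-- `α_κ` is projectively flat: its geodesics are straight lines. -/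
theorem hamel_alpha (hU : IsOpen U) (hκ : ∀ x ∈ U, 0 < 1 + κ * ‖x‖ ^ 2) (hx : x ∈ U)
    (hy : y ≠ 0) (v : Vec n) : hamel (alpha κ) x y v = 0 := by
  have hs := (isFinslerMetric_alpha hκ).smooth
  have hα := alpha_pos (hκ x hx) hy
  have hline : HasDerivAt (fun t : ℝ => y + t • v) v 0 := by
    simpa using ((hasDerivAt_id (0 : ℝ)).smul_const v).const_add y
  have hxy : HasDerivAt (fun t : ℝ => inner ℝ x (y + t • v)) (inner ℝ x v) 0 := by
    simpa using (hasDerivAt_const 0 x).inner ℝ hline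
  have hyy : HasDerivAt (fun t : ℝ => inner ℝ y (y + t • v)) (inner ℝ y v) 0 := by
    simpa using (hasDerivAt_const 0 y).inner ℝ hline
  have hn : HasDerivAt (fun t : ℝ => ‖y + t • v‖ ^ 2) (2 * inner ℝ y v) 0 := by
    simpa using hline.norm_sq
  have h1 : HasDerivAt (fun t : ℝ => dxForm κ x (y + t • v) y)
      (-2 * κ * inner ℝ x y * (2 * inner ℝ y v) / (1 + κ * ‖x‖ ^ 2) ^ 2
      - 2 * κ * (inner ℝ x v * ‖y‖ ^ 2 + inner ℝ x y * inner ℝ y v) / (1 + κ * ‖x‖ ^ 2) ^ 2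
      + 4 * κ ^ 2 * inner ℝ x y * (2 * inner ℝ x y * inner ℝ x v) / (1 + κ * ‖x‖ ^ 2) ^ 3) 0 := by
    have := (((hn.const_mul (-2 * κ * inner ℝ x y)).div_const ((1 + κ * ‖x‖ ^ 2) ^ 2)).sub
      (((hxy.const_mul (2 * κ)).mul hyy).div_const ((1 + κ * ‖x‖ ^ 2) ^ 2))).add
      (((hxy.pow 2).const_mul (4 * κ ^ 2 * inner ℝ x y)).div_const ((1 + κ * ‖x‖ ^ 2) ^ 3))
    refine this.congr_deriv ?_
    simp only [zero_smul, add_zero, real_inner_self_eq_norm_sq]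
    push_cast
    ring
  have h2 := hasDerivAt_line (hasFDerivAt_snd hU hs hx hy).differentiableAt v
  rw [fderiv_alpha_snd hU hκ hx hy] at h2
  have h3 := h1.div (h2.const_mul 2) (by simpa using hα.ne')
  have h4 : (fun t : ℝ => fderiv ℝ (fun x' => alpha κ x' (y + t • v)) x y) =ᶠ[𝓝 0]
      fun t => dxForm κ x (y + t • v) y / (2 * alpha κ x (y + t • v)) := by
    filter_upwards [eventually_line (isOpen_compl_singleton.mem_nhds hy) v] with t ht
    exact fderiv_alpha_fst hU hκ hx ht y
  rw [hamel_eq_of_hasDerivAt hU hs hx hy (h3.congr_of_eventuallyEq h4),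
    fderiv_alpha_fst hU hκ hx hy]
  have key : -2 * κ * inner ℝ x y * (2 * inner ℝ y v) / (1 + κ * ‖x‖ ^ 2) ^ 2
      - 2 * κ * (inner ℝ x v * ‖y‖ ^ 2 + inner ℝ x y * inner ℝ y v) / (1 + κ * ‖x‖ ^ 2) ^ 2
      + 4 * κ ^ 2 * inner ℝ x y * (2 * inner ℝ x y * inner ℝ x v) / (1 + κ * ‖x‖ ^ 2) ^ 3
      + 4 * (κ * inner ℝ x y / (1 + κ * ‖x‖ ^ 2)) * metricForm κ x y v - dxForm κ x y v = 0 := by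
    have hW0 := (hκ x hx).ne'
    rw [dxForm, metricForm, real_inner_comm y v]
    field_simp
    ring
  simp only [zero_smul, add_zero]
  rw [dxForm_self (hκ x hx), ← alpha_sq (hκ x hx) y]
  have hne := hα.ne'
  have hsplit : ∀ D E A L α : ℝ, α ≠ 0 → D + 4 * E * A - L = 0 →
      (D * (2 * α) - -4 * E * α ^ 2 * (2 * (A / α))) / (2 * α) ^ 2 - L / (2 * α) = 0 := by
    intro D E A L α hα h
    have : D = L - 4 * E * A := by linarith
    rw [this]; field_simp; ring
  rw [show -4 * κ * inner ℝ x y / (1 + κ * ‖x‖ ^ 2)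
    = -4 * (κ * inner ℝ x y / (1 + κ * ‖x‖ ^ 2)) by ring]
  exact hsplit _ _ _ _ _ hne key

theorem fderiv_alpha_self (hU : IsOpen U) (hκ : ∀ x ∈ U, 0 < 1 + κ * ‖x‖ ^ 2) (hx : x ∈ U)
    (hy : y ≠ 0) : fderiv ℝ (fun x' => alpha κ x' y) x y
      = -2 * κ * inner ℝ x y / (1 + κ * ‖x‖ ^ 2) * alpha κ x y := by
  rw [fderiv_alpha_fst hU hκ hx hy, dxForm_self (hκ x hx), ← alpha_sq (hκ x hx)]
  have hα := alpha_pos (hκ x hx) hy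
  field_simp
  ring

end

/-! ### Hamel's expression of a general `(α, β)`-metric -/

section
variable {κ : ℝ} {U : Set (Vec n)} {β : Vec n → (Vec n →L[ℝ] ℝ)} {φ : ℝ → ℝ → ℝ}
  {Ω : Set (ℝ × ℝ)} {x y : Vec n}

theorem mem_valueSet (hκ : ∀ x ∈ U, 0 < 1 + κ * ‖x‖ ^ 2) (hx : x ∈ U) (hy : y ≠ 0) :
    (bSq κ β x, β x y / alpha κ x y) ∈ valueSet κ U β := by
  refine ⟨x, hx, rfl, ?_⟩
  have h := sq_apply_le (hκ x hx) β y
  have hα := alpha_pos (hκ x hx) hy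
  rw [← alpha_sq (hκ x hx)] at h
  show (β x y / alpha κ x y) ^ 2 ≤ _
  rw [div_pow, div_le_iff₀ (by positivity)]
  exact h

theorem hasDerivAt_apply_line (hβ : DifferentiableAt ℝ β x) (u y : Vec n) :
    HasDerivAt (fun t : ℝ => β (x + t • u) y) (fderiv ℝ β x u y) 0 := by
  have h := hβ.hasFDerivAt.clm_apply (hasFDerivAt_const y x)
  have h2 := hasDerivAt_line h.differentiableAt u
  rw [h.fderiv] at h2
  simpa using h2

theorem fderiv_generalMetric_fst (hU : IsOpen U) (hκ : ∀ x ∈ U, 0 < 1 + κ * ‖x‖ ^ 2)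
    (hΩ : IsOpen Ω) (hΩU : valueSet κ U β ⊆ Ω)
    (hφ : ContDiffOn ℝ ∞ (fun p : ℝ × ℝ => φ p.1 p.2) Ω)
    (hs : ContDiffOn ℝ ∞ (fun p : Vec n × Vec n => generalMetric κ β φ p.1 p.2) (U ×ˢ {0}ᶜ))
    (hx : x ∈ U) (hβ : DifferentiableAt ℝ β x) (hy : y ≠ 0) (u : Vec n) :
    fderiv ℝ (fun x' => generalMetric κ β φ x' y) x u
      = fderiv ℝ (fun x' => alpha κ x' y) x u * (φ (bSq κ β x) (β x y / alpha κ x y)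
          - β x y / alpha κ x y * d2 φ (bSq κ β x) (β x y / alpha κ x y))
        + alpha κ x y * (d1 φ (bSq κ β x) (β x y / alpha κ x y) * fderiv ℝ (bSq κ β) x u)
        + d2 φ (bSq κ β x) (β x y / alpha κ x y) * fderiv ℝ β x u y := by
  have hα := (alpha_pos (hκ x hx) hy).ne'
  have h1 := hasDerivAt_line (hasFDerivAt_fst hU hs hx hy).differentiableAt u
  have h2 := hasDerivAt_line
    (hasFDerivAt_fst hU (isFinslerMetric_alpha hκ).smooth hx hy).differentiableAt u
  have h3 := hasDerivAt_line (differentiableAt_bSq (hκ x hx) hβ) u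
  have h4 := (hasDerivAt_apply_line hβ u y).div h2 (by simpa using hα)
  have h5 := h2.mul (hasDerivAt_comp_uncurry hΩ hφ
    (by simpa using hΩU (mem_valueSet hκ hx hy)) h3 h4)
  refine (h1.unique h5).trans ?_
  simp only [zero_smul, add_zero, Pi.div_apply]
  field_simp
  ring

/-- Hamel's expression of `α φ(b², β / α)`. All Christoffel symbols combine into the covariant
derivative of `β`, because the expression vanishes for `α` itself. -/
theorem hamel_generalMetric (hU : IsOpen U) (hκ : ∀ x ∈ U, 0 < 1 + κ * ‖x‖ ^ 2)
    (hΩ : IsOpen Ω) (hΩU : valueSet κ U β ⊆ Ω)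
    (hφ : ContDiffOn ℝ ∞ (fun p : ℝ × ℝ => φ p.1 p.2) Ω)
    (hs : ContDiffOn ℝ ∞ (fun p : Vec n × Vec n => generalMetric κ β φ p.1 p.2) (U ×ˢ {0}ᶜ))
    (hx : x ∈ U) (hβ : DifferentiableAt ℝ β x) (hy : y ≠ 0) (v : Vec n) {s : ℝ}
    (hsy : β x y / alpha κ x y = s) :
    hamel (generalMetric κ β φ) x y v
      = d1 φ (bSq κ β x) s * (metricForm κ x y v / alpha κ x y * fderiv ℝ (bSq κ β) x y
            - alpha κ x y * fderiv ℝ (bSq κ β) x v)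
        + (β x v - s * (metricForm κ x y v / alpha κ x y)) / alpha κ x y
            * (alpha κ x y * (d2 (d1 φ) (bSq κ β x) s * fderiv ℝ (bSq κ β) x y)
                + d2 (d2 φ) (bSq κ β x) s * cov κ β x y y)
        + d2 φ (bSq κ β x) s * (cov κ β x v y - cov κ β x y v) := by
  subst hsy
  have hα := (alpha_pos (hκ x hx) hy).ne'
  have hsα := (isFinslerMetric_alpha hκ).smooth
  have hmem : (bSq κ β x, β x (y + (0 : ℝ) • v) / alpha κ x (y + (0 : ℝ) • v)) ∈ Ω := by
    simpa using hΩU (mem_valueSet hκ hx hy)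
  have g1 : HasDerivAt (fun t : ℝ => fderiv ℝ (fun x' => alpha κ x' (y + t • v)) x y)
      (fderiv ℝ (fun x' => alpha κ x' y) x v) 0 := by
    have := hasDerivAt_line (differentiableAt_fderiv_fst hU hsα hx hy y) v
    have h0 := hamel_alpha hU hκ hx hy v
    rw [hamel] at h0
    exact this.congr_deriv (by linarith)
  have g2 := hasDerivAt_line (hasFDerivAt_snd hU hsα hx hy).differentiableAt v
  rw [fderiv_alpha_snd hU hκ hx hy] at g2
  have g3 : ∀ L : Vec n →L[ℝ] ℝ, HasDerivAt (fun t : ℝ => L (y + t • v)) (L v) 0 := by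
    intro L
    have := hasDerivAt_line (L.differentiableAt (x := y)) v
    rwa [L.fderiv] at this
  have g4 := (g3 (β x)).div g2 (by simpa using hα)
  have gφ := hasDerivAt_comp_uncurry hΩ hφ hmem (hasDerivAt_const (0 : ℝ) (bSq κ β x)) g4
  have g1φ := hasDerivAt_comp_uncurry hΩ (contDiffOn_d1 hΩ hφ) hmem
    (hasDerivAt_const (0 : ℝ) (bSq κ β x)) g4
  have g2φ := hasDerivAt_comp_uncurry hΩ (contDiffOn_d2 hΩ hφ) hmem
    (hasDerivAt_const (0 : ℝ) (bSq κ β x)) g4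
  have h5 := ((g1.mul (gφ.sub (g4.mul g2φ))).add
    (g2.mul (g1φ.mul_const (fderiv ℝ (bSq κ β) x y)))).add (g2φ.mul (g3 (fderiv ℝ β x y)))
  have hev : (fun t : ℝ => fderiv ℝ (fun x' => generalMetric κ β φ x' (y + t • v)) x y) =ᶠ[𝓝 0] _ :=
    (eventually_line (isOpen_compl_singleton.mem_nhds hy) v).mono fun t ht =>
      fderiv_generalMetric_fst hU hκ hΩ hΩU hφ hs hx hβ ht y
  rw [hamel_eq_of_hasDerivAt hU hs hx hy (h5.congr_of_eventuallyEq hev),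
    fderiv_generalMetric_fst hU hκ hΩ hΩU hφ hs hx hβ hy]
  simp only [zero_smul, add_zero, Pi.div_apply, Pi.mul_apply, Pi.sub_apply, cov,
    fderiv_alpha_self hU hκ hx hy]
  have hW0 := (hκ x hx).ne'
  generalize alpha κ x y = α at *
  field_simp
  ring

/-- Hamel's expression of `α φ(b², β / α)` at a vector `y` with `α(y) = 1`. -/
theorem hamel_generalMetric_unit (hU : IsOpen U) (hκ : ∀ x ∈ U, 0 < 1 + κ * ‖x‖ ^ 2)
    (hΩ : IsOpen Ω) (hΩU : valueSet κ U β ⊆ Ω)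
    (hφ : ContDiffOn ℝ ∞ (fun p : ℝ × ℝ => φ p.1 p.2) Ω)
    (hs : ContDiffOn ℝ ∞ (fun p : Vec n × Vec n => generalMetric κ β φ p.1 p.2) (U ×ˢ {0}ᶜ))
    (hx : x ∈ U) (hβ : DifferentiableAt ℝ β x) (hy : metricForm κ x y y = 1) (v : Vec n) :
    hamel (generalMetric κ β φ) x y v
      = d1 φ (bSq κ β x) (β x y) * (metricForm κ x y v * (2 * cov κ β x (sharp κ β x) y)
            - 2 * cov κ β x (sharp κ β x) v)
        + (β x v - β x y * metricForm κ x y v)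
            * (d2 (d1 φ) (bSq κ β x) (β x y) * (2 * cov κ β x (sharp κ β x) y)
                + d2 (d2 φ) (bSq κ β x) (β x y) * cov κ β x y y)
        + d2 φ (bSq κ β x) (β x y) * (cov κ β x v y - cov κ β x y v) := by
  have hα : alpha κ x y = 1 := by rw [alpha_eq_sqrt (hκ x hx), hy, Real.sqrt_one]
  have hy0 : y ≠ 0 := by rintro rfl; simp [metricForm] at hy
  rw [hamel_generalMetric (s := β x y) hU hκ hΩ hΩU hφ hs hx hβ hy0 v (by rw [hα, div_one])]
  simp only [hα, fderiv_bSq (hκ x hx) hβ]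
  ring

end

/-! ### Hamel's equation at a point -/

section
variable {V : Type*} [AddCommGroup V] [Module ℝ V]

/-- In dimension at least three there is a unit vector in the kernel of any two linear forms. -/
theorem exists_unit [FiniteDimensional ℝ V] (hV : 3 ≤ Module.finrank ℝ V)
    {A : V →ₗ[ℝ] V →ₗ[ℝ] ℝ} (hpos : ∀ v, v ≠ 0 → 0 < A v v) (f g : V →ₗ[ℝ] ℝ) :
    ∃ w, A w w = 1 ∧ f w = 0 ∧ g w = 0 := by
  have h : LinearMap.ker (f.prod g) ≠ ⊥ := LinearMap.ker_ne_bot_of_finrank_lt (by simp; omega)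
  obtain ⟨w, hw, hw0⟩ := Submodule.exists_mem_ne_zero_of_ne_bot h
  have hw' : f w = 0 ∧ g w = 0 := by simpa using hw
  have hA := hpos w hw0
  refine ⟨(Real.sqrt (A w w))⁻¹ • w, ?_, by simp [hw'.1], by simp [hw'.2]⟩
  have := Real.sq_sqrt hA.le
  have hne := (Real.sqrt_pos.2 hA).ne'
  simp only [map_smul, LinearMap.smul_apply, smul_eq_mul]
  field_simp
  exact this.symm

/-- Hamel's equation of `α φ(b², β / α)` at one point, as linear algebra: `A` is the metric, `b` the
form `β`, `N` its dual vector, `T` the covariant derivative of `β`, and `p₁, p₂, p₁₂, p₂₂` are the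
partial derivatives of `φ` at the value of `b²` in question, as functions of `s`. -/
structure HamelSystem (A T : V →ₗ[ℝ] V →ₗ[ℝ] ℝ) (b : V →ₗ[ℝ] ℝ) (N : V)
    (p₁ p₂ p₁₂ p₂₂ : ℝ → ℝ) : Prop where
  symm : ∀ u v, A u v = A v u
  pos : ∀ v, v ≠ 0 → 0 < A v v
  apply_left : ∀ v, A N v = b v
  ne : N ≠ 0
  coeff_ne : p₁ 0 ≠ 0
  eq : ∀ u, A u u = 1 → ∀ v,
    p₁ (b u) * (A u v * (2 * T N u) - 2 * T N v)
      + (b v - b u * A u v) * (p₁₂ (b u) * (2 * T N u) + p₂₂ (b u) * T u u)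
      + p₂ (b u) * (T v u - T u v) = 0

namespace HamelSystem
variable {A T : V →ₗ[ℝ] V →ₗ[ℝ] ℝ} {b : V →ₗ[ℝ] ℝ} {N : V}
  {p₁ p₂ p₁₂ p₂₂ : ℝ → ℝ} (H : HamelSystem A T b N p₁ p₂ p₁₂ p₂₂)
include H

theorem B_pos : 0 < b N := by rw [← H.apply_left]; exact H.pos N H.ne

/-- Unit vectors with a prescribed value `s` of `b`, in the plane of `N` and a unit vector of `ker b`. -/
theorem unit_combination {w : V} (hw : A w w = 1) (hbw : b w = 0) {s τ : ℝ}
    (hτ : τ ^ 2 = 1 - s ^ 2 / b N) :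
    A ((s / b N) • N + τ • w) ((s / b N) • N + τ • w) = 1 ∧ b ((s / b N) • N + τ • w) = s := by
  have hB := H.B_pos.ne'
  have h1 : A w N = 0 := by rw [H.symm, H.apply_left, hbw]
  constructor
  · simp only [map_add, map_smul, LinearMap.add_apply, LinearMap.smul_apply, smul_eq_mul,
      H.apply_left, hw, hbw, h1]
    have : (s / b N) * ((s / b N) * b N) = s ^ 2 / b N := by field_simp
    linarith
  · simp [hbw, hB]

theorem exists_tau {s : ℝ} (hs : s ^ 2 < b N) : ∃ τ : ℝ, τ ≠ 0 ∧ τ ^ 2 = 1 - s ^ 2 / b N := by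
  have h : 0 < 1 - s ^ 2 / b N := by
    rw [sub_pos, div_lt_one H.B_pos]; exact hs
  exact ⟨Real.sqrt (1 - s ^ 2 / b N), (Real.sqrt_pos.2 h).ne', Real.sq_sqrt h.le⟩

variable [FiniteDimensional ℝ V]

/-- `d(b²)` is a multiple of `β`: compare the equation at the unit vectors `u` and `-u`, with `u`
orthogonal to `N` and to `v`. -/
theorem T_N_ker (hV : 3 ≤ Module.finrank ℝ V) {v : V} (hv : b v = 0) : T N v = 0 := by
  obtain ⟨u, hu, hbu, hAu⟩ := exists_unit hV H.pos b (A v)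
  have hAu' : A u v = 0 := by rw [H.symm, hAu]
  -- the sum of the equations at `u` and `-u` leaves only the term with `p₁ 0`
  have h1 := H.eq u hu v
  have h2 := H.eq (-u) (by simpa using hu) v
  simp only [map_neg, LinearMap.neg_apply, hbu, hAu', hv, neg_zero] at h1 h2
  have : p₁ 0 * T N v = 0 := by linarith
  exact (mul_eq_zero.1 this).resolve_left H.coeff_ne

theorem T_N (hV : 3 ≤ Module.finrank ℝ V) (v : V) : T N v = T N N / b N * b v := by
  have hB := H.B_pos.ne'
  have h := H.T_N_ker hV (v := v - (b v / b N) • N) (by simp [hB])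
  simp only [map_sub, map_smul, smul_eq_mul] at h
  field_simp at h ⊢
  linarith

/-- The equation at the unit vectors of `ker b`, where `s = 0`, determines `T` on the diagonal of
`ker b`. -/
theorem T_diag_zero (hV : 3 ≤ Module.finrank ℝ V) {w : V} (hw : b w = 0) :
    p₁ 0 * (2 * T N N) * A w w = p₂₂ 0 * b N * T w w := by
  rcases eq_or_ne w 0 with rfl | hw0
  · simp
  have key : ∀ u, A u u = 1 → b u = 0 → p₁ 0 * (2 * T N N) = p₂₂ 0 * b N * T u u := by
    intro u hu hbu
    have hAu' : A u N = 0 := by rw [H.symm, H.apply_left, hbu]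
    have h0 := H.T_N_ker hV hbu
    have h1 := H.eq u hu N
    have h2 := H.eq (-u) (by simpa using hu) N
    simp only [map_neg, LinearMap.neg_apply, hbu, hAu', neg_zero, h0] at h1 h2
    linarith
  have hA := H.pos w hw0
  have hs := Real.sq_sqrt hA.le
  have hne := (Real.sqrt_pos.2 hA).ne'
  have := key ((Real.sqrt (A w w))⁻¹ • w) (by
    simp only [map_smul, LinearMap.smul_apply, smul_eq_mul]
    field_simp; exact hs.symm) (by simp [hw])
  simp only [map_smul, LinearMap.smul_apply, smul_eq_mul] at this
  rw [this]
  field_simp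
  rw [hs]
  ring

/-- `β` is closed: the part of the equation that is odd in `τ`, at the unit vectors
`(s / b²) N + τ w` with `w` in `ker b`, isolates the antisymmetric part of `T`, with the coefficient
`p₂ s`. -/
theorem T_symm (hV : 3 ≤ Module.finrank ℝ V) {s : ℝ} (hs0 : s ≠ 0) (hs : s ^ 2 < b N)
    (hp : p₂ s ≠ 0) (u v : V) : T u v = T v u := by
  have hB := H.B_pos.ne'
  obtain ⟨τ, hτ0, hτ⟩ := H.exists_tau hs
  have key : ∀ v w, b v = 0 → b w = 0 → A w w = 1 → A w v = 0 → T v N = 0 ∧ T v w = T w v := by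
    intro v w hv hbw hw hwv
    have h0 := H.T_N_ker hV hv
    obtain ⟨h1, h2⟩ := H.unit_combination hw hbw hτ
    obtain ⟨h3, h4⟩ := H.unit_combination (s := s) (τ := -τ) hw hbw (by rw [neg_sq, hτ])
    have e1 := H.eq _ h1 v
    have e2 := H.eq _ h3 v
    rw [h2] at e1
    rw [h4] at e2
    simp only [map_add, map_smul, LinearMap.add_apply, LinearMap.smul_apply, smul_eq_mul,
      H.apply_left, hv, hwv, h0] at e1 e2
    have f1 : p₂ s * (s / b N * T v N + τ * (T v w - T w v)) = 0 := by linarith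
    have f2 : p₂ s * (s / b N * T v N - τ * (T v w - T w v)) = 0 := by linarith
    have g1 := (mul_eq_zero.1 f1).resolve_left hp
    have g2 := (mul_eq_zero.1 f2).resolve_left hp
    have k1 : s / b N * T v N = 0 := by linarith
    have k2 : τ * (T v w - T w v) = 0 := by linarith
    exact ⟨(mul_eq_zero.1 k1).resolve_left (div_ne_zero hs0 hB),
      sub_eq_zero.1 ((mul_eq_zero.1 k2).resolve_left hτ0)⟩
  have keyN : ∀ v, b v = 0 → T v N = 0 := by
    intro v hv
    obtain ⟨w, hw, hbw, hAw⟩ := exists_unit hV H.pos b (A v)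
    exact (key v w hv hbw hw (by rw [H.symm, hAw])).1
  have keyW : ∀ v w, b v = 0 → b w = 0 → T v w = T w v := by
    intro v w hv hw
    rcases eq_or_ne w 0 with rfl | hw0
    · simp
    have hA := H.pos w hw0
    have hss := Real.sq_sqrt hA.le
    have hne := (Real.sqrt_pos.2 hA).ne'
    have hu : A ((Real.sqrt (A w w))⁻¹ • w) ((Real.sqrt (A w w))⁻¹ • w) = 1 := by
      simp only [map_smul, LinearMap.smul_apply, smul_eq_mul]
      field_simp; exact hss.symm
    have := (key (v - (A w v / A w w) • w) ((Real.sqrt (A w w))⁻¹ • w) (by simp [hv, hw])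
      (by simp [hw]) hu (by
        simp only [map_sub, map_smul, LinearMap.smul_apply, smul_eq_mul]
        field_simp; ring)).2
    simp only [map_sub, map_smul, LinearMap.smul_apply, smul_eq_mul, LinearMap.sub_apply] at this
    have h2 : (Real.sqrt (A w w))⁻¹ * (T v w - T w v) = 0 := by linarith
    exact sub_eq_zero.1 ((mul_eq_zero.1 h2).resolve_left (inv_ne_zero hne))
  have hu0 : b (u - (b u / b N) • N) = 0 := by simp [hB]
  have hv0 : b (v - (b v / b N) • N) = 0 := by simp [hB]
  have e1 := keyW _ _ hu0 hv0
  have e2 := keyN _ hu0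
  have e3 := keyN _ hv0
  have e4 := H.T_N_ker hV hu0
  have e5 := H.T_N_ker hV hv0
  simp only [map_sub, map_smul, LinearMap.smul_apply, smul_eq_mul, LinearMap.sub_apply]
    at e1 e2 e3 e4 e5
  linear_combination e1 + (b v / b N) * (e2 - e4) - (b u / b N) * (e3 - e5)

/-- The equation in the direction `N`, once `T` is symmetric. -/
theorem quadratic_eq (hV : 3 ≤ Module.finrank ℝ V) (hT : ∀ u v, T u v = T v u) {u : V}
    (hu : A u u = 1) (hs : (b u) ^ 2 < b N) :
    p₂₂ (b u) * T u u * b N = 2 * T N N * (p₁ (b u) - b u * p₁₂ (b u)) := by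
  have hB := H.B_pos.ne'
  have h := H.eq u hu N
  rw [hT N u, sub_self, mul_zero, add_zero, H.symm u N, H.apply_left, ← hT N u, H.T_N hV u] at h
  have h2 : (b N - b u ^ 2) * (p₂₂ (b u) * T u u * b N
      - 2 * T N N * (p₁ (b u) - b u * p₁₂ (b u))) = 0 := by
    field_simp at h
    linear_combination h
  exact sub_eq_zero.1 ((mul_eq_zero.1 h2).resolve_left (by linarith))

/-- `T` is determined by its diagonal on `ker b` and by `T N N`. -/
theorem T_eq_of_diag (hV : 3 ≤ Module.finrank ℝ V) (hT : ∀ u v, T u v = T v u) {k : ℝ}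
    (hk : ∀ w, b w = 0 → T w w = k * A w w) (u v : V) :
    T u v = k * A u v + (T N N / b N - k) / b N * (b u * b v) := by
  have hB := H.B_pos.ne'
  have keyW : ∀ v w, b v = 0 → b w = 0 → T v w = k * A v w := by
    intro v w hv hw
    have h1 := hk (v + w) (by simp [hv, hw])
    have h2 := hk v hv
    have h3 := hk w hw
    simp only [map_add, LinearMap.add_apply] at h1
    rw [hT w v, H.symm w v] at h1
    linarith
  have hu0 : b (u - (b u / b N) • N) = 0 := by simp [hB]
  have hv0 : b (v - (b v / b N) • N) = 0 := by simp [hB]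
  have e1 := keyW _ _ hu0 hv0
  have e2 := H.T_N hV u
  have e3 := H.T_N hV v
  simp only [map_sub, map_smul, LinearMap.smul_apply, smul_eq_mul, LinearMap.sub_apply,
    H.apply_left, H.symm u N, hT u N, e2, e3] at e1
  field_simp at e1 ⊢
  linear_combination e1

/-- `T` is a combination of the metric and of `b ⊗ b`. -/
theorem T_eq (hV : 3 ≤ Module.finrank ℝ V) (hT : ∀ u v, T u v = T v u) (hp : p₂₂ 0 ≠ 0)
    (u v : V) : T u v = 2 * p₁ 0 / p₂₂ 0 * (T N N / b N) * A u v
      + (T N N / b N - 2 * p₁ 0 / p₂₂ 0 * (T N N / b N)) / b N * (b u * b v) := by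
  have hB := H.B_pos.ne'
  refine H.T_eq_of_diag hV hT (fun w hw => ?_) u v
  have := H.T_diag_zero hV hw
  field_simp
  linarith

/-- The differential equation for `φ`, at a point where `d(b²)` does not vanish. -/
theorem pde (hV : 3 ≤ Module.finrank ℝ V) (hT : ∀ u v, T u v = T v u) (hp : p₂₂ 0 ≠ 0)
    (hN : T N N ≠ 0) {s : ℝ} (hs : s ^ 2 < b N) :
    p₂₂ s * (2 * p₁ 0 / p₂₂ 0 * (b N - s ^ 2) + s ^ 2) = 2 * b N * (p₁ s - s * p₁₂ s) := by
  have hB := H.B_pos.ne'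
  obtain ⟨τ, -, hτ⟩ := H.exists_tau hs
  obtain ⟨w, hw, hbw, -⟩ := exists_unit hV H.pos b b
  obtain ⟨h1, h2⟩ := H.unit_combination hw hbw hτ
  have h3 := H.quadratic_eq hV hT h1 (by rw [h2]; exact hs)
  rw [h2, H.T_eq hV hT hp, h1, h2] at h3
  have : T N N * (p₂₂ s * (2 * p₁ 0 / p₂₂ 0 * (b N - s ^ 2) + s ^ 2)
      - 2 * b N * (p₁ s - s * p₁₂ s)) = 0 := by
    field_simp at h3 ⊢
    linear_combination (T N N) * h3
  exact sub_eq_zero.1 ((mul_eq_zero.1 this).resolve_left hN)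

/-- If `d(b²)` vanishes and `φ` is not affine in `s`, then `β` is parallel at the point. -/
theorem T_eq_zero (hV : 3 ≤ Module.finrank ℝ V) (hN : T N N = 0) {s : ℝ} (hs0 : s ≠ 0)
    (hs : s ^ 2 < b N) (hp : p₂ s ≠ 0) (hp' : p₂₂ s ≠ 0) (u v : V) : T u v = 0 := by
  have hB := H.B_pos.ne'
  have hT := H.T_symm hV hs0 hs hp
  obtain ⟨τ, hτ0, hτ⟩ := H.exists_tau hs
  have key : ∀ w, A w w = 1 → b w = 0 → T w w = 0 := by
    intro w hw hbw
    obtain ⟨h1, h2⟩ := H.unit_combination hw hbw hτ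
    have h3 := H.quadratic_eq hV hT h1 (by rw [h2]; exact hs)
    have h4 := H.T_N_ker hV hbw
    rw [h2] at h3
    simp only [map_add, map_smul, LinearMap.add_apply, LinearMap.smul_apply, smul_eq_mul, hN,
      hT w N, h4] at h3
    have h5 : (p₂₂ s * b N * τ ^ 2) * T w w = 0 := by linear_combination h3
    exact (mul_eq_zero.1 h5).resolve_left (by positivity)
  have := H.T_eq_of_diag hV hT (k := 0) (fun w hw => by
    rcases eq_or_ne w 0 with rfl | hw0
    · simp
    have hA := H.pos w hw0
    have hss := Real.sq_sqrt hA.le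
    have hne := (Real.sqrt_pos.2 hA).ne'
    have h1 := key ((Real.sqrt (A w w))⁻¹ • w) (by
      simp only [map_smul, LinearMap.smul_apply, smul_eq_mul]
      field_simp; exact hss.symm) (by simp [hw])
    simp only [map_smul, LinearMap.smul_apply, smul_eq_mul] at h1
    have h2 : ((Real.sqrt (A w w))⁻¹ * (Real.sqrt (A w w))⁻¹) * T w w = 0 := by linarith
    rw [zero_mul]
    exact (mul_eq_zero.1 h2).resolve_left (by positivity)) u v
  rw [this, hN]; simp

end HamelSystem
end

/-! ### Flat metrics have non-constant `b²` -/

/-- A function with `|df| ≤ C |f - c|` which takes the value `c` is locally equal to `c`, by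
Grönwall's inequality along segments. -/
theorem eventually_eq_of_norm_fderiv_le {f : Vec n → ℝ} {x : Vec n} {c C : ℝ}
    (h : ∀ᶠ z in 𝓝 x, DifferentiableAt ℝ f z ∧ ‖fderiv ℝ f z‖ ≤ C * |f z - c|) (hx : f x = c) :
    ∀ᶠ z in 𝓝 x, f z = c := by
  obtain ⟨r, hr, hball⟩ := Metric.eventually_nhds_iff_ball.1 h
  filter_upwards [Metric.ball_mem_nhds x hr] with z hz
  have hmem : ∀ t ∈ Set.Icc (0 : ℝ) 1, x + t • (z - x) ∈ Metric.ball x r := by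
    intro t ht
    rw [mem_ball_iff_norm] at hz ⊢
    rw [add_sub_cancel_left, norm_smul, Real.norm_of_nonneg ht.1]
    exact (mul_le_of_le_one_left (norm_nonneg _) ht.2).trans_lt hz
  have hline : ∀ t : ℝ, HasDerivAt (fun t : ℝ => x + t • (z - x)) (z - x) t := fun t => by
    simpa using ((hasDerivAt_id t).smul_const (z - x)).const_add x
  have hd : ∀ t ∈ Set.Icc (0 : ℝ) 1, HasDerivAt (fun t : ℝ => f (x + t • (z - x)) - c)
      (fderiv ℝ f (x + t • (z - x)) (z - x)) t := fun t ht =>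
    (((hball _ (hmem t ht)).1.hasFDerivAt).comp_hasDerivAt t (hline t)).sub_const c
  have := eq_zero_of_abs_deriv_le_mul_abs_self_of_eq_zero_right (K := C * ‖z - x‖)
    (f := fun t : ℝ => f (x + t • (z - x)) - c) (f' := fun t => fderiv ℝ f (x + t • (z - x)) (z - x))
    (a := 0) (b := 1) (fun t ht => (hd t ht).continuousAt.continuousWithinAt)
    (fun t ht => (hd t ⟨ht.1, ht.2.le⟩).hasDerivWithinAt) (by simp [hx])
    (fun t ht => by
      refine (ContinuousLinearMap.le_opNorm _ _).trans ?_
      have := mul_le_mul_of_nonneg_right (hball _ (hmem t ⟨ht.1, ht.2.le⟩)).2 (norm_nonneg (z - x))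
      rw [Real.norm_eq_abs]
      linarith) 1 ⟨zero_le_one, le_rfl⟩
  simp only [one_smul, add_sub_cancel] at this
  linarith

/-- On a connected set, a level set that is open is everything or empty. -/
theorem eq_of_eventually_eq {U : Set (Vec n)} (hU : IsOpen U) (hUc : IsPreconnected U)
    {f : Vec n → ℝ} (hf : ContinuousOn f U) {c : ℝ}
    (h : ∀ x ∈ U, f x = c → ∀ᶠ z in 𝓝 x, f z = c) {x₀ : Vec n} (hx₀ : x₀ ∈ U) (h₀ : f x₀ = c)
    {x : Vec n} (hx : x ∈ U) : f x = c := by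
  have hu : IsOpen {x | ∀ᶠ z in 𝓝 x, f z = c} := isOpen_setOfPred_eventually_nhds
  have hv : IsOpen (U ∩ f ⁻¹' {c}ᶜ) := hf.isOpen_inter_preimage hU isOpen_compl_singleton
  have := hUc.subset_left_of_subset_union hu hv
    (by
      rw [Set.disjoint_left]
      rintro z hz ⟨-, hz2⟩
      exact hz2 (show ∀ᶠ w in 𝓝 z, f w = c from hz).self_of_nhds)
    (fun z hz => by
      by_cases hzc : f z = c
      · exact Or.inl (h z hz hzc)
      · exact Or.inr ⟨hz, hzc⟩) ⟨x₀, hx₀, h x₀ hx₀ h₀⟩ hx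
  exact (show ∀ᶠ w in 𝓝 x, f w = c from this).self_of_nhds

/-- If the derivative `g'` does not vanish at `s`, then `g` and `g'` are both nonzero at some
`t ≠ 0` near `s`. -/
theorem exists_near_ne {g g' : ℝ → ℝ} {s B : ℝ} (hg : HasDerivAt g (g' s) s)
    (hg' : ContinuousAt g' s) (hs : s ^ 2 < B) (hne : g' s ≠ 0) :
    ∃ t, t ≠ 0 ∧ t ^ 2 < B ∧ g t ≠ 0 ∧ g' t ≠ 0 := by
  have h1 : ∀ᶠ t in 𝓝[≠] s, g t ≠ 0 := hg.eventually_ne hne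
  have h2 : ∀ᶠ t in 𝓝[≠] s, t ≠ 0 := (hasDerivAt_id s).eventually_ne one_ne_zero
  have h3 : ∀ᶠ t in 𝓝[≠] s, g' t ≠ 0 := (hg'.eventually_ne hne).filter_mono nhdsWithin_le_nhds
  have h4 : ∀ᶠ t in 𝓝[≠] s, t ^ 2 < B :=
    ((continuous_pow 2).continuousAt.eventually (gt_mem_nhds hs)).filter_mono nhdsWithin_le_nhds
  obtain ⟨t, ht1, ht2, ht3, ht4⟩ := (h1.and (h2.and (h3.and h4))).exists
  exact ⟨t, ht2, ht4, ht1, ht3⟩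

/-- The metric `α_κ` at the point `x` as a bilinear map. -/
def metricBilin (κ : ℝ) (x : Vec n) : Vec n →ₗ[ℝ] Vec n →ₗ[ℝ] ℝ :=
  LinearMap.mk₂ ℝ (metricForm κ x) (fun u u' v => metricForm_add_left κ x u u' v)
    (fun t u v => metricForm_smul_left κ x u v t) (fun u v v' => metricForm_add_right κ x u v v')
    (fun t u v => metricForm_smul_right κ x u v t)

/-- The covariant derivative of `β` at the point `x` as a bilinear map. -/
def covBilin (κ : ℝ) (β : Vec n → (Vec n →L[ℝ] ℝ)) (x : Vec n) : Vec n →ₗ[ℝ] Vec n →ₗ[ℝ] ℝ :=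
  LinearMap.mk₂ ℝ (cov κ β x)
    (fun u u' v => by simp only [cov, map_add, inner_add_right]; ring)
    (fun t u v => by simp only [cov, map_smul, real_inner_smul_right, smul_eq_mul]; ring)
    (fun u v v' => by
      simp only [cov, map_add, inner_add_right, add_apply]; ring)
    (fun t u v => by
      simp only [cov, map_smul, real_inner_smul_right, smul_eq_mul,
        smul_apply]; ring)

@[simp] theorem metricBilin_apply (κ : ℝ) (x u v : Vec n) :
    metricBilin κ x u v = metricForm κ x u v := rfl

@[simp] theorem covBilin_apply (κ : ℝ) (β : Vec n → (Vec n →L[ℝ] ℝ)) (x u v : Vec n) :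
    covBilin κ β x u v = cov κ β x u v := rfl

theorem cov_eq_zero_of_eventually {κ : ℝ} {β : Vec n → (Vec n →L[ℝ] ℝ)} {x : Vec n}
    (h : ∀ᶠ z in 𝓝 x, β z = 0) (u v : Vec n) :
    cov κ β x u v = 0 := by
  have h1 : fderiv ℝ β x = 0 := by
    have : β =ᶠ[𝓝 x] fun _ => 0 := h
    rw [this.fderiv_eq]; simp
  simp [cov, h1, h.self_of_nhds]

/-- A general `(α, β)`-metric `α φ(b², β / α)` over a constant curvature metric in dimension at least
three, with `φ` smooth on the neighbourhood `Ω` of the set `|s| ≤ b`, such that `β` is not parallel,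
`φ₁` does not vanish on the axis `s = 0`, and `φ₂₂` is not identically zero. -/
structure Setting (κ : ℝ) (U : Set (Vec n)) (β : Vec n → (Vec n →L[ℝ] ℝ)) (φ : ℝ → ℝ → ℝ)
    (Ω : Set (ℝ × ℝ)) : Prop where
  three_le : 3 ≤ n
  isOpen : IsOpen U
  isConnected : IsConnected U
  conf_pos : ∀ x ∈ U, 0 < 1 + κ * ‖x‖ ^ 2
  smooth_form : ContDiffOn ℝ ∞ β U
  isOpen_dom : IsOpen Ω
  subset_dom : valueSet κ U β ⊆ Ω
  smooth : ContDiffOn ℝ ∞ (fun p : ℝ × ℝ => φ p.1 p.2) Ω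
  finsler : IsFinslerMetric U (generalMetric κ β φ)
  d1_ne : ∀ x ∈ U, d1 φ (bSq κ β x) 0 ≠ 0
  d22_ne : ∃ p ∈ valueSet κ U β, d2 (d2 φ) p.1 p.2 ≠ 0
  not_parallel : ¬ IsParallel κ U β

namespace Setting
variable {κ : ℝ} {U : Set (Vec n)} {β : Vec n → (Vec n →L[ℝ] ℝ)} {φ : ℝ → ℝ → ℝ}
  {Ω : Set (ℝ × ℝ)} (S : Setting κ U β φ Ω) {x : Vec n}
include S

theorem three_le_finrank : 3 ≤ Module.finrank ℝ (Vec n) := by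
  rw [finrank_euclideanSpace_fin]; exact S.three_le

theorem contDiffAt_form (hx : x ∈ U) : ContDiffAt ℝ ∞ β x :=
  S.smooth_form.contDiffAt (S.isOpen.mem_nhds hx)

theorem differentiableAt_form (hx : x ∈ U) : DifferentiableAt ℝ β x :=
  (S.contDiffAt_form hx).differentiableAt (by simp)

theorem differentiableAt_bSq (hx : x ∈ U) : DifferentiableAt ℝ (bSq κ β) x :=
  GeneralAlphaBeta.differentiableAt_bSq (S.conf_pos x hx) (S.differentiableAt_form hx)

theorem continuousOn_bSq : ContinuousOn (bSq κ β) U := fun _ hx =>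
  (S.differentiableAt_bSq hx).continuousAt.continuousWithinAt

theorem mem_dom (hx : x ∈ U) {s : ℝ} (hs : s ^ 2 ≤ bSq κ β x) : (bSq κ β x, s) ∈ Ω :=
  S.subset_dom ⟨x, hx, rfl, hs⟩

theorem mem_dom_zero (hx : x ∈ U) : (bSq κ β x, 0) ∈ Ω :=
  S.mem_dom hx (by simpa using bSq_nonneg (S.conf_pos x hx) β)

theorem continuousAt_d1 {p : ℝ × ℝ} (hp : p ∈ Ω) :
    ContinuousAt (fun p : ℝ × ℝ => d1 φ p.1 p.2) p :=
  (contDiffOn_d1 S.isOpen_dom S.smooth).continuousOn.continuousAt (S.isOpen_dom.mem_nhds hp)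

theorem continuousAt_d22 {p : ℝ × ℝ} (hp : p ∈ Ω) :
    ContinuousAt (fun p : ℝ × ℝ => d2 (d2 φ) p.1 p.2) p :=
  (contDiffOn_d2 S.isOpen_dom (contDiffOn_d2 S.isOpen_dom S.smooth)).continuousOn.continuousAt
    (S.isOpen_dom.mem_nhds hp)

theorem continuousAt_d12 {p : ℝ × ℝ} (hp : p ∈ Ω) :
    ContinuousAt (fun p : ℝ × ℝ => d2 (d1 φ) p.1 p.2) p :=
  (contDiffOn_d2 S.isOpen_dom (contDiffOn_d1 S.isOpen_dom S.smooth)).continuousOn.continuousAt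
    (S.isOpen_dom.mem_nhds hp)

theorem not_cov_eq_zero : ¬ ∀ x ∈ U, ∀ u v, cov κ β x u v = 0 := fun h =>
  S.not_parallel fun x hx i j => by
    rw [covDeriv_eq_cov (S.conf_pos x hx) (S.differentiableAt_form hx), h x hx]

theorem hamelSystem (hflat : IsProjectivelyFlat U (generalMetric κ β φ)) (hx : x ∈ U)
    (hb : β x ≠ 0) : HamelSystem (metricBilin κ x) (covBilin κ β x) (β x : Vec n →ₗ[ℝ] ℝ)
      (sharp κ β x) (d1 φ (bSq κ β x)) (d2 φ (bSq κ β x)) (d2 (d1 φ) (bSq κ β x))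
      (d2 (d2 φ) (bSq κ β x)) where
  symm := fun u v => metricForm_comm κ x u v
  pos := fun v hv => metricForm_pos (S.conf_pos x hx) hv
  apply_left := fun v => metricForm_sharp (S.conf_pos x hx) β v
  ne := fun h => (bSq_pos (S.conf_pos x hx) hb).ne' (by
    rw [bSq_eq_apply_sharp (S.conf_pos x hx), h, map_zero])
  coeff_ne := S.d1_ne x hx
  eq := fun u hu v => by
    have h := (isProjectivelyFlat_iff S.isOpen S.finsler).1 hflat x hx u
      (by rintro rfl; simp at hu) v
    rwa [hamel_generalMetric_unit S.isOpen S.conf_pos S.isOpen_dom S.subset_dom S.smooth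
      S.finsler.smooth hx (S.differentiableAt_form hx) hu] at h

theorem apply_sharp (hx : x ∈ U) : β x (sharp κ β x) = bSq κ β x :=
  (bSq_eq_apply_sharp (S.conf_pos x hx) β).symm

theorem bSq_pos (hx : x ∈ U) (hb : β x ≠ 0) : 0 < bSq κ β x :=
  GeneralAlphaBeta.bSq_pos (S.conf_pos x hx) hb

theorem form_ne_zero (hx : x ∈ U) (hb : 0 < bSq κ β x) : β x ≠ 0 := fun h =>
  hb.ne' ((bSq_eq_zero_iff (S.conf_pos x hx) β).2 h)

theorem not_bSq_eq_zero : ¬ ∀ x ∈ U, bSq κ β x = 0 := fun h =>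
  S.not_cov_eq_zero fun _ hx u v => cov_eq_zero_of_eventually
    (Filter.mem_of_superset (S.isOpen.mem_nhds hx) fun z hz =>
      (bSq_eq_zero_iff (S.conf_pos z hz) β).1 (h z hz)) u v

theorem hasDerivAt_d2_slice {B s : ℝ} (h : (B, s) ∈ Ω) :
    HasDerivAt (d2 φ B) (d2 (d2 φ) B s) s :=
  hasDerivAt_d2 S.isOpen_dom (contDiffOn_d2 S.isOpen_dom S.smooth) h

theorem continuousAt_d22_slice {B s : ℝ} (h : (B, s) ∈ Ω) :
    ContinuousAt (d2 (d2 φ) B) s :=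
  ContinuousAt.comp (f := fun s' => (B, s')) (g := fun p : ℝ × ℝ => d2 (d2 φ) p.1 p.2)
    (S.continuousAt_d22 h) (by fun_prop)

/-- If `b²` were constant, then `d(b²) = 0` and a value of `s` with `φ₂ φ₂₂ ≠ 0` would make `β`
parallel. -/
theorem bSq_not_const (hflat : IsProjectivelyFlat U (generalMetric κ β φ)) (B : ℝ) :
    ¬ ∀ x ∈ U, bSq κ β x = B := by
  intro hc
  rcases eq_or_ne B 0 with rfl | hB0
  · exact S.not_bSq_eq_zero hc
  obtain ⟨⟨B', s⟩, ⟨x₀, hx₀, hB', hs⟩, hne⟩ := S.d22_ne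
  simp only [hc x₀ hx₀] at hB' hs hne
  subst hB'
  have hBpos : 0 < B' := lt_of_le_of_ne (hc x₀ hx₀ ▸ bSq_nonneg (S.conf_pos x₀ hx₀) β) hB0.symm
  have hmem : ∀ t : ℝ, t ^ 2 ≤ B' → (B', t) ∈ Ω := fun t ht => by
    have := S.mem_dom hx₀ (s := t) (by rw [hc x₀ hx₀]; exact ht)
    rwa [hc x₀ hx₀] at this
  -- `φ₂₂ ≠ 0` persists in the interior of the domain, and near such a point `φ₂ ≠ 0` somewhere
  obtain ⟨s', hs', hne'⟩ : ∃ s', s' ^ 2 < B' ∧ d2 (d2 φ) B' s' ≠ 0 := by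
    have h1 : ContinuousAt (fun t : ℝ => d2 (d2 φ) B' (t * s)) 1 := by
      refine ContinuousAt.comp (f := fun t : ℝ => t * s) (g := d2 (d2 φ) B') ?_ (by fun_prop)
      simpa using S.continuousAt_d22_slice (hmem s hs)
    have h2 : ∀ᶠ t in 𝓝[<] (1 : ℝ), d2 (d2 φ) B' (t * s) ≠ 0 :=
      (h1.eventually_ne (by simpa using hne)).filter_mono nhdsWithin_le_nhds
    have h3 : ∀ᶠ t in 𝓝[<] (1 : ℝ), 0 < t :=
      (lt_mem_nhds zero_lt_one).filter_mono nhdsWithin_le_nhds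
    obtain ⟨t, ht1, ht2, ht3⟩ := (h2.and (h3.and self_mem_nhdsWithin)).exists
    have ht3' : t < 1 := ht3
    refine ⟨t * s, ?_, ht1⟩
    rw [mul_pow]
    have : t ^ 2 < 1 := by nlinarith
    nlinarith [sq_nonneg s]
  obtain ⟨t, ht0, ht, hp, hp'⟩ := exists_near_ne (S.hasDerivAt_d2_slice (hmem s' hs'.le))
    (S.continuousAt_d22_slice (hmem s' hs'.le)) hs' hne'
  refine S.not_cov_eq_zero fun x hx u v => ?_
  have hb : β x ≠ 0 := S.form_ne_zero hx (by rw [hc x hx]; exact hBpos)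
  have H := S.hamelSystem hflat hx hb
  rw [hc x hx] at H
  refine H.T_eq_zero S.three_le_finrank ?_ ht0
    (by rw [ContinuousLinearMap.coe_coe, S.apply_sharp hx, hc x hx]; exact ht) hp hp' u v
  have h1 : bSq κ β =ᶠ[𝓝 x] fun _ => B' :=
    Filter.mem_of_superset (S.isOpen.mem_nhds hx) fun z hz => hc z hz
  have h2 := fderiv_bSq (S.conf_pos x hx) (S.differentiableAt_form hx) (sharp κ β x)
  rw [h1.fderiv_eq] at h2
  simp at h2
  simpa using h2

end Setting

/-! ### The equations for `φ` and `β` of a flat metric -/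

theorem continuousAt_cov {κ : ℝ} {β : Vec n → (Vec n →L[ℝ] ℝ)} {x : Vec n}
    (hx : 0 < 1 + κ * ‖x‖ ^ 2) (hβ : ContDiffAt ℝ ∞ β x) {f g : Vec n → Vec n}
    (hf : ContinuousAt f x) (hg : ContinuousAt g x) :
    ContinuousAt (fun z => cov κ β z (f z) (g z)) x := by
  have h1 : ContinuousAt (fderiv ℝ β) x :=
    (hβ.fderiv_right (m := ∞) (by simp)).continuousAt
  have h2 : ContinuousAt β x := hβ.continuousAt
  have h3 : ContinuousAt (fun z : Vec n => 1 + κ * ‖z‖ ^ 2) x := by fun_prop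
  have h4 : ∀ g : Vec n → Vec n, ContinuousAt g x → ContinuousAt (fun z => inner ℝ z (g z)) x :=
    fun g hg => continuousAt_id.inner (𝕜 := ℝ) hg
  exact ((h1.clm_apply hg).clm_apply hf).add ((continuousAt_const.div h3 hx.ne').mul
    (((h4 g hg).mul (h2.clm_apply hf)).add ((h4 f hf).mul (h2.clm_apply hg))))

theorem continuousAt_metricForm {κ : ℝ} {x : Vec n} (hx : 0 < 1 + κ * ‖x‖ ^ 2)
    {f g : Vec n → Vec n} (hf : ContinuousAt f x) (hg : ContinuousAt g x) :
    ContinuousAt (fun z => metricForm κ z (f z) (g z)) x := by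
  have h3 : ContinuousAt (fun z : Vec n => 1 + κ * ‖z‖ ^ 2) x := by fun_prop
  have h4 : ∀ g : Vec n → Vec n, ContinuousAt g x → ContinuousAt (fun z => inner ℝ z (g z)) x :=
    fun g hg => continuousAt_id.inner (𝕜 := ℝ) hg
  exact ((hf.inner (𝕜 := ℝ) hg).div h3 hx.ne').sub
    (((continuousAt_const.mul (h4 f hf)).mul (h4 g hg)).div (h3.pow 2) (pow_pos hx 2).ne')

namespace Setting
variable {κ : ℝ} {U : Set (Vec n)} {β : Vec n → (Vec n →L[ℝ] ℝ)} {φ : ℝ → ℝ → ℝ}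
  {Ω : Set (ℝ × ℝ)} (S : Setting κ U β φ Ω) {x : Vec n}
include S

/-- `d(b²)` is a multiple of `β`. -/
theorem fderiv_bSq_eq (hflat : IsProjectivelyFlat U (generalMetric κ β φ)) (hx : x ∈ U)
    (hb : β x ≠ 0) (v : Vec n) : fderiv ℝ (bSq κ β) x v
      = 2 * (cov κ β x (sharp κ β x) (sharp κ β x) / bSq κ β x) * β x v := by
  have H := S.hamelSystem hflat hx hb
  have := H.T_N S.three_le_finrank v
  simp only [covBilin_apply, ContinuousLinearMap.coe_coe, S.apply_sharp hx] at this
  rw [fderiv_bSq (S.conf_pos x hx) (S.differentiableAt_form hx), this]; ring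

/-- The multiple in `d(b²) = λ β`, expressed by the diagonal value of the covariant derivative at a
vector `w` of the kernel of `β`. The factor `φ₂₂ / φ₁` is evaluated at `s = 0`. -/
theorem fderiv_bSq_eq' (hflat : IsProjectivelyFlat U (generalMetric κ β φ)) (hx : x ∈ U)
    (hb : β x ≠ 0) {w : Vec n} (hw : β x w = 0) (hA : metricForm κ x w w ≠ 0) (v : Vec n) :
    fderiv ℝ (bSq κ β) x v = d2 (d2 φ) (bSq κ β x) 0 / d1 φ (bSq κ β x) 0 *
      (cov κ β x w w / metricForm κ x w w) * β x v := by
  have H := S.hamelSystem hflat hx hb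
  have := H.T_diag_zero S.three_le_finrank (w := w) hw
  simp only [covBilin_apply, metricBilin_apply, ContinuousLinearMap.coe_coe,
    S.apply_sharp hx] at this
  rw [S.fderiv_bSq_eq hflat hx hb]
  have hB := (S.bSq_pos hx hb).ne'
  have h1 := S.d1_ne x hx
  congr 1
  field_simp
  linarith

/-- If `φ₂₂(b², 0)` vanished at a point with `β ≠ 0`, then `d(b²)` would be bounded by a multiple of
`|b² - b₀²|` near that level set, hence the level set would be open, and `b²` constant. -/
theorem d22_zero_ne_of_ne (hflat : IsProjectivelyFlat U (generalMetric κ β φ)) (hx : x ∈ U)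
    (hb : β x ≠ 0) : d2 (d2 φ) (bSq κ β x) 0 ≠ 0 := by
  intro h0
  refine S.bSq_not_const hflat (bSq κ β x) fun z hz => ?_
  refine eq_of_eventually_eq S.isOpen S.isConnected.isPreconnected S.continuousOn_bSq
    (fun x₁ hx₁ hB => ?_) hx rfl hz
  have hpos : 0 < bSq κ β x₁ := hB ▸ S.bSq_pos hx hb
  have hb₁ := S.form_ne_zero hx₁ hpos
  have hc1 := S.conf_pos x₁ hx₁
  obtain ⟨w, hw, hbw, -⟩ := exists_unit S.three_le_finrank
    (S.hamelSystem hflat hx₁ hb₁).pos (β x₁ : Vec n →ₗ[ℝ] ℝ) (β x₁ : Vec n →ₗ[ℝ] ℝ)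
  simp only [metricBilin_apply, ContinuousLinearMap.coe_coe] at hw hbw
  -- a continuous field in the kernel of `β`
  have cβ := (S.contDiffAt_form hx₁).continuousAt
  have cB := (S.differentiableAt_bSq hx₁).continuousAt
  have cW : ContinuousAt (fun z => w - (β z w / bSq κ β z) • sharp κ β z) x₁ :=
    continuousAt_const.sub (((cβ.clm_apply continuousAt_const).div cB hpos.ne').smul
      (differentiableAt_sharp (S.differentiableAt_form hx₁)).continuousAt)
  have hW₁ : w - (β x₁ w / bSq κ β x₁) • sharp κ β x₁ = w := by simp [hbw]
  have cA := continuousAt_metricForm hc1 cW cW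
  have cT := continuousAt_cov hc1 (S.contDiffAt_form hx₁) cW cW
  have hA₁ : metricForm κ x₁ (w - (β x₁ w / bSq κ β x₁) • sharp κ β x₁)
      (w - (β x₁ w / bSq κ β x₁) • sharp κ β x₁) ≠ 0 := by rw [hW₁, hw]; exact one_ne_zero
  have cK := (cT.div cA hA₁).norm.mul cβ.norm
  obtain ⟨M, hM⟩ : ∃ M, ∀ᶠ z in 𝓝 x₁, ‖cov κ β z (w - (β z w / bSq κ β z) • sharp κ β z)
      (w - (β z w / bSq κ β z) • sharp κ β z) /
      metricForm κ z (w - (β z w / bSq κ β z) • sharp κ β z)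
      (w - (β z w / bSq κ β z) • sharp κ β z)‖ * ‖β z‖ ≤ M :=
    ⟨_, (cK.eventually (gt_mem_nhds (lt_add_one _))).mono fun z hz => hz.le⟩
  -- the coefficient vanishes to first order
  have hmem := S.mem_dom_zero hx
  have he : HasDerivAt (fun B => d2 (d2 φ) B 0 / d1 φ B 0) _ (bSq κ β x) :=
    (hasDerivAt_d1 S.isOpen_dom
      (contDiffOn_d2 S.isOpen_dom (contDiffOn_d2 S.isOpen_dom S.smooth)) hmem).div
      (hasDerivAt_d1 S.isOpen_dom (contDiffOn_d1 S.isOpen_dom S.smooth) hmem) (S.d1_ne x hx)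
  obtain ⟨C, hC⟩ := he.isBigO_sub.bound
  rw [← hB] at hC
  have hC' := cB.eventually hC
  have hU := S.isOpen.mem_nhds hx₁
  have hne : ∀ᶠ z in 𝓝 x₁, 0 < bSq κ β z := cB.eventually (lt_mem_nhds hpos)
  refine eventually_eq_of_norm_fderiv_le (C := C * M) ?_ hB
  filter_upwards [hM, hC', hU, hne, cA.eventually_ne hA₁] with z hzM hzC hzU hzpos hzA
  refine ⟨S.differentiableAt_bSq hzU, ?_⟩
  have hM0 : 0 ≤ M := le_trans (by positivity) hzM
  have hbz : β z (w - (β z w / bSq κ β z) • sharp κ β z) = 0 := by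
    rw [map_sub, map_smul, S.apply_sharp hzU]
    have := hzpos.ne'
    simp [this]
  rw [hB] at hzC
  rw [h0, zero_div, sub_zero, Real.norm_eq_abs (bSq κ β z - bSq κ β x)] at hzC
  have hCnn : 0 ≤ C * |bSq κ β z - bSq κ β x| := le_trans (norm_nonneg _) hzC
  refine ContinuousLinearMap.opNorm_le_bound _ (by nlinarith) fun v => ?_
  rw [S.fderiv_bSq_eq' hflat hzU (S.form_ne_zero hzU hzpos) hbz hzA, norm_mul, norm_mul]
  have h1 := mul_le_mul_of_nonneg_right hzM (norm_nonneg v)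
  have h2 := ContinuousLinearMap.le_opNorm (β z) v
  have h3 := mul_le_mul_of_nonneg_left h2 (norm_nonneg
    (cov κ β z (w - (β z w / bSq κ β z) • sharp κ β z)
      (w - (β z w / bSq κ β z) • sharp κ β z) /
      metricForm κ z (w - (β z w / bSq κ β z) • sharp κ β z)
      (w - (β z w / bSq κ β z) • sharp κ β z)))
  have h4 := mul_le_mul hzC (h3.trans (le_of_eq_of_le (mul_assoc _ _ _).symm h1)) (by positivity) hCnn
  rw [mul_assoc]
  exact h4.trans_eq (by ring)

/-- Values of `b²` at which `d(b²)` does not vanish identically are dense in the set of values: a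
value which is critical at all its points has an open level set when the neighbouring values are
critical too. -/
theorem exists_near_fderiv_ne (hconst : ∀ B, ¬ ∀ x ∈ U, bSq κ β x = B) (hx : x ∈ U) {ε : ℝ}
    (hε : 0 < ε) :
    ∃ z ∈ U, |bSq κ β z - bSq κ β x| < ε ∧ 0 < bSq κ β z ∧ fderiv ℝ (bSq κ β) z ≠ 0 := by
  by_contra! hcon
  obtain ⟨x₁, hx₁, hne⟩ : ∃ x₁ ∈ U, bSq κ β x₁ ≠ bSq κ β x := by
    have := hconst (bSq κ β x)
    push Not at this
    exact this
  have hx0 := bSq_nonneg (S.conf_pos x hx) β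
  have hx10 := bSq_nonneg (S.conf_pos x₁ hx₁) β
  -- a value strictly between, close to the first one
  obtain ⟨m, hm1, hm2, hm3, hm4⟩ : ∃ m, m ∈ Set.uIcc (bSq κ β x) (bSq κ β x₁) ∧
      |m - bSq κ β x| < ε ∧ 0 < m ∧ m ≠ bSq κ β x := by
    rcases lt_or_gt_of_ne hne with h | h
    · have h1 : (bSq κ β x₁ + bSq κ β x) / 2 < bSq κ β x := by linarith
      have h2 : bSq κ β x - ε / 2 < bSq κ β x := by linarith
      have h3 := max_lt h1 h2
      have h4 := le_max_right ((bSq κ β x₁ + bSq κ β x) / 2) (bSq κ β x - ε / 2)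
      refine ⟨max ((bSq κ β x₁ + bSq κ β x) / 2) (bSq κ β x - ε / 2), ?_, ?_, ?_, h3.ne⟩
      · rw [Set.uIcc_of_ge h.le]
        exact ⟨le_max_of_le_left (by linarith), h3.le⟩
      · rw [abs_lt]
        exact ⟨by linarith, by linarith⟩
      · exact lt_max_of_lt_left (by linarith)
    · have h1 : bSq κ β x < (bSq κ β x₁ + bSq κ β x) / 2 := by linarith
      have h2 : bSq κ β x < bSq κ β x + ε / 2 := by linarith
      have h3 := lt_min h1 h2
      have h4 := min_le_right ((bSq κ β x₁ + bSq κ β x) / 2) (bSq κ β x + ε / 2)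
      refine ⟨min ((bSq κ β x₁ + bSq κ β x) / 2) (bSq κ β x + ε / 2), ?_, ?_, ?_, h3.ne'⟩
      · rw [Set.uIcc_of_le h.le]
        exact ⟨h3.le, min_le_of_left_le (by linarith)⟩
      · rw [abs_lt]
        exact ⟨by linarith, by linarith⟩
      · exact lt_min (by linarith) (by linarith)
  obtain ⟨z, hz, rfl⟩ : ∃ z ∈ U, bSq κ β z = m := by
    have hpre := S.isConnected.isPreconnected.image _ S.continuousOn_bSq
    exact hpre.ordConnected.uIcc_subset ⟨x, hx, rfl⟩ ⟨x₁, hx₁, rfl⟩ hm1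
  have hconstz := hconst (bSq κ β z)
  refine hconstz fun z' hz' => ?_
  refine eq_of_eventually_eq S.isOpen S.isConnected.isPreconnected S.continuousOn_bSq
    (fun y hy hB => ?_) hz rfl hz'
  have cB := (S.differentiableAt_bSq hy).continuousAt
  refine eventually_eq_of_norm_fderiv_le (C := 0) ?_ hB
  have h1 : ∀ᶠ q in 𝓝 y, 0 < bSq κ β q := cB.eventually (lt_mem_nhds (hB ▸ hm3))
  have h2 : ∀ᶠ q in 𝓝 y, |bSq κ β q - bSq κ β x| < ε :=
    (cB.sub continuousAt_const).abs.eventually (gt_mem_nhds (by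
      show |bSq κ β y - bSq κ β x| < ε
      rw [hB]; exact hm2))
  filter_upwards [h1, h2, S.isOpen.mem_nhds hy] with q hq1 hq2 hq3
  refine ⟨S.differentiableAt_bSq hq3, ?_⟩
  rw [hcon q hq3 hq2 hq1]; simp

theorem cov_symm (hflat : IsProjectivelyFlat U (generalMetric κ β φ)) (hx : x ∈ U)
    (hb : β x ≠ 0) (u v : Vec n) : cov κ β x u v = cov κ β x v u := by
  have hmem := S.mem_dom_zero hx
  obtain ⟨t, ht0, ht, hp, -⟩ := exists_near_ne (S.hasDerivAt_d2_slice hmem)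
    (S.continuousAt_d22_slice hmem) (by simpa using S.bSq_pos hx hb)
    (S.d22_zero_ne_of_ne hflat hx hb)
  exact (S.hamelSystem hflat hx hb).T_symm S.three_le_finrank ht0
    (by rw [ContinuousLinearMap.coe_coe, S.apply_sharp hx]; exact ht) hp u v

/-- The covariant derivative of `β` where `β ≠ 0`, with `c = 2 φ₁ / φ₂₂` at `s = 0`:
`b_{i|j}` is a multiple of `c a_{ij} + (1 - c) bᵢ bⱼ / b²`. -/
theorem cov_eq (hflat : IsProjectivelyFlat U (generalMetric κ β φ)) (hx : x ∈ U)
    (hb : β x ≠ 0) (u v : Vec n) : cov κ β x u v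
      = cov κ β x (sharp κ β x) (sharp κ β x) / bSq κ β x *
        (2 * d1 φ (bSq κ β x) 0 / d2 (d2 φ) (bSq κ β x) 0 * metricForm κ x u v
          + (1 - 2 * d1 φ (bSq κ β x) 0 / d2 (d2 φ) (bSq κ β x) 0) / bSq κ β x
              * (β x u * β x v)) := by
  have := (S.hamelSystem hflat hx hb).T_eq S.three_le_finrank (S.cov_symm hflat hx hb)
    (S.d22_zero_ne_of_ne hflat hx hb) u v
  simp only [covBilin_apply, metricBilin_apply, ContinuousLinearMap.coe_coe,
    S.apply_sharp hx] at this
  rw [this]; ring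

theorem pde_of_fderiv_ne (hflat : IsProjectivelyFlat U (generalMetric κ β φ)) (hx : x ∈ U)
    (hb : β x ≠ 0) (hd : fderiv ℝ (bSq κ β) x ≠ 0) {s : ℝ} (hs : s ^ 2 < bSq κ β x) :
    d2 (d2 φ) (bSq κ β x) s * (2 * d1 φ (bSq κ β x) 0 * (bSq κ β x - s ^ 2)
        + d2 (d2 φ) (bSq κ β x) 0 * s ^ 2)
      = d2 (d2 φ) (bSq κ β x) 0 *
        (2 * bSq κ β x * (d1 φ (bSq κ β x) s - s * d2 (d1 φ) (bSq κ β x) s)) := by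
  have hN : cov κ β x (sharp κ β x) (sharp κ β x) ≠ 0 := by
    intro h0
    apply hd
    ext v
    rw [S.fderiv_bSq_eq hflat hx hb, h0]; simp
  have hp := S.d22_zero_ne_of_ne hflat hx hb
  have := (S.hamelSystem hflat hx hb).pde S.three_le_finrank (S.cov_symm hflat hx hb) hp hN
    (s := s) (by rw [ContinuousLinearMap.coe_coe, S.apply_sharp hx]; exact hs)
  simp only [ContinuousLinearMap.coe_coe, S.apply_sharp hx] at this
  rw [← this]
  field_simp

/-- The differential equation for `φ` holds at all points of the set `|s| ≤ b`, by continuity from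
the points where `d(b²) ≠ 0` and `|s| < b`. -/
theorem pde (hflat : IsProjectivelyFlat U (generalMetric κ β φ)) (hx : x ∈ U)
    {s : ℝ} (hs : s ^ 2 ≤ bSq κ β x) :
    d2 (d2 φ) (bSq κ β x) s * (2 * d1 φ (bSq κ β x) 0 * (bSq κ β x - s ^ 2)
        + d2 (d2 φ) (bSq κ β x) 0 * s ^ 2)
      = d2 (d2 φ) (bSq κ β x) 0 *
        (2 * bSq κ β x * (d1 φ (bSq κ β x) s - s * d2 (d1 φ) (bSq κ β x) s)) := by
  rcases (bSq_nonneg (S.conf_pos x hx) β).eq_or_lt with h0 | hpos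
  · have : s = 0 := by
      have : s ^ 2 ≤ 0 := by rw [h0]; exact hs
      exact pow_eq_zero_iff two_ne_zero |>.1 (le_antisymm this (sq_nonneg s))
    rw [← h0, this]; ring
  set G : ℝ × ℝ → ℝ := fun p => d2 (d2 φ) p.1 p.2 * (2 * d1 φ p.1 0 * (p.1 - p.2 ^ 2)
        + d2 (d2 φ) p.1 0 * p.2 ^ 2)
      - d2 (d2 φ) p.1 0 * (2 * p.1 * (d1 φ p.1 p.2 - p.2 * d2 (d1 φ) p.1 p.2)) with hG
  have hmem := S.mem_dom hx hs
  have hmem0 := S.mem_dom_zero hx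
  have cG : ContinuousAt G (bSq κ β x, s) := by
    have c1 := S.continuousAt_d1 hmem
    have c2 := S.continuousAt_d22 hmem
    have c3 := S.continuousAt_d12 hmem
    have c4 : ContinuousAt (fun p : ℝ × ℝ => d1 φ p.1 0) (bSq κ β x, s) :=
      ContinuousAt.comp (f := fun p : ℝ × ℝ => (p.1, (0 : ℝ)))
        (g := fun p : ℝ × ℝ => d1 φ p.1 p.2) (S.continuousAt_d1 hmem0) (by fun_prop)
    have c5 : ContinuousAt (fun p : ℝ × ℝ => d2 (d2 φ) p.1 0) (bSq κ β x, s) :=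
      ContinuousAt.comp (f := fun p : ℝ × ℝ => (p.1, (0 : ℝ)))
        (g := fun p : ℝ × ℝ => d2 (d2 φ) p.1 p.2) (S.continuousAt_d22 hmem0) (by fun_prop)
    have cf : ContinuousAt (Prod.fst : ℝ × ℝ → ℝ) (bSq κ β x, s) := continuousAt_fst
    have cs : ContinuousAt (Prod.snd : ℝ × ℝ → ℝ) (bSq κ β x, s) := continuousAt_snd
    exact (c2.mul (((continuousAt_const.mul c4).mul (cf.sub (cs.pow 2))).add
      (c5.mul (cs.pow 2)))).sub (c5.mul ((continuousAt_const.mul cf).mul (c1.sub (cs.mul c3))))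
  by_contra hne
  have hGne : G (bSq κ β x, s) ≠ 0 := sub_ne_zero.2 hne
  have hev := cG.eventually_ne hGne
  -- move `s` into the open interval
  obtain ⟨t, ht, htG⟩ : ∃ t, t ^ 2 < bSq κ β x ∧ ∀ᶠ B in 𝓝 (bSq κ β x), G (B, t) ≠ 0 := by
    have h1 : Tendsto (fun r : ℝ => (bSq κ β x, r * s)) (𝓝 1) (𝓝 (bSq κ β x, s)) := by
      have : ContinuousAt (fun r : ℝ => (bSq κ β x, r * s)) 1 := by fun_prop
      simpa [ContinuousAt] using this
    have h2 : ∀ᶠ r in 𝓝[<] (1 : ℝ), ∀ᶠ p in 𝓝 (bSq κ β x, r * s), G p ≠ 0 :=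
      (h1.eventually hev.eventually_nhds).filter_mono nhdsWithin_le_nhds
    have h3 : ∀ᶠ t in 𝓝[<] (1 : ℝ), 0 < t :=
      (lt_mem_nhds zero_lt_one).filter_mono nhdsWithin_le_nhds
    obtain ⟨r, hr1, hr2, hr3⟩ := (h2.and (h3.and self_mem_nhdsWithin)).exists
    have hr3' : r < 1 := hr3
    refine ⟨r * s, ?_, ?_⟩
    · rw [mul_pow]
      have : r ^ 2 < 1 := by nlinarith
      nlinarith [sq_nonneg s]
    · have h4 : Tendsto (fun B : ℝ => (B, r * s)) (𝓝 (bSq κ β x)) (𝓝 (bSq κ β x, r * s)) := by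
        have : ContinuousAt (fun B : ℝ => (B, r * s)) (bSq κ β x) := by fun_prop
        exact this
      exact h4.eventually hr1
  obtain ⟨ε, hε, hball⟩ := Metric.eventually_nhds_iff_ball.1 (htG.and (lt_mem_nhds ht))
  obtain ⟨z, hz, hz1, hz2, hz3⟩ := S.exists_near_fderiv_ne (S.bSq_not_const hflat) hx hε
  have := hball (bSq κ β z) (by rw [mem_ball_iff_norm]; exact hz1)
  exact this.1 (sub_eq_zero.2 (S.pde_of_fderiv_ne hflat hz (S.form_ne_zero hz hz2) hz3 this.2))

/-- At a zero of `β` the number `c = 2 φ₁ / φ₂₂` is one: divide the equation for `φ` at `s = b` by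
`b²` and let `b → 0`. -/
theorem d22_zero_of_eq_zero (hflat : IsProjectivelyFlat U (generalMetric κ β φ)) (hx : x ∈ U)
    (hb : bSq κ β x = 0) : d2 (d2 φ) 0 0 = 2 * d1 φ 0 0 := by
  have hmem : ((0 : ℝ), (0 : ℝ)) ∈ Ω := by simpa [hb] using S.mem_dom_zero hx
  set G : ℝ → ℝ := fun r => d2 (d2 φ) (r ^ 2) r
      - 2 * (d1 φ (r ^ 2) r - r * d2 (d1 φ) (r ^ 2) r) with hG
  have cG : ContinuousAt G 0 := by
    have cp : ContinuousAt (fun r : ℝ => (r ^ 2, r)) 0 := by fun_prop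
    have hm : ((0 : ℝ) ^ 2, (0 : ℝ)) ∈ Ω := by simpa using hmem
    have c1 : ContinuousAt (fun r : ℝ => d1 φ (r ^ 2) r) 0 :=
      ContinuousAt.comp (f := fun r : ℝ => (r ^ 2, r)) (g := fun p : ℝ × ℝ => d1 φ p.1 p.2)
        (S.continuousAt_d1 hm) cp
    have c2 : ContinuousAt (fun r : ℝ => d2 (d2 φ) (r ^ 2) r) 0 :=
      ContinuousAt.comp (f := fun r : ℝ => (r ^ 2, r)) (g := fun p : ℝ × ℝ => d2 (d2 φ) p.1 p.2)
        (S.continuousAt_d22 hm) cp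
    have c3 : ContinuousAt (fun r : ℝ => d2 (d1 φ) (r ^ 2) r) 0 :=
      ContinuousAt.comp (f := fun r : ℝ => (r ^ 2, r)) (g := fun p : ℝ × ℝ => d2 (d1 φ) p.1 p.2)
        (S.continuousAt_d12 hm) cp
    exact c2.sub (continuousAt_const.mul (c1.sub (continuousAt_id.mul c3)))
  by_contra hne
  have hG0 : G 0 ≠ 0 := by
    simp only [hG]
    intro h
    apply hne
    norm_num at h
    linarith
  obtain ⟨ε, hε, hball⟩ := Metric.eventually_nhds_iff_ball.1 (cG.eventually_ne hG0)
  obtain ⟨z, hz, hz1, hz2, -⟩ := S.exists_near_fderiv_ne (S.bSq_not_const hflat) hx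
    (pow_pos hε 2)
  rw [hb, sub_zero, abs_of_pos hz2] at hz1
  have hsq := Real.sq_sqrt hz2.le
  refine hball (Real.sqrt (bSq κ β z)) ?_ ?_
  · rw [mem_ball_iff_norm, sub_zero, Real.norm_of_nonneg (Real.sqrt_nonneg _)]
    exact (Real.sqrt_lt' hε).2 hz1
  · have h1 := S.pde hflat hz (s := Real.sqrt (bSq κ β z)) hsq.le
    have h2 := S.d22_zero_ne_of_ne hflat hz (S.form_ne_zero hz hz2)
    simp only [hG, hsq]
    rw [hsq, sub_self, mul_zero, zero_add] at h1
    have h3 : d2 (d2 φ) (bSq κ β z) 0 * bSq κ β z * (d2 (d2 φ) (bSq κ β z) √(bSq κ β z)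
      - 2 * (d1 φ (bSq κ β z) √(bSq κ β z)
        - √(bSq κ β z) * d2 (d1 φ) (bSq κ β z) √(bSq κ β z))) = 0 := by linear_combination h1
    exact (mul_eq_zero.1 h3).resolve_left (mul_ne_zero h2 hz2.ne')

theorem d22_zero_ne (hflat : IsProjectivelyFlat U (generalMetric κ β φ)) (hx : x ∈ U) :
    d2 (d2 φ) (bSq κ β x) 0 ≠ 0 := by
  by_cases hb : β x = 0
  · have h0 := (bSq_eq_zero_iff (S.conf_pos x hx) β).2 hb
    have h1 := S.d1_ne x hx
    rw [h0] at h1 ⊢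
    rw [S.d22_zero_of_eq_zero hflat hx h0]
    exact mul_ne_zero two_ne_zero h1
  · exact S.d22_zero_ne_of_ne hflat hx hb

end Setting

/-! ### Conformal one-forms in dimension at least three -/

/-- The open cube with centre `x₀` and half-width `r`. Coordinate segments between its points stay in
it. -/
def cube (x₀ : Vec n) (r : ℝ) : Set (Vec n) := {z | ∀ i, |z i - x₀ i| < r}

theorem add_smul_e_apply (x : Vec n) (t : ℝ) (l i : Fin n) :
    (x + t • e l) i = x i + if i = l then t else 0 := by
  simp [e]

theorem isOpen_cube (x₀ : Vec n) (r : ℝ) : IsOpen (cube x₀ r) := by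
  have : cube x₀ r = ⋂ i, {z : Vec n | |z i - x₀ i| < r} := by ext; simp [cube]
  rw [this]
  exact isOpen_iInter_of_finite fun i => isOpen_lt (by fun_prop) continuous_const

theorem mem_cube_self (x₀ : Vec n) {r : ℝ} (hr : 0 < r) : x₀ ∈ cube x₀ r := fun i => by
  simpa using hr

theorem exists_cube_subset {U : Set (Vec n)} (hU : IsOpen U) {x₀ : Vec n} (hx₀ : x₀ ∈ U) :
    ∃ r > 0, cube x₀ r ⊆ U := by
  have h1 : IsOpen ((WithLp.toLp 2 : (Fin n → ℝ) → Vec n) ⁻¹' U) :=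
    hU.preimage (PiLp.continuous_toLp 2 _)
  obtain ⟨r, hr, h⟩ := Metric.isOpen_iff.1 h1 (WithLp.ofLp x₀) (by simpa using hx₀)
  refine ⟨r, hr, fun z hz => ?_⟩
  have : WithLp.ofLp z ∈ Metric.ball (WithLp.ofLp x₀) r := by
    rw [Metric.mem_ball, dist_pi_lt_iff hr]
    exact fun i => by rw [Real.dist_eq]; exact hz i
  simpa using h this

theorem segment_mem_cube {x₀ x : Vec n} {r t ρ : ℝ} {l : Fin n} (hx : x ∈ cube x₀ r)
    (hxt : x + t • e l ∈ cube x₀ r) (hρ : ρ ∈ Set.uIcc 0 t) : x + ρ • e l ∈ cube x₀ r := by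
  intro i
  have h1 := abs_lt.1 (hx i)
  have h2 := hxt i
  rw [add_smul_e_apply] at h2 ⊢
  split_ifs at h2 ⊢ with hi
  · rw [abs_lt] at h2 ⊢
    rcases le_total 0 t with ht | ht
    · rw [Set.uIcc_of_le ht] at hρ
      exact ⟨by linarith [hρ.1], by linarith [hρ.2]⟩
    · rw [Set.uIcc_of_ge ht] at hρ
      exact ⟨by linarith [hρ.1], by linarith [hρ.2]⟩
  · exact h2

theorem mem_cube_add_add {x₀ x : Vec n} {r s t : ℝ} {i j : Fin n} (hij : i ≠ j)
    (hs : x + s • e i ∈ cube x₀ r) (ht : x + t • e j ∈ cube x₀ r) :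
    x + s • e i + t • e j ∈ cube x₀ r := by
  intro m
  have h1 := hs m
  have h2 := ht m
  rw [add_smul_e_apply] at h1 h2
  rw [add_smul_e_apply, add_smul_e_apply]
  split_ifs at h1 h2 ⊢ with a b
  · exact absurd (a.symm.trans b) hij
  · simpa using h1
  · simpa using h2
  · simpa using h1

theorem exists_small_step {x₀ x : Vec n} {r : ℝ} (hx : x ∈ cube x₀ r) (l m : Fin n) :
    ∃ t : ℝ, t ≠ 0 ∧ x + t • e l ∈ cube x₀ r ∧ x + t • e m ∈ cube x₀ r := by
  have h1 := eventually_line ((isOpen_cube x₀ r).mem_nhds hx) (e l)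
  have h2 := eventually_line ((isOpen_cube x₀ r).mem_nhds hx) (e m)
  have h3 : ∀ᶠ t in 𝓝[≠] (0 : ℝ), t ≠ 0 := self_mem_nhdsWithin
  obtain ⟨t, ⟨h4, h5⟩, h6⟩ := (((h1.and h2).filter_mono nhdsWithin_le_nhds).and h3).exists
  exact ⟨t, h6, h4, h5⟩

/-- A function that is constant along all coordinate segments of a cube is constant on it: change
the coordinates one at a time. -/
theorem eq_on_cube {f : Vec n → ℝ} {x₀ : Vec n} {r : ℝ} (hr : 0 < r)
    (h : ∀ x ∈ cube x₀ r, ∀ (l : Fin n) (t : ℝ), x + t • (e l : Vec n) ∈ cube x₀ r →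
      f (x + t • (e l : Vec n)) = f x)
    {z : Vec n} (hz : z ∈ cube x₀ r) : f z = f x₀ := by
  set p : Finset (Fin n) → Vec n := fun S => WithLp.toLp 2 fun i => if i ∈ S then z i else x₀ i
    with hp
  have hpQ : ∀ S, p S ∈ cube x₀ r := by
    intro S i
    by_cases hi : i ∈ S
    · simpa [hp, hi] using hz i
    · simpa [hp, hi] using hr
  have hstep : ∀ S l, l ∉ S → p (insert l S) = p S + (z l - x₀ l) • e l := by
    intro S l hl
    ext i
    rw [add_smul_e_apply]
    by_cases hi : i = l
    · subst hi; simp [hp, hl]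
    · simp [hp, hi]
  have key : ∀ S, f (p S) = f x₀ := by
    intro S
    induction S using Finset.induction_on with
    | empty => simp [hp]
    | insert l S hl ih =>
      rw [hstep S l hl, h _ (hpQ S) l _ (by rw [← hstep S l hl]; exact hpQ _), ih]
  have := key Finset.univ
  simpa [hp] using this

/-- A function whose partial derivative is constant along a coordinate segment is affine there. -/
theorem apply_add_smul_e {f : Vec n → ℝ} {x : Vec n} {t c : ℝ} {l : Fin n}
    (h : ∀ ρ ∈ Set.uIcc 0 t, ∃ L : Vec n →L[ℝ] ℝ, HasFDerivAt f L (x + ρ • e l) ∧ L (e l) = c) :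
    f (x + t • e l) = f x + c * t := by
  have hd : ∀ ρ ∈ Set.uIcc 0 t, HasDerivWithinAt (fun ρ : ℝ => f (x + ρ • e l) - c * ρ) 0
      (Set.uIcc 0 t) ρ := by
    intro ρ hρ
    obtain ⟨L, hL, hc⟩ := h ρ hρ
    have hline : HasDerivAt (fun t : ℝ => x + t • (e l : Vec n)) (e l) ρ := by
      simpa using ((hasDerivAt_id ρ).smul_const (e l : Vec n)).const_add x
    have := (hL.comp_hasDerivAt ρ hline).sub ((hasDerivAt_id ρ).const_mul c)
    exact (this.congr_deriv (by rw [hc]; ring)).hasDerivWithinAt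
  have := (convex_uIcc (0 : ℝ) t).norm_image_sub_le_of_norm_hasDerivWithin_le (C := 0) hd
    (fun _ _ => by simp) Set.left_mem_uIcc Set.right_mem_uIcc
  simp only [zero_smul, add_zero, mul_zero, sub_zero, zero_mul, norm_le_zero_iff] at this
  linarith

theorem derivative_eq_of_eventually {f : Vec n → ℝ} {x y : Vec n} {l : Fin n}
    {L M : Vec n →L[ℝ] ℝ} (hx : HasFDerivAt f L x) (hy : HasFDerivAt f M y)
    (h : ∀ᶠ ρ in 𝓝 (0 : ℝ), f (x + ρ • e l) = f (y + ρ • e l)) : L (e l) = M (e l) := by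
  have h1 := hasDerivAt_line hx.differentiableAt (e l)
  have h2 := hasDerivAt_line hy.differentiableAt (e l)
  rw [hx.fderiv] at h1
  rw [hy.fderiv] at h2
  exact h1.unique (h2.congr_of_eventuallyEq h)

theorem proj_e (i j : Fin n) :
    (EuclideanSpace.proj i : Vec n →L[ℝ] ℝ) (e j) = if i = j then 1 else 0 := by
  simp [e]

theorem exists_third (hn : 3 ≤ n) (i l : Fin n) : ∃ j : Fin n, j ≠ i ∧ j ≠ l := by
  have : ({i, l} : Finset (Fin n)).card < (Finset.univ : Finset (Fin n)).card := by
    rw [Finset.card_univ, Fintype.card_fin]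
    exact lt_of_le_of_lt Finset.card_le_two (by omega)
  obtain ⟨j, -, hj⟩ := Finset.exists_mem_notMem_of_card_lt_card this
  simp only [Finset.mem_insert, Finset.mem_singleton, not_or] at hj
  exact ⟨j, hj⟩

/-- If `dPᵢ = E dxᵢ` for every `i`, then `E` is locally constant. Only first derivatives of `P` are
assumed to exist: `Pᵢ` does not depend on `xₗ` for `l ≠ i`, so neither does `E`, its partial
derivative in `xᵢ`. -/
theorem locally_const_of_conformal (hn : 3 ≤ n) {U : Set (Vec n)} (hU : IsOpen U)
    {P : Fin n → Vec n → ℝ} {E : Vec n → ℝ}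
    (hP : ∀ x ∈ U, ∀ i, HasFDerivAt (P i) (E x • (EuclideanSpace.proj i : Vec n →L[ℝ] ℝ)) x)
    {x₀ : Vec n} (hx₀ : x₀ ∈ U) : ∀ᶠ z in 𝓝 x₀, E z = E x₀ := by
  obtain ⟨r, hr, hQ⟩ := exists_cube_subset hU hx₀
  filter_upwards [(isOpen_cube x₀ r).mem_nhds (mem_cube_self x₀ hr)] with z hz
  refine eq_on_cube hr (fun x hx l t hxt => ?_) hz
  obtain ⟨i, hi, -⟩ := exists_third hn l l
  have h0 : ∀ y ∈ cube x₀ r, y + t • e l ∈ cube x₀ r → P i (y + t • e l) = P i y := by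
    intro y hy hyt
    have := apply_add_smul_e (f := P i) (x := y) (t := t) (c := 0) (l := l) fun ρ hρ =>
      ⟨_, hP _ (hQ (segment_mem_cube hy hyt hρ)) i, by
        rw [smul_apply, proj_e, if_neg hi]; simp⟩
    simpa using this
  have h1 := derivative_eq_of_eventually (l := i) (hP _ (hQ hxt) i) (hP _ (hQ hx) i) (by
    filter_upwards [eventually_line ((isOpen_cube x₀ r).mem_nhds hx) (e i),
      eventually_line ((isOpen_cube x₀ r).mem_nhds hxt) (e i)] with ρ h1 h2
    rw [add_right_comm] at h2 ⊢
    exact h0 _ h1 h2)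
  simpa only [smul_apply, smul_eq_mul, proj_e, if_pos, mul_one] using h1

/-- If `dRᵢⱼ = aᵢ dxⱼ - aⱼ dxᵢ` for all `i, j`, in dimension at least three, then every `aᵢ` is
locally constant. Only first derivatives of `R` are assumed to exist. -/
theorem locally_const_of_rotational (hn : 3 ≤ n) {U : Set (Vec n)} (hU : IsOpen U)
    {R : Fin n → Fin n → Vec n → ℝ} {a : Fin n → Vec n → ℝ}
    (hR : ∀ x ∈ U, ∀ i j, HasFDerivAt (R i j)
      (a i x • (EuclideanSpace.proj j : Vec n →L[ℝ] ℝ)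
        - a j x • (EuclideanSpace.proj i : Vec n →L[ℝ] ℝ)) x)
    {x₀ : Vec n} (hx₀ : x₀ ∈ U) (i : Fin n) : ∀ᶠ z in 𝓝 x₀, a i z = a i x₀ := by
  obtain ⟨r, hr, hQ⟩ := exists_cube_subset hU hx₀
  filter_upwards [(isOpen_cube x₀ r).mem_nhds (mem_cube_self x₀ hr)] with z hz
  -- `a i` does not depend on the other coordinates
  have hA : ∀ i l, l ≠ i → ∀ x ∈ cube x₀ r, ∀ t : ℝ, x + t • e l ∈ cube x₀ r →
      a i (x + t • e l) = a i x := by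
    intro i l hli x hx t hxt
    obtain ⟨j, hji, hjl⟩ := exists_third hn i l
    have h0 : ∀ y ∈ cube x₀ r, y + t • e l ∈ cube x₀ r → R i j (y + t • e l) = R i j y := by
      intro y hy hyt
      have := apply_add_smul_e (f := R i j) (x := y) (t := t) (c := 0) (l := l) fun ρ hρ =>
        ⟨_, hR _ (hQ (segment_mem_cube hy hyt hρ)) i j, by
          simp only [sub_apply, smul_apply, smul_eq_mul,
            proj_e, if_neg hjl, if_neg hli.symm, mul_zero, sub_zero]⟩
      simpa using this
    have h1 := derivative_eq_of_eventually (l := j) (hR _ (hQ hxt) i j) (hR _ (hQ hx) i j) (by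
      filter_upwards [eventually_line ((isOpen_cube x₀ r).mem_nhds hx) (e j),
        eventually_line ((isOpen_cube x₀ r).mem_nhds hxt) (e j)] with ρ h1 h2
      rw [add_right_comm] at h2 ⊢
      exact h0 _ h1 h2)
    simpa only [sub_apply, smul_apply, smul_eq_mul,
      proj_e, if_pos, if_neg hji.symm, mul_zero, mul_one, sub_zero] using h1
  have hB : ∀ i j, i ≠ j → ∀ x ∈ cube x₀ r, ∀ t : ℝ, x + t • e j ∈ cube x₀ r →
      R i j (x + t • e j) = R i j x + a i x * t := by
    intro i j hij x hx t hxt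
    exact apply_add_smul_e fun ρ hρ => ⟨_, hR _ (hQ (segment_mem_cube hx hxt hρ)) i j, by
      simp only [sub_apply, smul_apply, smul_eq_mul,
        proj_e, if_pos, if_neg hij, mul_zero, mul_one, sub_zero,
        hA i j hij.symm x hx ρ (segment_mem_cube hx hxt hρ)]⟩
  have hB' : ∀ i j, i ≠ j → ∀ x ∈ cube x₀ r, ∀ s : ℝ, x + s • e i ∈ cube x₀ r →
      R i j (x + s • e i) = R i j x + -a j x * s := by
    intro i j hij x hx s hxs
    exact apply_add_smul_e fun ρ hρ => ⟨_, hR _ (hQ (segment_mem_cube hx hxs hρ)) i j, by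
      simp only [sub_apply, smul_apply, smul_eq_mul,
        proj_e, if_pos, if_neg hij.symm, mul_zero, mul_one, zero_sub,
        hA j i hij x hx ρ (segment_mem_cube hx hxs hρ)]⟩
  -- the second difference of `R i j` over a coordinate rectangle, computed in both orders
  have hC : ∀ i j, i ≠ j → ∀ x ∈ cube x₀ r, ∀ s t : ℝ, x + s • e i ∈ cube x₀ r →
      x + t • e j ∈ cube x₀ r →
      (a i (x + s • e i) - a i x) * t = -((a j (x + t • e j) - a j x) * s) := by
    intro i j hij x hx s t hxs hxt
    have hm := mem_cube_add_add hij hxs hxt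
    have h1 := hB i j hij _ hxs t hm
    have h2 := hB' i j hij _ hx s hxs
    have h3 := hB i j hij _ hx t hxt
    rw [add_right_comm] at hm h1
    have h4 := hB' i j hij _ hxt s hm
    linarith
  refine eq_on_cube hr (fun x hx l s hxs => ?_) hz
  by_cases hli : l = i
  · subst hli
    obtain ⟨j, hjl, -⟩ := exists_third hn l l
    obtain ⟨m, hml, hmj⟩ := exists_third hn l j
    -- three indices: the increments of `aₗ`, `aⱼ`, `aₘ` are pairwise opposite, hence zero
    obtain ⟨t, ht0, htj, htm⟩ := exists_small_step hx j m
    have h1 := hC l j hjl.symm x hx s t hxs htj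
    have h2 := hC j m hmj.symm x hx t t htj htm
    have h3 := hC m l hml x hx t s htm hxs
    have h4 : (a j (x + t • e j) - a j x) = -(a m (x + t • e m) - a m x) :=
      mul_right_cancel₀ ht0 (by linarith)
    have h5 : (a l (x + s • e l) - a l x) * t = 0 := by
      rw [h4] at h1
      linarith
    exact sub_eq_zero.1 ((mul_eq_zero.1 h5).resolve_right ht0)
  · exact hA i l hli x hx s hxs

theorem const_of_locally_const {U : Set (Vec n)} (hU : IsOpen U) (hUc : IsPreconnected U)
    {f : Vec n → ℝ} (h : ∀ x ∈ U, ∀ᶠ z in 𝓝 x, f z = f x) {x₀ x : Vec n} (hx₀ : x₀ ∈ U)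
    (hx : x ∈ U) : f x = f x₀ :=
  eq_of_eventually_eq hU hUc
    (fun z hz => (continuousAt_const.congr (f := fun _ => f z)
      ((h z hz).mono fun _ hw => hw.symm)).continuousWithinAt)
    (fun z hz hzc => (h z hz).mono fun _ hw => hw.trans hzc) hx₀ rfl hx

/-- A one-form with `b_{i|j} = k a_{ij}` is one of the forms `conformalForm κ ε a`. With
`W = 1 + κ|x|²`, `wᵢ = √W bᵢ` and `m = k / √W`, the functions `wᵢ xⱼ - wⱼ xᵢ` have the derivative
`(wᵢ - m xᵢ) dxⱼ - (wⱼ - m xⱼ) dxᵢ`, so that `a = w - m x` is constant; and then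
`ε = m W + κ ⟨a, x⟩` is constant in the same way. -/
theorem exists_eq_conformalForm (hn : 3 ≤ n) {κ : ℝ} {U : Set (Vec n)} (hU : IsOpen U)
    (hUc : IsConnected U) (hκ : ∀ x ∈ U, 0 < 1 + κ * ‖x‖ ^ 2) {γ : Vec n → (Vec n →L[ℝ] ℝ)}
    (hγ : ∀ x ∈ U, DifferentiableAt ℝ γ x)
    (h : ∀ x ∈ U, ∃ k, ∀ u v, cov κ γ x u v = k * metricForm κ x u v) :
    ∃ (ε : ℝ) (a : Vec n), ∀ x ∈ U, ∀ y, γ x y = conformalForm κ ε a x y := by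
  choose! k hk using h
  obtain ⟨x₀, hx₀⟩ := hUc.nonempty
  set w : Vec n → Vec n → ℝ := fun u x => Real.sqrt (1 + κ * ‖x‖ ^ 2) * γ x u with hw
  set m : Vec n → ℝ := fun x => k x / Real.sqrt (1 + κ * ‖x‖ ^ 2) with hm
  have hWd : ∀ x : Vec n, HasFDerivAt (fun z : Vec n => 1 + κ * ‖z‖ ^ 2)
      (κ • (2 • (innerSL ℝ x))) x := fun x => by
    have := (((hasStrictFDerivAt_norm_sq x).hasFDerivAt).const_mul κ).const_add 1
    simpa using this
  have hwd : ∀ x ∈ U, ∀ u, HasFDerivAt (w u) (m x • innerSL ℝ u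
      + (inner ℝ x u * (-κ / (1 + κ * ‖x‖ ^ 2))) •
        (m x • innerSL ℝ x + Real.sqrt (1 + κ * ‖x‖ ^ 2) • γ x)) x := by
    intro x hx u
    have hW := hκ x hx
    have h1 := (hWd x).sqrt hW.ne'
    have h2 := (hγ x hx).hasFDerivAt.clm_apply (hasFDerivAt_const u x)
    refine (h1.mul h2).congr_fderiv ?_
    ext v
    have hc := hk x hx u v
    have hs := Real.sq_sqrt hW.le
    have hs0 := (Real.sqrt_pos.2 hW).ne'
    rw [cov, metricForm] at hc
    have hc' : fderiv ℝ γ x v u = k x * (inner ℝ u v / (1 + κ * ‖x‖ ^ 2)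
        - κ * inner ℝ x u * inner ℝ x v / (1 + κ * ‖x‖ ^ 2) ^ 2)
        - κ / (1 + κ * ‖x‖ ^ 2) * (inner ℝ x v * γ x u + inner ℝ x u * γ x v) := by linarith
    simp only [add_apply, smul_apply, smul_eq_mul,
      innerSL_apply_apply, ContinuousLinearMap.comp_apply, zero_apply,
      ContinuousLinearMap.flip_apply, hc', hm, map_zero]
    rw [nsmul_eq_mul]
    generalize Real.sqrt (1 + κ * ‖x‖ ^ 2) = q at hs0 hs ⊢
    rw [← hs]
    simp only [Nat.cast_ofNat, one_div]
    field_simp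
    ring
  have hproj : ∀ i : Fin n, innerSL ℝ (e i : Vec n) = (EuclideanSpace.proj i : Vec n →L[ℝ] ℝ) := by
    intro i; ext v; simp [real_inner_comm, inner_e]
  have hcoord : ∀ (x : Vec n) (i : Fin n), HasFDerivAt (fun z : Vec n => z i)
      (EuclideanSpace.proj i : Vec n →L[ℝ] ℝ) x := fun x i =>
    (EuclideanSpace.proj i : Vec n →L[ℝ] ℝ).hasFDerivAt
  -- the constant vector
  have hR : ∀ x ∈ U, ∀ i j, HasFDerivAt (fun z : Vec n => w (e i) z * z j - w (e j) z * z i)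
      ((w (e i) x - m x * x i) • (EuclideanSpace.proj j : Vec n →L[ℝ] ℝ)
        - (w (e j) x - m x * x j) • (EuclideanSpace.proj i : Vec n →L[ℝ] ℝ)) x := by
    intro x hx i j
    refine (((hwd x hx (e i)).mul (hcoord x j)).sub
      ((hwd x hx (e j)).mul (hcoord x i))).congr_fderiv ?_
    rw [hproj, hproj, inner_e, inner_e]
    ext v
    simp only [add_apply, smul_apply, smul_eq_mul,
      sub_apply]
    ring
  set a : Vec n := WithLp.toLp 2 fun i => w (e i) x₀ - m x₀ * x₀ i with ha
  have haU : ∀ x ∈ U, ∀ u, w u x = inner ℝ a u + m x * inner ℝ x u := by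
    intro x hx u
    have h1 : ∀ i, w (e i) x - m x * x i = a i := fun i =>
      const_of_locally_const (f := fun x => w (e i) x - m x * x i) hU hUc.isPreconnected
        (fun z hz => locally_const_of_rotational hn hU
          (a := fun i x => w (e i) x - m x * x i) hR hz i) hx₀ hx
    have h2 : w u x = ∑ i, w (e i) x * u i := by
      simp only [hw]
      rw [← sum_mul_apply_e (γ x) u, Finset.mul_sum]
      exact Finset.sum_congr rfl fun i _ => by ring
    have h3 : ∀ y : Vec n, inner ℝ y u = ∑ i, y i * u i := by
      intro y
      rw [← innerSL_apply_apply ℝ, ← sum_mul_apply_e (innerSL ℝ y) u]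
      simp only [innerSL_apply_apply, inner_e]
    rw [h2, h3, h3, Finset.mul_sum, ← Finset.sum_add_distrib]
    exact Finset.sum_congr rfl fun i _ => by rw [← h1 i]; ring
  -- the constant number
  have hP : ∀ x ∈ U, ∀ i, HasFDerivAt (fun z : Vec n =>
      (w (e i) z - a i) * (1 + κ * ‖z‖ ^ 2) + κ * inner ℝ a z * z i)
      ((m x * (1 + κ * ‖x‖ ^ 2) + κ * inner ℝ a x) •
        (EuclideanSpace.proj i : Vec n →L[ℝ] ℝ)) x := by
    intro x hx i
    have hW := (hκ x hx).ne'
    have h1 : HasFDerivAt (fun z : Vec n => inner ℝ a z) (innerSL ℝ a) x :=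
      (innerSL ℝ a).hasFDerivAt
    refine ((((hwd x hx (e i)).sub_const (a i)).mul (hWd x)).add
      ((h1.const_mul κ).mul (hcoord x i))).congr_fderiv ?_
    rw [hproj, inner_e]
    ext v
    have h2 := haU x hx v
    have h3 := haU x hx (e i)
    rw [inner_e, inner_e] at h3
    simp only [hw] at h2
    simp only [add_apply, smul_apply, smul_eq_mul,
      innerSL_apply_apply, h2, h3, nsmul_eq_mul]
    field_simp
    push_cast
    ring
  set ε : ℝ := m x₀ * (1 + κ * ‖x₀‖ ^ 2) + κ * inner ℝ a x₀ with hε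
  refine ⟨ε, a, fun x hx y => ?_⟩
  have hεx : m x * (1 + κ * ‖x‖ ^ 2) + κ * inner ℝ a x = ε :=
    const_of_locally_const (f := fun x => m x * (1 + κ * ‖x‖ ^ 2) + κ * inner ℝ a x) hU
      hUc.isPreconnected (fun z hz => locally_const_of_conformal hn hU hP hz) hx₀ hx
  have hW := hκ x hx
  have h1 := haU x hx y
  have hs := Real.sq_sqrt hW.le
  have hs0 := Real.sqrt_pos.2 hW
  have hrp : (1 + κ * ‖x‖ ^ 2) ^ (3 / 2 : ℝ)
      = (1 + κ * ‖x‖ ^ 2) * Real.sqrt (1 + κ * ‖x‖ ^ 2) := by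
    rw [Real.sqrt_eq_rpow, ← Real.rpow_one_add' hW.le (by norm_num)]; norm_num
  rw [conformalForm, hrp, ← hεx]
  simp only [hw] at h1
  field_simp
  linear_combination (1 + κ * ‖x‖ ^ 2) * h1

/-! ### Level curves of the partial differential equation -/

/-- A profile `φ` which over the interval `J` of values of `b²` satisfies
`φ₂₂ (c (B - s²) + s²) = 2 B (φ₁ - s φ₁₂)` for `s² ≤ B`, together with an antiderivative `Λ` of
`(c - 1) / B` on an open interval `I ⊇ J`. -/
structure LevelSystem (I J : Set ℝ) (c Λ : ℝ → ℝ) (φ : ℝ → ℝ → ℝ) (Ω : Set (ℝ × ℝ)) : Prop where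
  isOpen : IsOpen I
  ordConnected : I.OrdConnected
  subset : J ⊆ I
  ordConnected_values : J.OrdConnected
  nonneg : ∀ B ∈ J, 0 ≤ B
  smooth_coeff : ContDiffOn ℝ ∞ c I
  coeff_ne : ∀ B ∈ I, c B ≠ 0
  differentiableAt : ∀ B ∈ I, DifferentiableAt ℝ Λ B
  deriv_eq : ∀ B ∈ I, B * deriv Λ B = c B - 1
  isOpen_dom : IsOpen Ω
  mem_dom : ∀ B ∈ J, ∀ s : ℝ, s ^ 2 ≤ B → (B, s) ∈ Ω
  mem_dom_zero : ∀ B ∈ I, (B, (0 : ℝ)) ∈ Ω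
  smooth : ContDiffOn ℝ ∞ (fun p : ℝ × ℝ => φ p.1 p.2) Ω
  pde : ∀ B ∈ J, ∀ s : ℝ, s ^ 2 ≤ B → d2 (d2 φ) B s * (c B * (B - s ^ 2) + s ^ 2)
    = 2 * B * (d1 φ B s - s * d2 (d1 φ) B s)

/-- The function `φ - s φ₂`, which is constant on the level curves. -/
def legendre (φ : ℝ → ℝ → ℝ) (B s : ℝ) : ℝ := φ B s - s * d2 φ B s

/-- The value of `μ = B exp Λ`, an antiderivative of `c exp Λ`. -/
def levelMap (Λ : ℝ → ℝ) (B : ℝ) : ℝ := B * Real.exp (Λ B)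

/-- The height `s ≥ 0` of the level curve `exp Λ (B - s²) = σ` above `B`. -/
def levelHeight (Λ : ℝ → ℝ) (σ B : ℝ) : ℝ := Real.sqrt (B - σ * Real.exp (-Λ B))

theorem sub_mul_exp_nonneg {Λ : ℝ → ℝ} {σ B : ℝ} :
    0 ≤ B - σ * Real.exp (-Λ B) ↔ σ ≤ levelMap Λ B := by
  rw [levelMap, Real.exp_neg, sub_nonneg, ← div_eq_mul_inv, div_le_iff₀ (Real.exp_pos _)]

theorem sub_mul_exp_pos {Λ : ℝ → ℝ} {σ B : ℝ} :
    0 < B - σ * Real.exp (-Λ B) ↔ σ < levelMap Λ B := by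
  rw [levelMap, Real.exp_neg, sub_pos, ← div_eq_mul_inv, div_lt_iff₀ (Real.exp_pos _)]

theorem levelHeight_sq {Λ : ℝ → ℝ} {σ B : ℝ} (h : σ ≤ levelMap Λ B) :
    levelHeight Λ σ B ^ 2 = B - σ * Real.exp (-Λ B) :=
  Real.sq_sqrt (sub_mul_exp_nonneg.2 h)

theorem levelHeight_sq_le {Λ : ℝ → ℝ} {σ B : ℝ} (h : σ ≤ levelMap Λ B) (hσ : 0 ≤ σ) :
    levelHeight Λ σ B ^ 2 ≤ B := by
  rw [levelHeight_sq h]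
  have := mul_nonneg hσ (Real.exp_pos (-Λ B)).le
  linarith

theorem levelHeight_eq {Λ : ℝ → ℝ} {B s : ℝ} (hs : 0 ≤ s) :
    levelHeight Λ (Real.exp (Λ B) * (B - s ^ 2)) B = s := by
  have : B - Real.exp (Λ B) * (B - s ^ 2) * Real.exp (-Λ B) = s ^ 2 := by
    rw [Real.exp_neg]
    have := (Real.exp_pos (Λ B)).ne'
    field_simp
    ring
  rw [levelHeight, this, Real.sqrt_sq hs]

theorem levelHeight_levelMap {Λ : ℝ → ℝ} {B : ℝ} : levelHeight Λ (levelMap Λ B) B = 0 := by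
  have := levelHeight_eq (Λ := Λ) (B := B) le_rfl
  rwa [zero_pow two_ne_zero, sub_zero, mul_comm] at this

theorem level_le_levelMap {Λ : ℝ → ℝ} {B s : ℝ} :
    Real.exp (Λ B) * (B - s ^ 2) ≤ levelMap Λ B := by
  rw [levelMap]
  nlinarith [mul_nonneg (sq_nonneg s) (Real.exp_pos (Λ B)).le]

theorem level_nonneg {Λ : ℝ → ℝ} {B s : ℝ} (hs : s ^ 2 ≤ B) :
    0 ≤ Real.exp (Λ B) * (B - s ^ 2) :=
  mul_nonneg (Real.exp_pos _).le (sub_nonneg.2 hs)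

theorem hasDerivAt_levelMap {c Λ : ℝ → ℝ} {B : ℝ} (hd : DifferentiableAt ℝ Λ B)
    (h : B * deriv Λ B = c B - 1) : HasDerivAt (levelMap Λ) (c B * Real.exp (Λ B)) B := by
  refine ((hasDerivAt_id B).mul hd.hasDerivAt.exp).congr_deriv ?_
  simp only [id_eq]
  linear_combination Real.exp (Λ B) * h

namespace LevelSystem
variable {I J : Set ℝ} {c Λ : ℝ → ℝ} {φ : ℝ → ℝ → ℝ} {Ω : Set (ℝ × ℝ)}
  (S : LevelSystem I J c Λ φ Ω)
include S

theorem hasDerivAt_levelMap {B : ℝ} (hB : B ∈ I) :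
    HasDerivAt (levelMap Λ) (c B * Real.exp (Λ B)) B :=
  GeneralAlphaBeta.hasDerivAt_levelMap (S.differentiableAt B hB) (S.deriv_eq B hB)

theorem continuousOn_levelMap : ContinuousOn (levelMap Λ) I := fun _ hB =>
  (S.hasDerivAt_levelMap hB).continuousAt.continuousWithinAt

theorem injOn_levelMap : Set.InjOn (levelMap Λ) I := by
  intro a ha b hb hab
  by_contra hne
  wlog hlt : a < b generalizing a b
  · exact this hb ha hab.symm (Ne.symm hne) (lt_of_le_of_ne (not_lt.1 hlt) (Ne.symm hne))
  have hsub : Set.Icc a b ⊆ I := S.ordConnected.out ha hb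
  obtain ⟨z, hz, h0⟩ := exists_hasDerivAt_eq_zero hlt (S.continuousOn_levelMap.mono hsub) hab
    fun z hz => S.hasDerivAt_levelMap (hsub (Set.Ioo_subset_Icc_self hz))
  exact mul_ne_zero (S.coeff_ne z (hsub (Set.Ioo_subset_Icc_self hz))) (Real.exp_pos _).ne' h0

theorem lt_levelMap {a b B σ : ℝ} (ha : a ∈ I) (hb : b ∈ I) (hB : B ∈ Set.Ioo a b)
    (hσa : σ ≤ levelMap Λ a) (hσb : σ ≤ levelMap Λ b) : σ < levelMap Λ B := by
  have hsub : Set.Icc a b ⊆ I := S.ordConnected.out ha hb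
  have hab : a ≤ b := (hB.1.trans hB.2).le
  have hBI := Set.Ioo_subset_Icc_self hB
  rcases (S.continuousOn_levelMap.mono hsub).strictMonoOn_of_injOn_Icc' hab
    (S.injOn_levelMap.mono hsub) with h | h
  · exact hσa.trans_lt (h (Set.left_mem_Icc.2 hab) hBI hB.1)
  · exact hσb.trans_lt (h hBI (Set.right_mem_Icc.2 hab) hB.2)

theorem continuousAt_levelHeight {B : ℝ} (hB : B ∈ I) (σ : ℝ) :
    ContinuousAt (levelHeight Λ σ) B := by
  have := (S.differentiableAt B hB).continuousAt
  exact (continuousAt_id.sub (continuousAt_const.mul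
    (Real.continuous_exp.continuousAt.comp this.neg))).sqrt

theorem contDiffOn_legendre : ContDiffOn ℝ ∞ (fun p : ℝ × ℝ => legendre φ p.1 p.2) Ω :=
  S.smooth.sub (contDiffOn_snd.mul (contDiffOn_d2 S.isOpen_dom S.smooth))

theorem contDiffAt_legendre {p : ℝ × ℝ} (hp : p ∈ Ω) :
    ContDiffAt ℝ ∞ (fun p : ℝ × ℝ => legendre φ p.1 p.2) p :=
  S.contDiffOn_legendre.contDiffAt (S.isOpen_dom.mem_nhds hp)

/-- `φ - s φ₂` is constant along the level curves. -/
theorem legendre_eq {a b σ : ℝ} (ha : a ∈ J) (hb : b ∈ J) (hσ : 0 ≤ σ)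
    (hσa : σ ≤ levelMap Λ a) (hσb : σ ≤ levelMap Λ b) :
    legendre φ a (levelHeight Λ σ a) = legendre φ b (levelHeight Λ σ b) := by
  wlog hlt : a < b generalizing a b
  · rcases (not_lt.1 hlt).eq_or_lt with rfl | h
    · rfl
    · exact (this hb ha hσb hσa h).symm
  have hJ : Set.Icc a b ⊆ J := S.ordConnected_values.out ha hb
  have hle : ∀ B ∈ Set.Icc a b, σ ≤ levelMap Λ B := by
    intro B hB
    rcases hB.1.eq_or_lt with rfl | h1
    · exact hσa
    rcases hB.2.eq_or_lt with rfl | h2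
    · exact hσb
    exact (S.lt_levelMap (S.subset ha) (S.subset hb) ⟨h1, h2⟩ hσa hσb).le
  have hmem : ∀ B ∈ Set.Icc a b, (B, levelHeight Λ σ B) ∈ Ω := fun B hB =>
    S.mem_dom B (hJ hB) _ (levelHeight_sq_le (hle B hB) hσ)
  have hcont : ContinuousOn (fun B => legendre φ B (levelHeight Λ σ B)) (Set.Icc a b) := by
    intro B hB
    have h1 := S.continuousAt_levelHeight (S.subset (hJ hB)) σ
    exact (ContinuousAt.comp (f := fun B => (B, levelHeight Λ σ B))
      (g := fun p : ℝ × ℝ => legendre φ p.1 p.2)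
      (S.contDiffAt_legendre (hmem B hB)).continuousAt
      (continuousAt_id.prodMk h1)).continuousWithinAt
  have hder : ∀ B ∈ Set.Ioo a b,
      HasDerivAt (fun B => legendre φ B (levelHeight Λ σ B)) 0 B := by
    intro B hB
    have hBc := Set.Ioo_subset_Icc_self hB
    have hBI := S.subset (hJ hBc)
    have hlt := S.lt_levelMap (S.subset ha) (S.subset hb) hB hσa hσb
    have hpos : 0 < B - σ * Real.exp (-Λ B) := sub_mul_exp_pos.2 hlt
    have hB0 : 0 < B := (S.nonneg a ha).trans_lt hB.1
    have hs2 := levelHeight_sq hlt.le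
    have hs0 : levelHeight Λ σ B ≠ 0 := (Real.sqrt_pos.2 hpos).ne'
    have h1 : HasDerivAt (levelHeight Λ σ)
        ((1 + σ * Real.exp (-Λ B) * deriv Λ B) / (2 * levelHeight Λ σ B)) B := by
      have := ((hasDerivAt_id B).sub
        (((S.differentiableAt B hBI).hasDerivAt.neg.exp).const_mul σ)).sqrt hpos.ne'
      refine this.congr_deriv ?_
      rw [levelHeight]
      congr 1
      rw [Pi.neg_apply]
      ring
    have h2 := hasDerivAt_comp_uncurry S.isOpen_dom S.smooth (hmem B hBc) (hasDerivAt_id B) h1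
    have h3 := hasDerivAt_comp_uncurry S.isOpen_dom (contDiffOn_d2 S.isOpen_dom S.smooth)
      (hmem B hBc) (hasDerivAt_id B) h1
    refine (h2.sub (h1.mul h3)).congr_deriv ?_
    have hp := S.pde B (hJ hBc) _ (levelHeight_sq_le hlt.le hσ)
    rw [← d1_d2_comm S.isOpen_dom S.smooth (hmem B hBc)] at hp
    have hσe : σ * Real.exp (-Λ B) = B - levelHeight Λ σ B ^ 2 := by rw [hs2]; ring
    have hd := S.deriv_eq B hBI
    have hslope : 2 * B * levelHeight Λ σ B *
        ((1 + σ * Real.exp (-Λ B) * deriv Λ B) / (2 * levelHeight Λ σ B))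
          = c B * (B - levelHeight Λ σ B ^ 2) + levelHeight Λ σ B ^ 2 := by
      rw [hσe]
      generalize levelHeight Λ σ B = s at hs0
      field_simp
      linear_combination (B - s ^ 2) * hd
    simp only [id_eq]
    refine (mul_right_inj' (mul_pos two_pos hB0).ne').1 ?_
    linear_combination (-1 : ℝ) * hp - d2 (d2 φ) B (levelHeight Λ σ B) * hslope
  obtain ⟨z, hz, h0⟩ := exists_hasDerivAt_eq_slope _ _ hlt hcont hder
  have := (div_eq_zero_iff.1 h0.symm).resolve_right (sub_pos.2 hlt).ne'
  linarith

theorem contDiffAt_potential {B : ℝ} (hB : B ∈ I) (h0 : B ≠ 0) : ContDiffAt ℝ ∞ Λ B := by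
  have hO : IsOpen (I ∩ {0}ᶜ) := S.isOpen.inter isOpen_compl_singleton
  have : ContDiffOn ℝ ∞ Λ (I ∩ {0}ᶜ) := by
    rw [contDiffOn_infty_iff_deriv_of_isOpen hO]
    refine ⟨fun z hz => (S.differentiableAt z hz.1).differentiableWithinAt, ?_⟩
    have h1 : ContDiffOn ℝ ∞ (fun z => (c z - 1) / z) (I ∩ {0}ᶜ) :=
      ((S.smooth_coeff.mono Set.inter_subset_left).sub contDiffOn_const).div contDiffOn_id
        fun z hz => hz.2
    refine h1.congr fun z hz => ?_
    have hz0 : z ≠ 0 := hz.2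
    rw [eq_div_iff hz0, mul_comm, S.deriv_eq z hz.1]
  exact this.contDiffAt (hO.mem_nhds ⟨hB, h0⟩)

theorem contDiffAt_invFunOn {B : ℝ} (hB : B ∈ I) (h0 : B ≠ 0) :
    ContDiffAt ℝ ∞ (Function.invFunOn (levelMap Λ) I) (levelMap Λ B) := by
  have hc : ContDiffAt ℝ ∞ (levelMap Λ) B := contDiffAt_id.mul (S.contDiffAt_potential hB h0).exp
  have hne : c B * Real.exp (Λ B) ≠ 0 := mul_ne_zero (S.coeff_ne B hB) (Real.exp_pos _).ne'
  have hd : HasFDerivAt (levelMap Λ)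
      ((ContinuousLinearEquiv.unitsEquivAut ℝ (Units.mk0 _ hne) : ℝ ≃L[ℝ] ℝ) : ℝ →L[ℝ] ℝ) B := by
    refine (S.hasDerivAt_levelMap hB).hasFDerivAt.congr_fderiv ?_
    ext; simp
  have h1 := hc.to_localInverse hd (by simp)
  refine h1.congr_of_eventuallyEq ?_
  have hstr := hc.hasStrictFDerivAt' hd (by simp)
  have h2 : ∀ᶠ y in 𝓝 (levelMap Λ B), levelMap Λ (hc.localInverse hd (by simp) y) = y :=
    hstr.eventually_right_inverse
  have h3 : ∀ᶠ y in 𝓝 (levelMap Λ B), hc.localInverse hd (by simp) y ∈ I :=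
    hstr.localInverse_tendsto (S.isOpen.mem_nhds hB)
  filter_upwards [h2, h3] with y hy hyI
  conv_lhs => rw [← hy]
  exact S.injOn_levelMap.leftInvOn_invFunOn hyI

end LevelSystem

/-! ### The function `f` of a solution -/

/-- `(c - 1) / B` extends continuously over `B = 0` if `c 0 = 1`. -/
theorem exists_continuousOn_div {I : Set ℝ} (hI : IsOpen I) {c : ℝ → ℝ}
    (hc : ContDiffOn ℝ ∞ c I) (h0 : 0 ∈ I → c 0 = 1) :
    ∃ h : ℝ → ℝ, ContinuousOn h I ∧ ∀ B ∈ I, B * h B = c B - 1 := by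
  by_cases hz : (0 : ℝ) ∈ I
  · refine ⟨dslope c 0, (continuousOn_dslope (hI.mem_nhds hz)).2
      ⟨hc.continuousOn, (hc.contDiffAt (hI.mem_nhds hz)).differentiableAt (by simp)⟩, ?_⟩
    intro B _
    have := sub_smul_dslope c 0 B
    simpa [h0 hz] using this
  · have hne : ∀ B ∈ I, B ≠ 0 := fun B hB h => hz (h ▸ hB)
    refine ⟨fun B => (c B - 1) / B,
      (hc.continuousOn.sub continuousOn_const).div continuousOn_id hne, fun B hB => ?_⟩
    have := hne B hB
    field_simp

theorem exists_hasDerivAt_of_continuousOn {I : Set ℝ} (hI : IsOpen I) (hIc : I.OrdConnected)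
    {h : ℝ → ℝ} (hh : ContinuousOn h I) : ∃ H : ℝ → ℝ, ∀ B ∈ I, HasDerivAt H (h B) B := by
  rcases I.eq_empty_or_nonempty with rfl | ⟨x₀, hx₀⟩
  · exact ⟨0, by simp⟩
  refine ⟨fun B => ∫ z in x₀..B, h z, fun B hB => ?_⟩
  have hsub : Set.uIcc x₀ B ⊆ I := hIc.uIcc_subset hx₀ hB
  exact intervalIntegral.integral_hasDerivAt_right (hh.mono hsub).intervalIntegrable
    (hh.stronglyMeasurableAtFilter hI B hB) (hh.continuousAt (hI.mem_nhds hB))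

theorem d1_reflect (φ : ℝ → ℝ → ℝ) (B s : ℝ) : d1 (fun B s => φ B (-s)) B s = d1 φ B (-s) := rfl

theorem d2_reflect (φ : ℝ → ℝ → ℝ) (B s : ℝ) : d2 (fun B s => φ B (-s)) B s = -d2 φ B (-s) :=
  deriv_comp_neg (φ B) s

theorem d2_d2_reflect (φ : ℝ → ℝ → ℝ) (B s : ℝ) :
    d2 (d2 (fun B s => φ B (-s))) B s = d2 (d2 φ) B (-s) := by
  have h : d2 (fun B s => φ B (-s)) = fun B s => -d2 φ B (-s) :=
    funext fun B => funext fun s => d2_reflect φ B s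
  rw [h, d2, deriv.fun_neg, deriv_comp_neg (d2 φ B) s, neg_neg]
  rfl

theorem d2_d1_reflect (φ : ℝ → ℝ → ℝ) (B s : ℝ) :
    d2 (d1 (fun B s => φ B (-s))) B s = -d2 (d1 φ) B (-s) :=
  deriv_comp_neg (d1 φ B) s

/-- The function `c = 2 φ₁ / φ₂₂` at `s = 0` is smooth and nonzero on an open interval around the
values of `b²`, which is chosen to contain zero only if zero is a value of `b²`, where `c = 1`. -/
theorem exists_levelSystem {J : Set ℝ} {φ : ℝ → ℝ → ℝ} {Ω : Set (ℝ × ℝ)} (hJ : J.OrdConnected)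
    (hne : J.Nonempty) (h0 : ∀ B ∈ J, 0 ≤ B) (hΩ : IsOpen Ω)
    (hmem : ∀ B ∈ J, ∀ s : ℝ, s ^ 2 ≤ B → (B, s) ∈ Ω)
    (hφ : ContDiffOn ℝ ∞ (fun p : ℝ × ℝ => φ p.1 p.2) Ω) (h1 : ∀ B ∈ J, d1 φ B 0 ≠ 0)
    (h22 : ∀ B ∈ J, d2 (d2 φ) B 0 ≠ 0) (hv : (0 : ℝ) ∈ J → d2 (d2 φ) 0 0 = 2 * d1 φ 0 0)
    (hpde : ∀ B ∈ J, ∀ s : ℝ, s ^ 2 ≤ B →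
      d2 (d2 φ) B s * (2 * d1 φ B 0 * (B - s ^ 2) + d2 (d2 φ) B 0 * s ^ 2)
        = d2 (d2 φ) B 0 * (2 * B * (d1 φ B s - s * d2 (d1 φ) B s))) :
    ∃ (I : Set ℝ) (Λ : ℝ → ℝ),
      LevelSystem I J (fun B => 2 * d1 φ B 0 / d2 (d2 φ) B 0) Λ φ Ω := by
  obtain ⟨x₀, hx₀⟩ := hne
  have hl : Continuous fun B : ℝ => (B, (0 : ℝ)) := by fun_prop
  set K : Set ℝ := {B | (B, (0 : ℝ)) ∈ Ω} with hK
  have hKo : IsOpen K := hΩ.preimage hl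
  have s1 : ContDiffOn ℝ ∞ (fun B => d1 φ B 0) K :=
    (contDiffOn_d1 hΩ hφ).comp (g := fun p : ℝ × ℝ => d1 φ p.1 p.2)
      (f := fun B : ℝ => (B, (0 : ℝ))) (by fun_prop) fun _ h => h
  have s2 : ContDiffOn ℝ ∞ (fun B => d2 (d2 φ) B 0) K :=
    (contDiffOn_d2 hΩ (contDiffOn_d2 hΩ hφ)).comp (g := fun p : ℝ × ℝ => d2 (d2 φ) p.1 p.2)
      (f := fun B : ℝ => (B, (0 : ℝ))) (by fun_prop) fun _ h => h
  set I₀ : Set ℝ := ((K ∩ (fun B => d1 φ B 0) ⁻¹' {0}ᶜ) ∩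
    (K ∩ (fun B => d2 (d2 φ) B 0) ⁻¹' {0}ᶜ)) ∩ {B | (0 : ℝ) ∈ J ∨ 0 < B} with hI₀
  have hI₀o : IsOpen I₀ := by
    refine ((s1.continuousOn.isOpen_inter_preimage hKo isOpen_compl_singleton).inter
      (s2.continuousOn.isOpen_inter_preimage hKo isOpen_compl_singleton)).inter ?_
    by_cases h : (0 : ℝ) ∈ J
    · simp [h]
    · simp only [h, false_or]
      exact isOpen_Ioi
  have hJI₀ : J ⊆ I₀ := by
    intro B hB
    have hBK : B ∈ K := hmem B hB 0 (by simpa using h0 B hB)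
    refine ⟨⟨⟨hBK, h1 B hB⟩, hBK, h22 B hB⟩, ?_⟩
    rcases (h0 B hB).eq_or_lt with h | h
    · exact Or.inl (h ▸ hB)
    · exact Or.inr h
  set I := connectedComponentIn I₀ x₀ with hI
  have hIo : IsOpen I := hI₀o.connectedComponentIn
  have hIc : I.OrdConnected := isPreconnected_connectedComponentIn.ordConnected
  have hII₀ : I ⊆ I₀ := connectedComponentIn_subset _ _
  have hJI : J ⊆ I := hJ.isPreconnected.subset_connectedComponentIn hx₀ hJI₀
  set c : ℝ → ℝ := fun B => 2 * d1 φ B 0 / d2 (d2 φ) B 0 with hc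
  have hcs : ContDiffOn ℝ ∞ c I :=
    (contDiffOn_const.mul (s1.mono fun B hB => (hII₀ hB).1.1.1)).div
      (s2.mono fun B hB => (hII₀ hB).1.1.1) fun B hB => (hII₀ hB).1.2.2
  obtain ⟨h, hhc, hh⟩ := exists_continuousOn_div hIo hcs fun h => by
    have h' : (0 : ℝ) ∈ J := (hII₀ h).2.resolve_right (lt_irrefl _)
    have := h1 0 h'
    simp only [hc]
    rw [hv h']
    field_simp
  obtain ⟨Λ, hΛ⟩ := exists_hasDerivAt_of_continuousOn hIo hIc hhc
  refine ⟨I, Λ, ?_⟩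
  exact
    { isOpen := hIo
      ordConnected := hIc
      subset := hJI
      ordConnected_values := hJ
      nonneg := h0
      smooth_coeff := hcs
      coeff_ne := fun B hB =>
        div_ne_zero (mul_ne_zero two_ne_zero (hII₀ hB).1.1.2) (hII₀ hB).1.2.2
      differentiableAt := fun B hB => (hΛ B hB).differentiableAt
      deriv_eq := fun B hB => by rw [(hΛ B hB).deriv, hh B hB]
      isOpen_dom := hΩ
      mem_dom := hmem
      mem_dom_zero := fun B hB => (hII₀ hB).1.1.1
      smooth := hφ
      pde := fun B hB s hs => by
        have hq := h22 B hB
        have := hpde B hB s hs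
        simp only [hc]
        field_simp
        linear_combination this }

namespace LevelSystem
variable {I J : Set ℝ} {c Λ : ℝ → ℝ} {φ : ℝ → ℝ → ℝ} {Ω : Set (ℝ × ℝ)}
  (S : LevelSystem I J c Λ φ Ω)
include S

/-- The equation for `φ` is invariant under `s ↦ -s`. -/
theorem reflect : LevelSystem I J c Λ (fun B s => φ B (-s)) ((fun p : ℝ × ℝ => (p.1, -p.2)) ⁻¹' Ω) :=
  { S with
    isOpen_dom := S.isOpen_dom.preimage (by fun_prop)
    mem_dom := fun B hB s hs => S.mem_dom B hB (-s) (by simpa using hs)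
    mem_dom_zero := fun B hB => by simpa using S.mem_dom_zero B hB
    smooth := S.smooth.comp (g := fun p : ℝ × ℝ => φ p.1 p.2)
      (f := fun p : ℝ × ℝ => (p.1, -p.2)) (by fun_prop) fun _ h => h
    pde := fun B hB s hs => by
      have := S.pde B hB (-s) (by simpa using hs)
      rw [d2_d2_reflect, d2_d1_reflect, d1_reflect]
      simp only [neg_sq] at this
      linear_combination this }

theorem exists_levelMap_eq {a b σ : ℝ} (ha : a ∈ J) (hb : b ∈ J) (hσa : levelMap Λ a ≤ σ)
    (hσb : σ ≤ levelMap Λ b) : ∃ B ∈ J, levelMap Λ B = σ := by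
  have hsub := S.ordConnected_values.uIcc_subset ha hb
  obtain ⟨B, hB, h⟩ := intermediate_value_uIcc
    (S.continuousOn_levelMap.mono (hsub.trans S.subset)) (Set.mem_uIcc_of_le hσa hσb)
  exact ⟨B, hsub hB, h⟩

theorem legendre_eq_zero_height {a b σ : ℝ} (ha : a ∈ J) (hb : b ∈ J) (hσ : 0 ≤ σ)
    (hσa : levelMap Λ a = σ) (hσb : σ ≤ levelMap Λ b) :
    φ a 0 = legendre φ b (levelHeight Λ σ b) := by
  have := S.legendre_eq ha hb hσ hσa.ge hσb
  rw [← hσa, levelHeight_levelMap, hσa] at this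
  simpa [legendre] using this

/-- There is a smooth `f` with `φ - s φ₂ = f(exp Λ (b² - s²))` for `s ≥ 0`. For large values `σ` the
level curve is followed to the axis `s = 0`, for small ones to the line `b² = b`; the two
descriptions agree between `levelMap Λ a` and `levelMap Λ b`. -/
theorem exists_profile {a b : ℝ} (ha : a ∈ J) (hb : b ∈ J) (ha0 : 0 < a)
    (hab : levelMap Λ a < levelMap Λ b) :
    ∃ (T : Set ℝ) (f : ℝ → ℝ), IsOpen T ∧ ContDiffOn ℝ ∞ f T ∧
      (∀ B ∈ J, ∀ s : ℝ, s ^ 2 ≤ B → Real.exp (Λ B) * (B - s ^ 2) ∈ T) ∧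
      ∀ B ∈ J, ∀ s : ℝ, 0 ≤ s → s ^ 2 ≤ B →
        f (Real.exp (Λ B) * (B - s ^ 2)) = legendre φ B s := by
  obtain ⟨σ₁, ha1, hb1⟩ := exists_between hab
  have hpos : 0 < levelMap Λ a := mul_pos ha0 (Real.exp_pos _)
  set inv := Function.invFunOn (levelMap Λ) I with hinv
  have hinvI : ∀ B ∈ I, inv (levelMap Λ B) = B := fun B hB =>
    S.injOn_levelMap.leftInvOn_invFunOn hB
  set f : ℝ → ℝ := fun σ => if σ₁ ≤ σ then φ (inv σ) 0 else legendre φ b (levelHeight Λ σ b)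
    with hf
  -- on `V₁` and `V₂` the first and the second branch of `f` is a smooth formula for it: the inverse
  -- of the level map may fail to be smooth at `σ = 0`, and the square root fails to be smooth at
  -- `σ = levelMap Λ b`
  set V₁ : Set ℝ := Set.Ioi (levelMap Λ a) ∩ levelMap Λ '' (I ∩ Set.Ioi 0) with hV₁
  set V₂ : Set ℝ := Set.Iio (levelMap Λ b) ∩ {σ | (b, levelHeight Λ σ b) ∈ Ω} with hV₂
  have hbI := S.subset hb
  have hcon : Continuous fun σ => levelHeight Λ σ b := by unfold levelHeight; fun_prop
  have hmid : ∀ σ, levelMap Λ a < σ → σ < levelMap Λ b →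
      φ (inv σ) 0 = legendre φ b (levelHeight Λ σ b) := by
    intro σ h1 h2
    obtain ⟨B, hB, hBσ⟩ := S.exists_levelMap_eq ha hb h1.le h2.le
    rw [← hBσ, hinvI B (S.subset hB), hBσ]
    exact S.legendre_eq_zero_height hB hb (hpos.trans h1).le hBσ h2.le
  have hf1 : ∀ σ ∈ V₁, f σ = φ (inv σ) 0 := by
    intro σ hσ
    simp only [hf]
    split_ifs with h
    · rfl
    · exact (hmid σ hσ.1 ((not_le.1 h).trans hb1)).symm
  have hf2 : ∀ σ ∈ V₂, f σ = legendre φ b (levelHeight Λ σ b) := by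
    intro σ hσ
    simp only [hf]
    split_ifs with h
    · exact hmid σ (ha1.trans_le h) hσ.1
    · rfl
  have hsm1 : ∀ B ∈ I ∩ Set.Ioi 0, ContDiffAt ℝ ∞ inv (levelMap Λ B) := fun B hB =>
    S.contDiffAt_invFunOn hB.1 (ne_of_gt hB.2)
  have hV₁o : IsOpen V₁ := by
    refine isOpen_Ioi.inter (isOpen_iff_mem_nhds.2 ?_)
    rintro _ ⟨B, hB, rfl⟩
    have hd : HasStrictDerivAt (levelMap Λ) (c B * Real.exp (Λ B)) B :=
      (contDiffAt_id.mul (S.contDiffAt_potential hB.1 (ne_of_gt hB.2)).exp).hasStrictDerivAt'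
        (S.hasDerivAt_levelMap hB.1) (by simp)
    rw [← hd.map_nhds_eq (mul_ne_zero (S.coeff_ne B hB.1) (Real.exp_pos _).ne')]
    exact Filter.image_mem_map ((S.isOpen.inter isOpen_Ioi).mem_nhds hB)
  have hV₂o : IsOpen V₂ := isOpen_Iio.inter (S.isOpen_dom.preimage (by fun_prop))
  have hs1 : ContDiffOn ℝ ∞ f V₁ := by
    refine ContDiffOn.congr (f := fun σ => φ (inv σ) 0) ?_ hf1
    rintro _ ⟨-, B, hB, rfl⟩
    refine ContDiffAt.contDiffWithinAt ?_
    refine ContDiffAt.comp (g := fun p : ℝ × ℝ => φ p.1 p.2) (f := fun σ => (inv σ, (0 : ℝ))) _ ?_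
      ((hsm1 B hB).prodMk contDiffAt_const)
    rw [hinvI B hB.1]
    exact S.smooth.contDiffAt (S.isOpen_dom.mem_nhds (S.mem_dom_zero B hB.1))
  have hs2 : ContDiffOn ℝ ∞ f V₂ := by
    refine ContDiffOn.congr (f := fun σ => legendre φ b (levelHeight Λ σ b)) ?_ hf2
    intro σ hσ
    refine ContDiffAt.contDiffWithinAt ?_
    refine ContDiffAt.comp (g := fun p : ℝ × ℝ => legendre φ p.1 p.2)
      (f := fun σ => (b, levelHeight Λ σ b)) _ (S.contDiffAt_legendre hσ.2)
      (contDiffAt_const.prodMk ?_)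
    refine ContDiffAt.sqrt ?_ (sub_mul_exp_pos.2 hσ.1).ne'
    fun_prop
  have hval : ∀ B ∈ J, ∀ s : ℝ, s ^ 2 ≤ B → Real.exp (Λ B) * (B - s ^ 2) ∈ V₁ ∪ V₂ := by
    intro B hB s hs
    set σ := Real.exp (Λ B) * (B - s ^ 2) with hσ
    have hσ0 : 0 ≤ σ := level_nonneg hs
    rcases le_or_gt σ₁ σ with h | h
    · left
      obtain ⟨B', hB', h'⟩ := S.exists_levelMap_eq ha hB (ha1.le.trans h) level_le_levelMap
      refine ⟨ha1.trans_le h, B', ⟨S.subset hB', ?_⟩, h'⟩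
      refine lt_of_le_of_ne (S.nonneg B' hB') fun h0 => ?_
      rw [← h0, levelMap, zero_mul] at h'
      linarith
    · exact Or.inr ⟨h.trans hb1, S.mem_dom b hb _ (levelHeight_sq_le (h.trans hb1).le hσ0)⟩
  refine ⟨V₁ ∪ V₂, f, hV₁o.union hV₂o, hs1.union_of_isOpen hs2 hV₁o hV₂o, hval, ?_⟩
  intro B hB s hs0 hs
  have hσ0 : 0 ≤ Real.exp (Λ B) * (B - s ^ 2) := level_nonneg hs
  have hht := levelHeight_eq (Λ := Λ) (B := B) hs0
  have hle := level_le_levelMap (Λ := Λ) (B := B) (s := s)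
  set σ := Real.exp (Λ B) * (B - s ^ 2) with hσ
  rw [← hht]
  simp only [hf]
  split_ifs with h
  · obtain ⟨B', hB', h'⟩ := S.exists_levelMap_eq ha hB (ha1.le.trans h) hle
    rw [← h', hinvI B' (S.subset hB'), h']
    exact S.legendre_eq_zero_height hB' hB hσ0 h' hle
  · exact S.legendre_eq hb hB hσ0 ((not_le.1 h).trans hb1).le hle

end LevelSystem

/-! ### The profile `φ` in terms of `f` -/

theorem explicitPhi_neg (f : ℝ → ℝ) (μ ν g s : ℝ) :
    explicitPhi f μ ν (-g) (-s) = explicitPhi f μ ν g s := by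
  have h : ∫ z in (0 : ℝ)..(-s), deriv f (μ + ν * z ^ 2)
      = -∫ z in (0 : ℝ)..s, deriv f (μ + ν * z ^ 2) := by
    have := intervalIntegral.integral_comp_neg (a := 0) (b := s)
      (fun z => deriv f (μ + ν * z ^ 2))
    simp only [neg_sq, neg_zero] at this
    rw [this, intervalIntegral.integral_symm]
  rw [explicitPhi, explicitPhi, h]
  ring

theorem legendre_reflect (φ : ℝ → ℝ → ℝ) (B s : ℝ) :
    legendre (fun B s => φ B (-s)) B s = legendre φ B (-s) := by
  rw [legendre, legendre, d2_reflect]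
  ring

namespace LevelSystem
variable {I J : Set ℝ} {c Λ : ℝ → ℝ} {φ : ℝ → ℝ → ℝ} {Ω : Set (ℝ × ℝ)}
  (S : LevelSystem I J c Λ φ Ω)
include S

/-- `φ` is recovered from `φ - s φ₂ = f(exp Λ (b² - s²))`, as `φ₂₂ = 2 exp Λ · f'`. -/
theorem eq_explicitPhi {T : Set ℝ} {f : ℝ → ℝ} (hT : IsOpen T) (hf : ContDiffOn ℝ ∞ f T) {B : ℝ}
    (hB : B ∈ J) (hv : ∀ s : ℝ, s ^ 2 ≤ B → Real.exp (Λ B) * (B - s ^ 2) ∈ T)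
    (hl : ∀ s : ℝ, 0 ≤ s → s ^ 2 ≤ B → f (Real.exp (Λ B) * (B - s ^ 2)) = legendre φ B s) {s : ℝ}
    (hs0 : 0 ≤ s) (hs : s ^ 2 ≤ B) :
    φ B s = explicitPhi f (levelMap Λ B) (-Real.exp (Λ B)) (d2 φ B 0) s := by
  have hE := Real.exp_pos (Λ B)
  have hlev : ∀ z : ℝ, levelMap Λ B + -Real.exp (Λ B) * z ^ 2 = Real.exp (Λ B) * (B - z ^ 2) :=
    fun z => by rw [levelMap]; ring
  have hzs : ∀ z ∈ Set.Icc 0 s, z ^ 2 ≤ B := fun z hz =>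
    (pow_le_pow_left₀ hz.1 hz.2 2).trans hs
  have hc2 : ∀ z : ℝ, z ^ 2 ≤ B → HasDerivAt (d2 φ B) (d2 (d2 φ) B z) z := fun z hz =>
    hasDerivAt_d2 S.isOpen_dom (contDiffOn_d2 S.isOpen_dom S.smooth) (S.mem_dom B hB z hz)
  have hfd : ContinuousOn (deriv f) T := (hf.deriv_of_isOpen hT (m := ∞) (by simp)).continuousOn
  have hint : ∫ z in (0 : ℝ)..s, deriv f (levelMap Λ B + -Real.exp (Λ B) * z ^ 2)
      = d2 φ B s / (2 * Real.exp (Λ B)) - d2 φ B 0 / (2 * Real.exp (Λ B)) := by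
    refine intervalIntegral.integral_eq_sub_of_hasDerivAt_of_le hs0
      (f := fun z => d2 φ B z / (2 * Real.exp (Λ B))) ?_ ?_ ?_
    · exact fun z hz => ((hc2 z (hzs z hz)).continuousAt.div_const _).continuousWithinAt
    · intro z hz
      refine ((hc2 z (hzs z (Set.Ioo_subset_Icc_self hz))).div_const _).congr_deriv ?_
      have hz2 : z ^ 2 < B := (pow_lt_pow_left₀ hz.2 hz.1.le two_ne_zero).trans_le hs
      have h1 : HasDerivAt (fun z => Real.exp (Λ B) * (B - z ^ 2)) (Real.exp (Λ B) * (-(2 * z))) z := by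
        simpa using (((hasDerivAt_id z).pow 2).const_sub B).const_mul (Real.exp (Λ B))
      have h2 := ((hf.contDiffAt (hT.mem_nhds (hv z hz2.le))).differentiableAt
        (by simp)).hasDerivAt.comp z h1
      have h3 := (hasDerivAt_d2 S.isOpen_dom S.smooth (S.mem_dom B hB z hz2.le)).sub
        ((hasDerivAt_id z).mul (hc2 z hz2.le))
      have h4 : (f ∘ fun z => Real.exp (Λ B) * (B - z ^ 2)) =ᶠ[𝓝 z]
          (φ B - id * d2 φ B) := by
        filter_upwards [lt_mem_nhds hz.1,
          (continuous_pow 2).continuousAt.eventually_lt continuousAt_const hz2] with w hw hw2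
        exact hl w hw.le hw2.le
      have h5 := h2.unique (h3.congr_of_eventuallyEq h4)
      rw [hlev]
      simp only [id_eq] at h5
      have hz0 := hz.1.ne'
      rw [div_eq_iff (by positivity)]
      refine mul_left_cancel₀ hz0 ?_
      linear_combination h5
    · refine ContinuousOn.intervalIntegrable ?_
      rw [Set.uIcc_of_le hs0]
      exact hfd.comp (by fun_prop) fun z hz => by
        simpa only [hlev] using hv z (hzs z hz)
  rw [explicitPhi, hint, hlev, hl s hs0 hs, legendre]
  field_simp
  ring

/-- If the values of `b²` come close to zero and `φ - s φ₂` has a limit at the vertex `(0, 0)`, then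
`φ - s φ₂` is even in `s`. -/
theorem legendre_neg (hv : ∀ δ > 0, ∃ B ∈ J, B < δ) {L : ℝ}
    (hL : Tendsto (fun p : ℝ × ℝ => φ p.1 p.2 - p.2 * d2 φ p.1 p.2)
      (𝓝[{p : ℝ × ℝ | p.1 ∈ J ∧ p.2 ^ 2 ≤ p.1}] (0, 0)) (𝓝 L)) {B s : ℝ} (hB : B ∈ J)
    (hs0 : 0 ≤ s) (hs : s ^ 2 ≤ B) : legendre φ B (-s) = legendre φ B s := by
  have hσ : 0 ≤ Real.exp (Λ B) * (B - s ^ 2) := level_nonneg hs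
  have hht := levelHeight_eq (Λ := Λ) (B := B) hs0
  have hle := level_le_levelMap (Λ := Λ) (B := B) (s := s)
  set σ := Real.exp (Λ B) * (B - s ^ 2)
  by_cases hex : ∃ B' ∈ J, levelMap Λ B' = σ
  · -- the level curve meets the axis `s = 0`
    obtain ⟨B', hB', h'⟩ := hex
    have h1 := S.legendre_eq_zero_height hB' hB hσ h' hle
    have h2 := S.reflect.legendre_eq_zero_height hB' hB hσ h' hle
    rw [legendre_reflect] at h2
    rw [hht] at h1 h2
    rw [← h1, ← h2, neg_zero]
  · -- the level curve runs into the vertex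
    have hgt : ∀ B' ∈ J, σ ≤ levelMap Λ B' := by
      intro B' hB'
      by_contra! h
      exact hex (S.exists_levelMap_eq hB' hB h.le hle)
    choose! u huJ huδ using hv
    have hw : ∀ k : ℕ, (0 : ℝ) < 1 / ((k : ℝ) + 1) := fun k => Nat.one_div_pos_of_nat
    set v : ℕ → ℝ := fun k => u (1 / ((k : ℝ) + 1)) with hvdef
    have hvJ : ∀ k, v k ∈ J := fun k => huJ _ (hw k)
    have hv0 : Tendsto v atTop (𝓝 0) :=
      squeeze_zero (fun k => S.nonneg _ (hvJ k)) (fun k => (huδ _ (hw k)).le)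
        tendsto_one_div_add_atTop_nhds_zero_nat
    have hh0 : Tendsto (fun k => levelHeight Λ σ (v k)) atTop (𝓝 0) := by
      have hsq : Tendsto (fun k => Real.sqrt (v k)) atTop (𝓝 0) := by
        have := (Real.continuous_sqrt.tendsto 0).comp hv0
        rwa [Real.sqrt_zero] at this
      refine squeeze_zero (fun k => Real.sqrt_nonneg _) (fun k => ?_) hsq
      exact Real.le_sqrt_of_sq_le (levelHeight_sq_le (hgt _ (hvJ k)) hσ)
    have key : ∀ r : ℝ, r ^ 2 = 1 →
        Tendsto (fun k => legendre φ (v k) (r * levelHeight Λ σ (v k))) atTop (𝓝 L) := by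
      intro r hr
      refine hL.comp (tendsto_nhdsWithin_iff.2 ⟨hv0.prodMk_nhds (by simpa using hh0.const_mul r),
        Filter.Eventually.of_forall fun k => ⟨hvJ k, ?_⟩⟩)
      show (r * levelHeight Λ σ (v k)) ^ 2 ≤ v k
      rw [mul_pow, hr, one_mul]
      exact levelHeight_sq_le (hgt _ (hvJ k)) hσ
    have h1 : ∀ k, legendre φ (v k) (1 * levelHeight Λ σ (v k)) = legendre φ B s := fun k => by
      have := S.legendre_eq (hvJ k) hB hσ (hgt _ (hvJ k)) hle
      rwa [hht, ← one_mul (levelHeight Λ σ (v k))] at this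
    have h2 : ∀ k, legendre φ (v k) (-1 * levelHeight Λ σ (v k)) = legendre φ B (-s) := fun k => by
      have := S.reflect.legendre_eq (hvJ k) hB hσ (hgt _ (hvJ k)) hle
      rwa [legendre_reflect, legendre_reflect, hht, ← neg_one_mul (levelHeight Λ σ (v k))] at this
    have t1 := key 1 (by norm_num)
    have t2 := key (-1) (by norm_num)
    simp only [h1] at t1
    simp only [h2] at t2
    exact (tendsto_nhds_unique t2 tendsto_const_nhds).symm.trans
      (tendsto_nhds_unique t1 tendsto_const_nhds)

theorem exists_ordered (hJ : J.Nontrivial) :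
    ∃ a ∈ J, ∃ b ∈ J, 0 < a ∧ levelMap Λ a < levelMap Λ b := by
  obtain ⟨a, ha, b, hb, hab⟩ := hJ.exists_lt
  have hmem : ∀ z ∈ Set.Icc a b, z ∈ J := fun z hz => S.ordConnected_values.out ha hb hz
  have ha0 := S.nonneg a ha
  have hm : (a + b) / 2 ∈ J := hmem _ ⟨by linarith, by linarith⟩
  rcases lt_trichotomy (levelMap Λ ((a + b) / 2)) (levelMap Λ b) with h | h | h
  · exact ⟨_, hm, b, hb, by linarith, h⟩
  · have := S.injOn_levelMap (S.subset hm) (S.subset hb) h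
    linarith
  · exact ⟨b, hb, _, hm, by linarith, h⟩

/-- The explicit form of `φ`, with separate functions for `s ≥ 0` and `s ≤ 0`. -/
theorem exists_explicit (hJ : J.Nontrivial) :
    ∃ (T : Set ℝ) (fp fm : ℝ → ℝ), IsOpen T ∧ ContDiffOn ℝ ∞ fp T ∧ ContDiffOn ℝ ∞ fm T ∧
      ∀ B ∈ J, ∀ s : ℝ, s ^ 2 ≤ B → Real.exp (Λ B) * (B - s ^ 2) ∈ T ∧
        (0 ≤ s → φ B s = explicitPhi fp (levelMap Λ B) (-Real.exp (Λ B)) (d2 φ B 0) s) ∧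
        (s ≤ 0 → φ B s = explicitPhi fm (levelMap Λ B) (-Real.exp (Λ B)) (d2 φ B 0) s) := by
  obtain ⟨a, ha, b, hb, ha0, hab⟩ := S.exists_ordered hJ
  obtain ⟨T₁, fp, hT₁, hfp, hv₁, hl₁⟩ := S.exists_profile ha hb ha0 hab
  obtain ⟨T₂, fm, hT₂, hfm, hv₂, hl₂⟩ := S.reflect.exists_profile ha hb ha0 hab
  refine ⟨T₁ ∩ T₂, fp, fm, hT₁.inter hT₂, hfp.mono Set.inter_subset_left,
    hfm.mono Set.inter_subset_right, fun B hB s hs => ⟨⟨hv₁ B hB s hs, hv₂ B hB s hs⟩,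
      fun h => S.eq_explicitPhi hT₁ hfp hB (hv₁ B hB) (hl₁ B hB) h hs, fun h => ?_⟩⟩
  have := S.reflect.eq_explicitPhi hT₂ hfm hB (hv₂ B hB) (hl₂ B hB) (s := -s) (by linarith)
    (by simpa using hs)
  rwa [neg_neg, d2_reflect, neg_zero, explicitPhi_neg] at this

/-- The explicit form of `φ` with one function, under the hypotheses of `legendre_neg`. -/
theorem exists_explicit_of_vertex (hJ : J.Nontrivial) (hv : ∀ δ > 0, ∃ B ∈ J, B < δ) {L : ℝ}
    (hL : Tendsto (fun p : ℝ × ℝ => φ p.1 p.2 - p.2 * d2 φ p.1 p.2)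
      (𝓝[{p : ℝ × ℝ | p.1 ∈ J ∧ p.2 ^ 2 ≤ p.1}] (0, 0)) (𝓝 L)) :
    ∃ (T : Set ℝ) (f : ℝ → ℝ), IsOpen T ∧ ContDiffOn ℝ ∞ f T ∧
      ∀ B ∈ J, ∀ s : ℝ, s ^ 2 ≤ B → Real.exp (Λ B) * (B - s ^ 2) ∈ T ∧
        φ B s = explicitPhi f (levelMap Λ B) (-Real.exp (Λ B)) (d2 φ B 0) s := by
  obtain ⟨a, ha, b, hb, ha0, hab⟩ := S.exists_ordered hJ
  obtain ⟨T, f, hT, hf, hv', hl⟩ := S.exists_profile ha hb ha0 hab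
  refine ⟨T, f, hT, hf, fun B hB s hs => ⟨hv' B hB s hs, ?_⟩⟩
  rcases le_total 0 s with h | h
  · exact S.eq_explicitPhi hT hf hB (hv' B hB) (hl B hB) h hs
  · have hl' : ∀ s : ℝ, 0 ≤ s → s ^ 2 ≤ B → f (Real.exp (Λ B) * (B - s ^ 2))
        = legendre (fun B s => φ B (-s)) B s := fun s h0 hs => by
      rw [legendre_reflect, S.legendre_neg hv hL hB h0 hs, hl B hB s h0 hs]
    have := S.reflect.eq_explicitPhi hT hf hB (hv' B hB) hl' (s := -s) (by linarith)
      (by simpa using hs)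
    rwa [neg_neg, d2_reflect, neg_zero, explicitPhi_neg] at this

end LevelSystem

/-! ### From projective flatness to the explicit form -/

theorem cov_smul {κ : ℝ} {ρ : Vec n → ℝ} {β : Vec n → (Vec n →L[ℝ] ℝ)} {x : Vec n}
    (hρ : DifferentiableAt ℝ ρ x) (hβ : DifferentiableAt ℝ β x) (u v : Vec n) :
    cov κ (fun z => ρ z • β z) x u v = ρ x * cov κ β x u v + fderiv ℝ ρ x v * β x u := by
  have h : fderiv ℝ (fun z => ρ z • β z) x = _ := (hρ.hasFDerivAt.smul hβ.hasFDerivAt).fderiv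
  rw [cov, h, cov]
  simp only [add_apply, smul_apply, smul_eq_mul,
    ContinuousLinearMap.smulRight_apply]
  ring

theorem abs_mul_apply_le {κ : ℝ} {x : Vec n} (hx : 0 < 1 + κ * ‖x‖ ^ 2)
    (β : Vec n → (Vec n →L[ℝ] ℝ)) (u v : Vec n) :
    |β x u * β x v| ≤ bSq κ β x * ((metricForm κ x u u + metricForm κ x v v) / 2) := by
  have h1 := sq_apply_le hx β u
  have h2 := sq_apply_le hx β v
  rw [abs_le]
  constructor <;> nlinarith [sq_nonneg (β x u + β x v), sq_nonneg (β x u - β x v)]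

/-- The function `exp (Λ(b²) / 2)`, by which `β` has to be multiplied to become a closed
conformal form. -/
def conformalFactor (κ : ℝ) (β : Vec n → (Vec n →L[ℝ] ℝ)) (Λ : ℝ → ℝ) (x : Vec n) : ℝ :=
  Real.exp (Λ (bSq κ β x) / 2)

theorem hasFDerivAt_conformalFactor {κ : ℝ} {β : Vec n → (Vec n →L[ℝ] ℝ)} {Λ : ℝ → ℝ} {x : Vec n}
    (hΛ : DifferentiableAt ℝ Λ (bSq κ β x)) (hb : DifferentiableAt ℝ (bSq κ β) x) :
    HasFDerivAt (conformalFactor κ β Λ)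
      ((conformalFactor κ β Λ x * (deriv Λ (bSq κ β x) / 2)) • fderiv ℝ (bSq κ β) x) x := by
  have h1 := (hΛ.hasDerivAt.div_const 2).exp
  exact h1.comp_hasFDerivAt x hb.hasFDerivAt

theorem mem_valueSet_iff {κ : ℝ} {U : Set (Vec n)} {β : Vec n → (Vec n →L[ℝ] ℝ)} (p : ℝ × ℝ) :
    p ∈ valueSet κ U β ↔ p.1 ∈ bSq κ β '' U ∧ p.2 ^ 2 ≤ p.1 := by
  constructor
  · rintro ⟨x, hx, h1, h2⟩
    exact ⟨⟨x, hx, h1.symm⟩, by rwa [h1]⟩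
  · rintro ⟨⟨x, hx, h1⟩, h2⟩
    exact ⟨x, hx, h1.symm, by rwa [h1]⟩

namespace Setting
variable {κ : ℝ} {U : Set (Vec n)} {β : Vec n → (Vec n →L[ℝ] ℝ)} {φ : ℝ → ℝ → ℝ}
  {Ω : Set (ℝ × ℝ)} (S : Setting κ U β φ Ω) {x : Vec n}
include S

theorem ordConnected_values : (bSq κ β '' U).OrdConnected :=
  (S.isConnected.isPreconnected.image _ S.continuousOn_bSq).ordConnected

theorem nontrivial_values (hconst : ∀ B, ¬ ∀ x ∈ U, bSq κ β x = B) :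
    (bSq κ β '' U).Nontrivial := by
  obtain ⟨x₀, hx₀⟩ := S.isConnected.nonempty
  have := hconst (bSq κ β x₀)
  push Not at this
  obtain ⟨x₁, hx₁, hne⟩ := this
  exact ⟨_, ⟨x₁, hx₁, rfl⟩, _, ⟨x₀, hx₀, rfl⟩, hne⟩

theorem exists_levelSystem (hflat : IsProjectivelyFlat U (generalMetric κ β φ)) :
    ∃ (I : Set ℝ) (Λ : ℝ → ℝ), LevelSystem I (bSq κ β '' U)
      (fun B => 2 * d1 φ B 0 / d2 (d2 φ) B 0) Λ φ Ω := by
  refine GeneralAlphaBeta.exists_levelSystem S.ordConnected_values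
    (S.isConnected.nonempty.image _) ?_ S.isOpen_dom ?_ S.smooth ?_ ?_ ?_ ?_
  · rintro _ ⟨x, hx, rfl⟩; exact bSq_nonneg (S.conf_pos x hx) β
  · rintro _ ⟨x, hx, rfl⟩ s hs; exact S.mem_dom hx hs
  · rintro _ ⟨x, hx, rfl⟩; exact S.d1_ne x hx
  · rintro _ ⟨x, hx, rfl⟩; exact S.d22_zero_ne hflat hx
  · rintro ⟨x, hx, h⟩; exact S.d22_zero_of_eq_zero hflat hx h
  · rintro _ ⟨x, hx, rfl⟩ s hs; exact S.pde hflat hx hs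

/-- At a zero of `β` the covariant derivative is a multiple of the metric, as a limit of `cov_eq` at
nearby points where `β ≠ 0`, or because `β` vanishes nearby. -/
theorem exists_cov_eq_of_form_eq_zero (hflat : IsProjectivelyFlat U (generalMetric κ β φ))
    {I : Set ℝ} {Λ : ℝ → ℝ} (hL : LevelSystem I (bSq κ β '' U)
      (fun B => 2 * d1 φ B 0 / d2 (d2 φ) B 0) Λ φ Ω) (hx : x ∈ U) (hb : β x = 0) :
    ∃ k, ∀ u v, cov κ β x u v = k * metricForm κ x u v := by
  by_cases hev : ∀ᶠ z in 𝓝 x, β z = 0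
  · exact ⟨0, fun u v => by rw [cov_eq_zero_of_eventually hev, zero_mul]⟩
  set c : ℝ → ℝ := fun B => 2 * d1 φ B 0 / d2 (d2 φ) B 0 with hc
  have hxI : bSq κ β x ∈ I := hL.subset ⟨x, hx, rfl⟩
  have hB0 : bSq κ β x = 0 := (bSq_eq_zero_iff (S.conf_pos x hx) β).2 hb
  have hc1 : c (bSq κ β x) = 1 := by
    have := hL.deriv_eq _ hxI
    rw [hB0, zero_mul] at this
    rw [hB0]
    linarith
  have hcc : ContinuousAt (fun z => c (bSq κ β z)) x :=
    ContinuousAt.comp (f := bSq κ β) (hL.smooth_coeff.continuousOn.continuousAt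
      (hL.isOpen.mem_nhds hxI)) (S.differentiableAt_bSq hx).continuousAt
  have hW : ∀ᶠ z in 𝓝 x, z ∈ U := S.isOpen.mem_nhds hx
  have : (𝓝[{z | β z ≠ 0}] x).NeBot := by
    rw [← mem_closure_iff_nhdsWithin_neBot, mem_closure_iff_frequently]
    exact fun h => hev (h.mono fun z hz => not_not.1 hz)
  have hA : ∀ u v, ContinuousAt (fun z => metricForm κ z u v) x := fun u v =>
    continuousAt_metricForm (S.conf_pos x hx) continuousAt_const continuousAt_const
  have hT : ∀ u v, ContinuousAt (fun z => cov κ β z u v) x := fun u v =>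
    continuousAt_cov (S.conf_pos x hx) (S.contDiffAt_form hx) continuousAt_const continuousAt_const
  -- the bracket in `cov_eq` tends to the metric, because `β ⊗ β / b²` is bounded and `c → 1`
  have hM : ∀ u v, Tendsto (fun z => c (bSq κ β z) * metricForm κ z u v
      + (1 - c (bSq κ β z)) / bSq κ β z * (β z u * β z v)) (𝓝[{z | β z ≠ 0}] x)
      (𝓝 (metricForm κ x u v)) := by
    intro u v
    have h1 : Tendsto (fun z => c (bSq κ β z) * metricForm κ z u v) (𝓝[{z | β z ≠ 0}] x)
        (𝓝 (1 * metricForm κ x u v)) := by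
      rw [← hc1]
      exact (hcc.mul (hA u v)).tendsto.mono_left nhdsWithin_le_nhds
    have h2 : Tendsto (fun z => |1 - c (bSq κ β z)|
        * ((metricForm κ z u u + metricForm κ z v v) / 2)) (𝓝[{z | β z ≠ 0}] x) (𝓝 0) := by
      have : ContinuousAt (fun z => |1 - c (bSq κ β z)|
          * ((metricForm κ z u u + metricForm κ z v v) / 2)) x :=
        (continuousAt_const.sub hcc).abs.mul (((hA u u).add (hA v v)).div_const 2)
      have h := this.tendsto.mono_left (nhdsWithin_le_nhds (s := {z | β z ≠ 0}))
      rwa [hc1, sub_self, abs_zero, zero_mul] at h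
    have h3 : Tendsto (fun z => (1 - c (bSq κ β z)) / bSq κ β z * (β z u * β z v))
        (𝓝[{z | β z ≠ 0}] x) (𝓝 0) := by
      refine squeeze_zero_norm' ?_ h2
      filter_upwards [self_mem_nhdsWithin, hW.filter_mono nhdsWithin_le_nhds] with z hz hzU
      have hpos := S.bSq_pos hzU hz
      rw [Real.norm_eq_abs, abs_mul, abs_div, abs_of_pos hpos, div_mul_eq_mul_div,
        div_le_iff₀ hpos, mul_assoc]
      refine mul_le_mul_of_nonneg_left ?_ (abs_nonneg _)
      rw [mul_comm ((_ : ℝ) / 2)]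
      exact abs_mul_apply_le (S.conf_pos z hzU) β u v
    simpa using h1.add h3
  have hlim : ∀ u v w, cov κ β x u v * metricForm κ x w w
      = cov κ β x w w * metricForm κ x u v := by
    intro u v w
    refine tendsto_nhds_unique
      (((hT u v).tendsto.mono_left nhdsWithin_le_nhds).mul (hM w w))
      ((((hT w w).tendsto.mono_left nhdsWithin_le_nhds).mul (hM u v)).congr' ?_)
    filter_upwards [self_mem_nhdsWithin, hW.filter_mono nhdsWithin_le_nhds] with z hz hzU
    rw [S.cov_eq hflat hzU hz w w, S.cov_eq hflat hzU hz u v]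
    ring
  obtain ⟨w, hw⟩ : ∃ w : Vec n, w ≠ 0 := by
    have : Nontrivial (Vec n) := Module.nontrivial_of_finrank_pos (R := ℝ)
      (by have := S.three_le_finrank; omega)
    exact exists_ne 0
  have hpos := metricForm_pos (S.conf_pos x hx) hw
  refine ⟨cov κ β x w w / metricForm κ x w w, fun u v => ?_⟩
  rw [div_mul_eq_mul_div, eq_div_iff hpos.ne', hlim]

/-- The form `exp (Λ(b²) / 2) β` satisfies `b_{i|j} = k a_{ij}`: the term in `bᵢ bⱼ` of `cov_eq` is
cancelled by the derivative of the factor, as `b² Λ' = c - 1`. -/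
theorem exists_cov_conformalFactor (hflat : IsProjectivelyFlat U (generalMetric κ β φ))
    {I : Set ℝ} {Λ : ℝ → ℝ} (hL : LevelSystem I (bSq κ β '' U)
      (fun B => 2 * d1 φ B 0 / d2 (d2 φ) B 0) Λ φ Ω) (hx : x ∈ U) :
    ∃ k, ∀ u v, cov κ (fun z => conformalFactor κ β Λ z • β z) x u v
      = k * metricForm κ x u v := by
  have hxI : bSq κ β x ∈ I := hL.subset ⟨x, hx, rfl⟩
  have hρ := hasFDerivAt_conformalFactor (hL.differentiableAt _ hxI) (S.differentiableAt_bSq hx)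
  by_cases hb : β x = 0
  · obtain ⟨k, hk⟩ := S.exists_cov_eq_of_form_eq_zero hflat hL hx hb
    refine ⟨conformalFactor κ β Λ x * k, fun u v => ?_⟩
    rw [cov_smul hρ.differentiableAt (S.differentiableAt_form hx), hk, hb]
    simp [mul_assoc]
  · refine ⟨conformalFactor κ β Λ x * (cov κ β x (sharp κ β x) (sharp κ β x) / bSq κ β x
      * (2 * d1 φ (bSq κ β x) 0 / d2 (d2 φ) (bSq κ β x) 0)), fun u v => ?_⟩
    have hpos := S.bSq_pos hx hb
    have hd : deriv Λ (bSq κ β x)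
        = (2 * d1 φ (bSq κ β x) 0 / d2 (d2 φ) (bSq κ β x) 0 - 1) / bSq κ β x := by
      rw [eq_div_iff hpos.ne', mul_comm, hL.deriv_eq _ hxI]
    rw [cov_smul hρ.differentiableAt (S.differentiableAt_form hx), hρ.fderiv,
      smul_apply, S.fderiv_bSq_eq hflat hx hb, S.cov_eq hflat hx hb u v, hd,
      smul_eq_mul]
    ring

/-- A projectively flat metric determines an equation for the level curves, and its form `β` is an
explicit one. -/
theorem exists_data (hflat : IsProjectivelyFlat U (generalMetric κ β φ)) :
    ∃ (I : Set ℝ) (c Λ : ℝ → ℝ) (ε : ℝ) (a : Vec n), LevelSystem I (bSq κ β '' U) c Λ φ Ω ∧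
      ∀ x ∈ U, ∀ y, β x y = Real.exp (-(Λ (bSq κ β x) / 2)) * conformalForm κ ε a x y := by
  obtain ⟨I, Λ, hL⟩ := S.exists_levelSystem hflat
  obtain ⟨ε, a, h⟩ := exists_eq_conformalForm S.three_le S.isOpen S.isConnected S.conf_pos
    (γ := fun z => conformalFactor κ β Λ z • β z)
    (fun x hx => (hasFDerivAt_conformalFactor (hL.differentiableAt _ (hL.subset ⟨x, hx, rfl⟩))
      (S.differentiableAt_bSq hx)).differentiableAt.smul (S.differentiableAt_form hx))
    (fun x hx => S.exists_cov_conformalFactor hflat hL hx)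
  refine ⟨I, _, Λ, ε, a, hL, fun x hx y => ?_⟩
  have := h x hx y
  simp only [smul_apply, smul_eq_mul] at this
  rw [← this, conformalFactor, ← mul_assoc, ← Real.exp_add, neg_add_cancel, Real.exp_zero, one_mul]

theorem isExplicit_of_profile {I : Set ℝ} {c Λ : ℝ → ℝ} {ε : ℝ} {a : Vec n}
    (hL : LevelSystem I (bSq κ β '' U) c Λ φ Ω)
    (hβ : ∀ x ∈ U, ∀ y, β x y = Real.exp (-(Λ (bSq κ β x) / 2)) * conformalForm κ ε a x y)
    {T : Set ℝ} {fp fm : ℝ → ℝ} (hT : IsOpen T) (hfp : ContDiffOn ℝ ∞ fp T)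
    (hfm : ContDiffOn ℝ ∞ fm T)
    (h : ∀ B ∈ bSq κ β '' U, ∀ s : ℝ, s ^ 2 ≤ B → Real.exp (Λ B) * (B - s ^ 2) ∈ T ∧
        (0 ≤ s → φ B s = explicitPhi fp (levelMap Λ B) (-Real.exp (Λ B)) (d2 φ B 0) s) ∧
        (s ≤ 0 → φ B s = explicitPhi fm (levelMap Λ B) (-Real.exp (Λ B)) (d2 φ B 0) s)) :
    IsExplicit κ U β φ c Λ (levelMap Λ) fp fm (fun B => d2 φ B 0) ε a := by
  refine ⟨I, T, hL.isOpen, hT, fun x hx => hL.subset ⟨x, hx, rfl⟩, fun p hp => ?_,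
    hL.smooth_coeff, ?_, hfp, hfm, fun B hB => ⟨hL.differentiableAt B hB, hL.deriv_eq B hB⟩,
    fun B hB => ?_, fun p hp => ?_, hβ⟩
  · rw [mem_valueSet_iff] at hp
    have := (h _ hp.1 _ hp.2).1
    rwa [levelMap, show p.1 * Real.exp (Λ p.1) + -Real.exp (Λ p.1) * p.2 ^ 2
      = Real.exp (Λ p.1) * (p.1 - p.2 ^ 2) by ring]
  · exact (contDiffOn_d2 S.isOpen_dom S.smooth).comp (g := fun p : ℝ × ℝ => d2 φ p.1 p.2)
      (f := fun B : ℝ => (B, (0 : ℝ))) (by fun_prop) fun B hB => hL.mem_dom_zero B hB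
  · exact (hL.hasDerivAt_levelMap hB).congr_deriv (by ring)
  · rw [mem_valueSet_iff] at hp
    exact (h _ hp.1 _ hp.2).2

/-- A projectively flat metric has the explicit form. -/
theorem exists_isExplicit (hflat : IsProjectivelyFlat U (generalMetric κ β φ)) :
    ∃ (c Λ μ fp fm g : ℝ → ℝ) (ε : ℝ) (a : Vec n),
      IsExplicit κ U β φ c Λ μ fp fm g ε a := by
  obtain ⟨I, c, Λ, ε, a, hL, hβ⟩ := S.exists_data hflat
  obtain ⟨T, fp, fm, hT, hfp, hfm, h⟩ :=
    hL.exists_explicit (S.nontrivial_values (S.bSq_not_const hflat))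
  exact ⟨c, Λ, _, fp, fm, _, ε, a, S.isExplicit_of_profile hL hβ hT hfp hfm h⟩

/-- A projectively flat metric has the explicit form with one function `f`, if the vertex is reached. -/
theorem exists_isExplicit_of_reachesVertex (hflat : IsProjectivelyFlat U (generalMetric κ β φ))
    (hv : ReachesVertex κ U β φ) :
    ∃ (c Λ μ f g : ℝ → ℝ) (ε : ℝ) (a : Vec n), IsExplicit κ U β φ c Λ μ f f g ε a := by
  obtain ⟨I, c, Λ, ε, a, hL, hβ⟩ := S.exists_data hflat
  obtain ⟨hsmall, L, hlim⟩ := hv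
  have hset : valueSet κ U β = {p : ℝ × ℝ | p.1 ∈ bSq κ β '' U ∧ p.2 ^ 2 ≤ p.1} :=
    Set.ext mem_valueSet_iff
  rw [hset] at hlim
  obtain ⟨T, f, hT, hf, h⟩ := hL.exists_explicit_of_vertex
    (S.nontrivial_values (S.bSq_not_const hflat))
    (fun δ hδ => by
      obtain ⟨x, hx, h⟩ := hsmall δ hδ
      exact ⟨_, ⟨x, hx, rfl⟩, h⟩) hlim
  exact ⟨c, Λ, _, f, _, ε, a, S.isExplicit_of_profile hL hβ hT hf hf fun B hB s hs =>
    ⟨(h B hB s hs).1, fun _ => (h B hB s hs).2, fun _ => (h B hB s hs).2⟩⟩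

end Setting

/-! ### The explicit one-forms -/

/-- The explicit one-forms satisfy `b_{i|j} = k a_{ij}` with `k = (ε - κ ⟨a, x⟩) / √(1 + κ|x|²)`. -/
theorem cov_conformalForm {κ ε : ℝ} {a x : Vec n} {γ : Vec n → (Vec n →L[ℝ] ℝ)}
    (hx : 0 < 1 + κ * ‖x‖ ^ 2) (hd : DifferentiableAt ℝ γ x)
    (hγ : ∀ᶠ z in 𝓝 x, ∀ y, γ z y = conformalForm κ ε a z y) (u v : Vec n) :
    cov κ γ x u v
      = (ε - κ * inner ℝ a x) / Real.sqrt (1 + κ * ‖x‖ ^ 2) * metricForm κ x u v := by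
  have hline : HasDerivAt (fun t : ℝ => x + t • v) v 0 := by
    simpa using ((hasDerivAt_id (0 : ℝ)).smul_const v).const_add x
  have hW : HasDerivAt (fun t : ℝ => 1 + κ * ‖x + t • v‖ ^ 2) (κ * (2 * inner ℝ x v)) 0 := by
    have := (hline.norm_sq.const_mul κ).const_add 1
    simpa using this
  have hxu : HasDerivAt (fun t : ℝ => inner ℝ (x + t • v) u) (inner ℝ v u) 0 := by
    simpa using hline.inner ℝ (hasDerivAt_const 0 u)
  have hax : HasDerivAt (fun t : ℝ => inner ℝ a (x + t • v)) (inner ℝ a v) 0 := by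
    simpa using (hasDerivAt_const 0 a).inner ℝ hline
  have hW0 : 0 < 1 + κ * ‖x + (0 : ℝ) • v‖ ^ 2 := by simpa using hx
  have h1 : HasDerivAt (fun t : ℝ => conformalForm κ ε a (x + t • v) u) _ 0 :=
    (((hxu.const_mul ε).add (hW.mul_const (inner ℝ a u))).sub ((hax.const_mul κ).mul hxu)).div
      (hW.rpow_const (p := 3 / 2) (Or.inl hW0.ne')) (Real.rpow_pos_of_pos hW0 _).ne'
  have h2 : (fun t : ℝ => γ (x + t • v) u) =ᶠ[𝓝 0] fun t => conformalForm κ ε a (x + t • v) u :=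
    (eventually_line hγ v).mono fun t ht => ht u
  have h3 := (hasDerivAt_apply_line hd v u).unique (h1.congr_of_eventuallyEq h2)
  have hq := Real.sqrt_pos.2 hx
  have hq2 := Real.sq_sqrt hx.le
  have e1 : (1 + κ * ‖x‖ ^ 2) ^ (3 / 2 : ℝ) = Real.sqrt (1 + κ * ‖x‖ ^ 2) ^ 3 := by
    rw [Real.sqrt_eq_rpow, ← Real.rpow_mul_natCast hx.le]; norm_num
  have e2 : (1 + κ * ‖x‖ ^ 2) ^ (3 / 2 - 1 : ℝ) = Real.sqrt (1 + κ * ‖x‖ ^ 2) := by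
    rw [Real.sqrt_eq_rpow]; norm_num
  rw [cov, h3, hγ.self_of_nhds u, hγ.self_of_nhds v, conformalForm, conformalForm, metricForm]
  simp only [zero_smul, add_zero, Pi.sub_apply, Pi.add_apply, Pi.mul_apply]
  rw [e1, e2, real_inner_comm u v]
  generalize Real.sqrt (1 + κ * ‖x‖ ^ 2) = q at hq hq2
  rw [← hq2]
  field_simp
  ring

/-- The one-form `β` is, up to the factor `exp (-Λ(b²) / 2)`, the form `conformalForm κ ε a`, where
`b² Λ' = c - 1`. -/
structure ConformalData (κ : ℝ) (U : Set (Vec n)) (β : Vec n → (Vec n →L[ℝ] ℝ)) (c Λ : ℝ → ℝ)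
    (ε : ℝ) (a : Vec n) : Prop where
  differentiableAt : ∀ x ∈ U, DifferentiableAt ℝ Λ (bSq κ β x)
  deriv_eq : ∀ x ∈ U, bSq κ β x * deriv Λ (bSq κ β x) = c (bSq κ β x) - 1
  form_eq : ∀ x ∈ U, ∀ y, β x y = Real.exp (-(Λ (bSq κ β x) / 2)) * conformalForm κ ε a x y

/-- The factor `k` for which `b_{i|j} = k (a_{ij} - Λ' b_i b_j / c)`. -/
def conformalRate (κ : ℝ) (β : Vec n → (Vec n →L[ℝ] ℝ)) (Λ : ℝ → ℝ) (ε : ℝ) (a x : Vec n) : ℝ :=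
  Real.exp (-(Λ (bSq κ β x) / 2)) * ((ε - κ * inner ℝ a x) / Real.sqrt (1 + κ * ‖x‖ ^ 2))

namespace Setting
variable {κ : ℝ} {U : Set (Vec n)} {β : Vec n → (Vec n →L[ℝ] ℝ)} {φ : ℝ → ℝ → ℝ}
  {Ω : Set (ℝ × ℝ)} (S : Setting κ U β φ Ω) {x : Vec n} {c Λ : ℝ → ℝ} {ε : ℝ} {a : Vec n}
  (H : ConformalData κ U β c Λ ε a)
include S H

/-- The covariant derivative of `β`, from that of the conformal form `exp (Λ(b²) / 2) β`. -/
theorem cov_add_eq (hx : x ∈ U) (u v : Vec n) :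
    cov κ β x u v + deriv Λ (bSq κ β x) * cov κ β x (sharp κ β x) v * β x u
      = conformalRate κ β Λ ε a x * metricForm κ x u v := by
  have hρ := hasFDerivAt_conformalFactor (H.differentiableAt x hx) (S.differentiableAt_bSq hx)
  have h1 := cov_conformalForm (κ := κ) (ε := ε) (a := a)
    (γ := fun z => conformalFactor κ β Λ z • β z) (S.conf_pos x hx)
    (hρ.differentiableAt.smul (S.differentiableAt_form hx))
    (Filter.mem_of_superset (S.isOpen.mem_nhds hx) fun z hz y => by
      simp only [smul_apply, smul_eq_mul]
      rw [H.form_eq z hz, conformalFactor, ← mul_assoc, ← Real.exp_add, add_neg_cancel,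
        Real.exp_zero, one_mul]) u v
  rw [cov_smul hρ.differentiableAt (S.differentiableAt_form hx), hρ.fderiv,
    smul_apply, fderiv_bSq (S.conf_pos x hx) (S.differentiableAt_form hx),
    conformalFactor, smul_eq_mul] at h1
  rw [conformalRate, Real.exp_neg]
  have := (Real.exp_pos (Λ (bSq κ β x) / 2)).ne'
  rw [mul_assoc (Real.exp _)⁻¹, ← h1]
  field_simp

/-- The preceding identity contracted with the dual vector of `β`, that is, `c d(b²) = 2 k β`. -/
theorem coeff_mul_cov_sharp (hx : x ∈ U) (v : Vec n) :
    c (bSq κ β x) * cov κ β x (sharp κ β x) v = conformalRate κ β Λ ε a x * β x v := by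
  have h1 := S.cov_add_eq H hx (sharp κ β x) v
  rw [S.apply_sharp hx, metricForm_sharp (S.conf_pos x hx)] at h1
  linear_combination h1 - cov κ β x (sharp κ β x) v * H.deriv_eq x hx

/-- If `b²` is constant, then `k β = 0`, so that `β` vanishes identically or is parallel. -/
theorem bSq_not_const_of_conformalData (B : ℝ) : ¬ ∀ x ∈ U, bSq κ β x = B := by
  intro hc
  rcases eq_or_ne B 0 with rfl | hB0
  · exact S.not_bSq_eq_zero hc
  refine S.not_cov_eq_zero fun x hx u v => ?_
  have hN : ∀ v, cov κ β x (sharp κ β x) v = 0 := by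
    intro v
    have h1 : bSq κ β =ᶠ[𝓝 x] fun _ => B :=
      Filter.mem_of_superset (S.isOpen.mem_nhds hx) fun z hz => hc z hz
    have h2 := fderiv_bSq (S.conf_pos x hx) (S.differentiableAt_form hx) v
    rw [h1.fderiv_eq] at h2
    simp at h2
    exact h2
  have h1 := S.coeff_mul_cov_sharp H hx (sharp κ β x)
  rw [hN, mul_zero, S.apply_sharp hx, hc x hx] at h1
  have hk : conformalRate κ β Λ ε a x = 0 := (mul_eq_zero.1 h1.symm).resolve_right hB0
  have h2 := S.cov_add_eq H hx u v
  rwa [hN, hk, mul_zero, zero_mul, zero_mul, add_zero] at h2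

theorem fderiv_bSq_of_conformalData (hx : x ∈ U) (hc : c (bSq κ β x) ≠ 0) (v : Vec n) :
    fderiv ℝ (bSq κ β) x v
      = 2 * (conformalRate κ β Λ ε a x / c (bSq κ β x)) * β x v := by
  rw [fderiv_bSq (S.conf_pos x hx) (S.differentiableAt_form hx)]
  have := S.coeff_mul_cov_sharp H hx v
  field_simp
  linear_combination this

theorem cov_of_conformalData (hx : x ∈ U) (hc : c (bSq κ β x) ≠ 0) (u v : Vec n) :
    cov κ β x u v = conformalRate κ β Λ ε a x * metricForm κ x u v
      - deriv Λ (bSq κ β x) * (conformalRate κ β Λ ε a x / c (bSq κ β x)) * (β x u * β x v) := by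
  have h1 := S.cov_add_eq H hx u v
  have h2 := S.coeff_mul_cov_sharp H hx v
  have h3 : cov κ β x (sharp κ β x) v = conformalRate κ β Λ ε a x / c (bSq κ β x) * β x v := by
    field_simp
    linear_combination h2
  rw [h3] at h1
  linear_combination h1

/-- With the covariant derivative of an explicit one-form, Hamel's expression is a multiple of the
differential equation for `φ`. -/
theorem hamel_eq_zero (hx : x ∈ U) (hc : c (bSq κ β x) ≠ 0)
    (hpde : ∀ s : ℝ, s ^ 2 ≤ bSq κ β x →
      d2 (d2 φ) (bSq κ β x) s * (c (bSq κ β x) * (bSq κ β x - s ^ 2) + s ^ 2)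
        = 2 * bSq κ β x * (d1 φ (bSq κ β x) s - s * d2 (d1 φ) (bSq κ β x) s))
    {y : Vec n} (hy : y ≠ 0) (v : Vec n) : hamel (generalMetric κ β φ) x y v = 0 := by
  have hα := alpha_pos (S.conf_pos x hx) hy
  have hA := alpha_sq (S.conf_pos x hx) y
  obtain ⟨s, hs⟩ : ∃ s, β x y / alpha κ x y = s := ⟨_, rfl⟩
  have hsy : β x y = s * alpha κ x y := by rw [← hs]; field_simp
  obtain ⟨x', -, h1, h2⟩ := mem_valueSet (β := β) S.conf_pos hx hy
  have hs2 : s ^ 2 ≤ bSq κ β x := by rw [← hs]; simp only at h1 h2; rwa [h1]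
  have hp := hpde s hs2
  have hd := H.deriv_eq x hx
  rw [hamel_generalMetric S.isOpen S.conf_pos S.isOpen_dom S.subset_dom S.smooth S.finsler.smooth
    hx (S.differentiableAt_form hx) hy v hs, S.fderiv_bSq_of_conformalData H hx hc,
    S.fderiv_bSq_of_conformalData H hx hc, S.cov_of_conformalData H hx hc v y,
    S.cov_of_conformalData H hx hc y v, S.cov_of_conformalData H hx hc y y, metricForm_comm κ x v y,
    ← hA, hsy]
  by_cases hb : β x = 0
  · have hs0 : s = 0 := by rw [← hs, hb]; simp
    rw [hb, hs0]
    simp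
  have hB := S.bSq_pos hx hb
  have hd' : deriv Λ (bSq κ β x) = (c (bSq κ β x) - 1) / bSq κ β x := by
    rw [eq_div_iff hB.ne', mul_comm, hd]
  rw [hd']
  generalize conformalRate κ β Λ ε a x = k
  field_simp
  linear_combination (k * (β x v * alpha κ x y - s * metricForm κ x y v)) * hp

/-- The formula for the geodesic coefficients. Both `Gⁱ` and `ᵅGⁱ` are multiples `F_{xᵏ} yᵏ / (2F)` of
`yⁱ`, so the difference is `(α φ₁ d(b²)(y) + φ₂ b_{i|j} yⁱ yʲ) / (2 α φ)` times `yⁱ`. -/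
theorem geodesicCoeff_eq_of_hamel_eq_zero (hx : x ∈ U) (hb : β x ≠ 0) (hc : c (bSq κ β x) ≠ 0)
    {y : Vec n} (hy : y ≠ 0) (h : ∀ v, hamel (generalMetric κ β φ) x y v = 0) (i : Fin n) :
    geodesicCoeff (generalMetric κ β φ) x y i =
      geodesicCoeff (alpha κ) x y i +
        Real.exp (-(Λ (bSq κ β x) / 2)) *
          ((ε - κ * inner ℝ a x) /
            (c (bSq κ β x) * bSq κ β x * Real.sqrt (1 + κ * ‖x‖ ^ 2))) *
          alpha κ x y *
          ((c (bSq κ β x) - 1) *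
              ((bSq κ β x - (β x y / alpha κ x y) ^ 2) *
                d2 φ (bSq κ β x) (β x y / alpha κ x y) /
                (2 * φ (bSq κ β x) (β x y / alpha κ x y))) +
            bSq κ β x *
              (2 * (β x y / alpha κ x y) * d1 φ (bSq κ β x) (β x y / alpha κ x y) +
                d2 φ (bSq κ β x) (β x y / alpha κ x y)) /
              (2 * φ (bSq κ β x) (β x y / alpha κ x y))) * y i := by
  have hα := alpha_pos (S.conf_pos x hx) hy
  have hA := alpha_sq (S.conf_pos x hx) y
  have hF := S.finsler.pos x hx y hy
  rw [generalMetric] at hF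
  have hφ0 := pos_of_mul_pos_right hF hα.le
  have h1 := (geodesicCoeff_eq_iff S.isOpen S.finsler hx hy).2 h i
  have h2 := (geodesicCoeff_eq_iff S.isOpen (isFinslerMetric_alpha S.conf_pos) hx hy).2
    (hamel_alpha S.isOpen S.conf_pos hx hy) i
  have hcov : fderiv ℝ β x y y = cov κ β x y y
      - κ / (1 + κ * ‖x‖ ^ 2) * (inner ℝ x y * β x y + inner ℝ x y * β x y) := by
    rw [cov]; ring
  rw [h1, h2, fderiv_generalMetric_fst S.isOpen S.conf_pos S.isOpen_dom S.subset_dom S.smooth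
    S.finsler.smooth hx (S.differentiableAt_form hx) hy, hcov,
    S.fderiv_bSq_of_conformalData H hx hc, S.cov_of_conformalData H hx hc,
    fderiv_alpha_self S.isOpen S.conf_pos hx hy, ← hA, generalMetric]
  obtain ⟨s, hs⟩ : ∃ s, β x y / alpha κ x y = s := ⟨_, rfl⟩
  have hsy : β x y = s * alpha κ x y := by rw [← hs]; field_simp
  rw [hs] at hφ0 ⊢
  rw [hsy]
  have hB := S.bSq_pos hx hb
  have hd' : deriv Λ (bSq κ β x) = (c (bSq κ β x) - 1) / bSq κ β x := by
    rw [eq_div_iff hB.ne', mul_comm, H.deriv_eq x hx]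
  rw [hd', conformalRate]
  have hq := Real.sqrt_pos.2 (S.conf_pos x hx)
  have hW := (S.conf_pos x hx).ne'
  generalize Real.sqrt (1 + κ * ‖x‖ ^ 2) = q at *
  generalize Real.exp (-(Λ (bSq κ β x) / 2)) = E
  generalize alpha κ x y = α at *
  generalize φ (bSq κ β x) s = p at *
  field_simp
  ring

end Setting

/-! ### The explicit profiles solve the partial differential equation -/

/-- For `s ≥ 0` the profile `φ` has the explicit form with the function `f`, over the interval `J`
of values of `b²`. -/
structure ProfileData (J T : Set ℝ) (c Λ μ f g : ℝ → ℝ) (φ : ℝ → ℝ → ℝ) (Ω : Set (ℝ × ℝ)) :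
    Prop where
  ordConnected : J.OrdConnected
  nontrivial : J.Nontrivial
  nonneg : ∀ B ∈ J, 0 ≤ B
  isOpen_dom : IsOpen Ω
  mem_dom : ∀ B ∈ J, ∀ s : ℝ, s ^ 2 ≤ B → (B, s) ∈ Ω
  smooth : ContDiffOn ℝ ∞ (fun p : ℝ × ℝ => φ p.1 p.2) Ω
  isOpen : IsOpen T
  smooth_fun : ContDiffOn ℝ ∞ f T
  mem : ∀ B ∈ J, ∀ s : ℝ, s ^ 2 ≤ B → μ B + -Real.exp (Λ B) * s ^ 2 ∈ T
  differentiableAt : ∀ B ∈ J, DifferentiableAt ℝ Λ B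
  deriv_eq : ∀ B ∈ J, B * deriv Λ B = c B - 1
  hasDerivAt : ∀ B ∈ J, HasDerivAt μ (c B * Real.exp (Λ B)) B
  eq : ∀ B ∈ J, ∀ s : ℝ, 0 ≤ s → s ^ 2 ≤ B →
    φ B s = explicitPhi f (μ B) (-Real.exp (Λ B)) (g B) s

namespace ProfileData
variable {J T : Set ℝ} {c Λ μ f g : ℝ → ℝ} {φ : ℝ → ℝ → ℝ} {Ω : Set (ℝ × ℝ)}
  (P : ProfileData J T c Λ μ f g φ Ω) {B s : ℝ}
include P

theorem uniqueDiffWithinAt (hB : B ∈ J) : UniqueDiffWithinAt ℝ J B := by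
  obtain ⟨a, ha, b, hb, hab⟩ := P.nontrivial.exists_lt
  refine uniqueDiffOn_convex P.ordConnected.convex ?_ B hB
  refine (Set.nonempty_Ioo.2 hab).mono (interior_maximal ?_ isOpen_Ioo)
  exact Set.Ioo_subset_Icc_self.trans (P.ordConnected.out ha hb)

theorem hasDerivAt_fun (hB : B ∈ J) (hs : s ^ 2 ≤ B) :
    HasDerivAt f (deriv f (μ B + -Real.exp (Λ B) * s ^ 2)) (μ B + -Real.exp (Λ B) * s ^ 2) :=
  ((P.smooth_fun.contDiffAt (P.isOpen.mem_nhds (P.mem B hB s hs))).differentiableAt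
    (by simp)).hasDerivAt

/-- Evaluated at `s = 0` the explicit form reads `φ = f(μ)`; its derivative can be taken within the
interval `J`. -/
theorem d1_zero (hB : B ∈ J) : d1 φ B 0 = deriv f (μ B) * (c B * Real.exp (Λ B)) := by
  have hB0 : (0 : ℝ) ^ 2 ≤ B := by simpa using P.nonneg B hB
  have h1 := (hasDerivAt_d1 P.isOpen_dom P.smooth (P.mem_dom B hB 0 hB0)).hasDerivWithinAt (s := J)
  have hf := P.hasDerivAt_fun hB hB0
  rw [zero_pow two_ne_zero, mul_zero, add_zero] at hf
  have h2 := (hf.comp B (P.hasDerivAt B hB)).hasDerivWithinAt (s := J)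
  have he : ∀ B ∈ J, φ B 0 = (f ∘ μ) B := fun B hB => by
    rw [P.eq B hB 0 le_rfl (by simpa using P.nonneg B hB), explicitPhi]
    simp
  exact (P.uniqueDiffWithinAt hB).eq_deriv _ h1 (h2.congr he (he B hB))

theorem legendre_eq (hB : B ∈ J) (hs0 : 0 < s) (hs : s ^ 2 < B) :
    legendre φ B s = f (μ B + -Real.exp (Λ B) * s ^ 2) := by
  set ν := -Real.exp (Λ B) with hν
  have hfd : ContinuousOn (deriv f) T :=
    (P.smooth_fun.deriv_of_isOpen P.isOpen (m := ∞) (by simp)).continuousOn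
  have hK : IsOpen {z : ℝ | μ B + ν * z ^ 2 ∈ T} := P.isOpen.preimage (by fun_prop)
  have hKc : ContinuousOn (fun z => deriv f (μ B + ν * z ^ 2)) {z : ℝ | μ B + ν * z ^ 2 ∈ T} :=
    hfd.comp (by fun_prop) fun _ h => h
  have hsub : Set.uIcc 0 s ⊆ {z : ℝ | μ B + ν * z ^ 2 ∈ T} := by
    intro z hz
    rw [Set.uIcc_of_le hs0.le] at hz
    exact P.mem B hB z ((pow_le_pow_left₀ hz.1 hz.2 2).trans hs.le)
  have hsK : s ∈ {z : ℝ | μ B + ν * z ^ 2 ∈ T} := hsub Set.right_mem_uIcc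
  have hint : HasDerivAt (fun s => ∫ z in (0 : ℝ)..s, deriv f (μ B + ν * z ^ 2))
      (deriv f (μ B + ν * s ^ 2)) s :=
    intervalIntegral.integral_hasDerivAt_right (hKc.mono hsub).intervalIntegrable
      (hKc.stronglyMeasurableAtFilter hK s hsK) (hKc.continuousAt (hK.mem_nhds hsK))
  have hlev : HasDerivAt (fun s => μ B + ν * s ^ 2) (ν * (2 * s)) s := by
    simpa using (((hasDerivAt_id s).pow 2).const_mul ν).const_add (μ B)
  have h1 : HasDerivAt (explicitPhi f (μ B) ν (g B)) _ s :=
    (((P.hasDerivAt_fun hB hs.le).comp s hlev).sub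
      (((hasDerivAt_id s).const_mul (2 * ν)).mul hint)).add ((hasDerivAt_id s).const_mul (g B))
  have h2 := hasDerivAt_d2 P.isOpen_dom P.smooth (P.mem_dom B hB s hs.le)
  have h3 : φ B =ᶠ[𝓝 s] explicitPhi f (μ B) ν (g B) := by
    filter_upwards [lt_mem_nhds hs0,
      (continuous_pow 2).continuousAt.eventually_lt continuousAt_const hs] with w hw hw2
    exact P.eq B hB w hw.le hw2.le
  have h4 := h2.unique (h1.congr_of_eventuallyEq h3)
  rw [legendre, h4, P.eq B hB s hs0.le hs.le, explicitPhi]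
  simp only [id_eq]
  ring

theorem d2_d2_eq (hB : B ∈ J) (hs0 : 0 < s) (hs : s ^ 2 < B) :
    d2 (d2 φ) B s = 2 * Real.exp (Λ B) * deriv f (μ B + -Real.exp (Λ B) * s ^ 2) := by
  have hm := P.mem_dom B hB s hs.le
  have h1 := (hasDerivAt_d2 P.isOpen_dom P.smooth hm).sub
    ((hasDerivAt_id s).mul (hasDerivAt_d2 P.isOpen_dom (contDiffOn_d2 P.isOpen_dom P.smooth) hm))
  have hlev : HasDerivAt (fun s => μ B + -Real.exp (Λ B) * s ^ 2)
      (-Real.exp (Λ B) * (2 * s)) s := by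
    simpa using (((hasDerivAt_id s).pow 2).const_mul (-Real.exp (Λ B))).const_add (μ B)
  have h2 := (P.hasDerivAt_fun hB hs.le).comp s hlev
  have h3 : (φ B - id * d2 φ B) =ᶠ[𝓝 s] (f ∘ fun s => μ B + -Real.exp (Λ B) * s ^ 2) := by
    filter_upwards [lt_mem_nhds hs0,
      (continuous_pow 2).continuousAt.eventually_lt continuousAt_const hs] with w hw hw2
    exact P.legendre_eq hB hw hw2
  have h4 := h1.unique (h2.congr_of_eventuallyEq h3)
  simp only [id_eq] at h4
  refine mul_left_cancel₀ hs0.ne' ?_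
  linear_combination -h4

/-- The `b²`-derivative of the identity `legendre_eq`. That identity holds over `J` only, so the
derivatives are compared within `J`. -/
theorem d1_sub_eq (hB : B ∈ J) (hs0 : 0 < s) (hs : s ^ 2 < B) :
    d1 φ B s - s * d2 (d1 φ) B s = deriv f (μ B + -Real.exp (Λ B) * s ^ 2)
      * (c B * Real.exp (Λ B) - deriv Λ B * Real.exp (Λ B) * s ^ 2) := by
  have hm := P.mem_dom B hB s hs.le
  have h1 := ((hasDerivAt_d1 P.isOpen_dom P.smooth hm).sub
    ((hasDerivAt_d1 P.isOpen_dom (contDiffOn_d2 P.isOpen_dom P.smooth) hm).const_mul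
      s)).hasDerivWithinAt (s := J)
  have h2 := ((P.hasDerivAt_fun hB hs.le).comp B ((P.hasDerivAt B hB).add
    ((P.differentiableAt B hB).hasDerivAt.exp.neg.mul_const (s ^ 2)))).hasDerivWithinAt (s := J)
  have h3 : ∀ᶠ B' in 𝓝[J] B, φ B' s - s * d2 φ B' s
      = f (μ B' + -Real.exp (Λ B') * s ^ 2) := by
    filter_upwards [self_mem_nhdsWithin, (lt_mem_nhds hs).filter_mono nhdsWithin_le_nhds]
      with B' hB' hs'
    exact P.legendre_eq hB' hs0 hs'
  have h4 := (P.uniqueDiffWithinAt hB).eq_deriv _ h1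
    (h2.congr_of_eventuallyEq h3 (P.legendre_eq hB hs0 hs))
  rw [← d1_d2_comm P.isOpen_dom P.smooth hm, h4]
  ring

/-- The explicit profiles satisfy the differential equation, first for `0 < s < b` and then for
`0 ≤ s ≤ b` by continuity. -/
theorem pde (hB : B ∈ J) (hs0 : 0 ≤ s) (hs : s ^ 2 ≤ B) :
    d2 (d2 φ) B s * (c B * (B - s ^ 2) + s ^ 2) = 2 * B * (d1 φ B s - s * d2 (d1 φ) B s) := by
  rcases (P.nonneg B hB).eq_or_lt with hB0 | hB0
  · have : s ^ 2 = 0 := le_antisymm (by rw [hB0]; exact hs) (sq_nonneg s)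
    rw [this, ← hB0]
    ring
  have hr := Real.sqrt_pos.2 hB0
  have hsq : ∀ z ∈ Set.Icc 0 (Real.sqrt B), z ^ 2 ≤ B := fun z hz =>
    (Real.le_sqrt hz.1 hB0.le).1 hz.2
  have hc : ∀ {G : ℝ → ℝ → ℝ}, ContDiffOn ℝ ∞ (fun p : ℝ × ℝ => G p.1 p.2) Ω →
      ContinuousOn (G B) (Set.Icc 0 (Real.sqrt B)) := fun hG =>
    hG.continuousOn.comp (f := fun s : ℝ => (B, s)) (by fun_prop) fun z hz =>
      P.mem_dom B hB z (hsq z hz)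
  have c1 := contDiffOn_d1 P.isOpen_dom P.smooth
  have k1 := hc c1
  have k12 := hc (contDiffOn_d2 P.isOpen_dom c1)
  have k22 := hc (contDiffOn_d2 P.isOpen_dom (contDiffOn_d2 P.isOpen_dom P.smooth))
  have hmain : Set.EqOn (fun s => d2 (d2 φ) B s * (c B * (B - s ^ 2) + s ^ 2))
      (fun s => 2 * B * (d1 φ B s - s * d2 (d1 φ) B s)) (Set.Ioo 0 (Real.sqrt B)) := by
    intro z hz
    have hz2 : z ^ 2 < B := (Real.lt_sqrt hz.1.le).1 hz.2
    simp only
    rw [P.d2_d2_eq hB hz.1 hz2, P.d1_sub_eq hB hz.1 hz2]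
    linear_combination (2 * Real.exp (Λ B) * deriv f (μ B + -Real.exp (Λ B) * z ^ 2) * z ^ 2)
      * P.deriv_eq B hB
  have := hmain.of_subset_closure (t := Set.Icc 0 (Real.sqrt B))
    (k22.mul (by fun_prop)) (continuousOn_const.mul (k1.sub (continuousOn_id.mul k12)))
    Set.Ioo_subset_Icc_self (by rw [closure_Ioo hr.ne])
  exact this ⟨hs0, Real.le_sqrt_of_sq_le hs⟩

end ProfileData

theorem IsExplicit.conformalData {κ : ℝ} {U : Set (Vec n)} {β : Vec n → (Vec n →L[ℝ] ℝ)}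
    {φ : ℝ → ℝ → ℝ} {c Λ μ fp fm g : ℝ → ℝ} {ε : ℝ} {a : Vec n}
    (H : IsExplicit κ U β φ c Λ μ fp fm g ε a) : ConformalData κ U β c Λ ε a := by
  obtain ⟨I, T, -, -, hI, -, -, -, -, -, hΛ, -, -, hβ⟩ := H
  exact ⟨fun x hx => (hΛ _ (hI x hx)).1, fun x hx => (hΛ _ (hI x hx)).2, hβ⟩

namespace Setting
variable {κ : ℝ} {U : Set (Vec n)} {β : Vec n → (Vec n →L[ℝ] ℝ)} {φ : ℝ → ℝ → ℝ}
  {Ω : Set (ℝ × ℝ)} (S : Setting κ U β φ Ω) {x : Vec n} {c Λ μ fp fm g : ℝ → ℝ} {ε : ℝ} {a : Vec n}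
  (H : IsExplicit κ U β φ c Λ μ fp fm g ε a)
include S H

/-- The explicit form for `s ≥ 0`, and the one for `s ≤ 0` after the reflection `s ↦ -s`, which changes
the sign of `g`. -/
theorem exists_profileData : ∃ T, ProfileData (bSq κ β '' U) T c Λ μ fp g φ Ω ∧
    ProfileData (bSq κ β '' U) T c Λ μ fm (fun B => -g B) (fun B s => φ B (-s))
      ((fun p : ℝ × ℝ => (p.1, -p.2)) ⁻¹' Ω) := by
  have hnt := S.nontrivial_values (S.bSq_not_const_of_conformalData H.conformalData)
  obtain ⟨I, T, hI, hT, hbI, hmem, hc, hg, hfp, hfm, hΛ, hμ, hφ, hβ⟩ := H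
  have hJI : ∀ B ∈ bSq κ β '' U, B ∈ I := by rintro _ ⟨x, hx, rfl⟩; exact hbI x hx
  have h0 : ∀ B ∈ bSq κ β '' U, 0 ≤ B := by
    rintro _ ⟨x, hx, rfl⟩; exact bSq_nonneg (S.conf_pos x hx) β
  have hdom : ∀ B ∈ bSq κ β '' U, ∀ s : ℝ, s ^ 2 ≤ B → (B, s) ∈ Ω := by
    rintro _ ⟨x, hx, rfl⟩ s hs; exact S.mem_dom hx hs
  have hval : ∀ B ∈ bSq κ β '' U, ∀ s : ℝ, s ^ 2 ≤ B → (B, s) ∈ valueSet κ U β := fun B hB s hs =>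
    (mem_valueSet_iff (B, s)).2 ⟨hB, hs⟩
  refine ⟨T, ⟨S.ordConnected_values, hnt, h0, S.isOpen_dom, hdom, S.smooth, hT, hfp,
      fun B hB s hs => hmem _ (hval B hB s hs), fun B hB => (hΛ B (hJI B hB)).1,
      fun B hB => (hΛ B (hJI B hB)).2, fun B hB => ?_,
      fun B hB s hs0 hs => (hφ _ (hval B hB s hs)).1 hs0⟩,
    ⟨S.ordConnected_values, hnt, h0, S.isOpen_dom.preimage (by fun_prop),
      fun B hB s hs => hdom B hB (-s) (by simpa using hs),
      S.smooth.comp (g := fun p : ℝ × ℝ => φ p.1 p.2) (f := fun p : ℝ × ℝ => (p.1, -p.2))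
        (by fun_prop) fun _ h => h, hT, hfm,
      fun B hB s hs => hmem _ (hval B hB s hs), fun B hB => (hΛ B (hJI B hB)).1,
      fun B hB => (hΛ B (hJI B hB)).2, fun B hB => ?_, fun B hB s hs0 hs => ?_⟩⟩
  · exact (hμ B (hJI B hB)).congr_deriv (by ring)
  · exact (hμ B (hJI B hB)).congr_deriv (by ring)
  · have := (hφ _ (hval B hB (-s) (by simpa using hs))).2 (by simpa using hs0)
    simp only at this
    rw [this, ← explicitPhi_neg, neg_neg]

/-- `φ₁(b², 0) = f'(μ) c exp Λ`, so that `c` does not vanish. -/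
theorem coeff_ne_zero (hx : x ∈ U) : c (bSq κ β x) ≠ 0 := by
  obtain ⟨T, P, -⟩ := S.exists_profileData H
  intro h
  apply S.d1_ne x hx
  rw [P.d1_zero ⟨x, hx, rfl⟩, h]
  ring

theorem pde_of_isExplicit (hx : x ∈ U) {s : ℝ} (hs : s ^ 2 ≤ bSq κ β x) :
    d2 (d2 φ) (bSq κ β x) s * (c (bSq κ β x) * (bSq κ β x - s ^ 2) + s ^ 2)
      = 2 * bSq κ β x * (d1 φ (bSq κ β x) s - s * d2 (d1 φ) (bSq κ β x) s) := by
  obtain ⟨T, P, Q⟩ := S.exists_profileData H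
  rcases le_total 0 s with h | h
  · exact P.pde ⟨x, hx, rfl⟩ h hs
  · have := Q.pde (s := -s) ⟨x, hx, rfl⟩ (by linarith) (by simpa using hs)
    rw [d2_d2_reflect, d2_d1_reflect, d1_reflect, neg_neg, neg_sq] at this
    linear_combination this

theorem hamel_eq_zero_of_isExplicit (hx : x ∈ U) {y : Vec n} (hy : y ≠ 0) (v : Vec n) :
    hamel (generalMetric κ β φ) x y v = 0 :=
  S.hamel_eq_zero H.conformalData hx (S.coeff_ne_zero H hx)
    (fun _ hs => S.pde_of_isExplicit H hx hs) hy v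

theorem isProjectivelyFlat_of_isExplicit : IsProjectivelyFlat U (generalMetric κ β φ) :=
  (isProjectivelyFlat_iff S.isOpen S.finsler).2 fun _ hx _ hy v =>
    S.hamel_eq_zero_of_isExplicit H hx hy v

end Setting

end GeneralAlphaBeta

end

open GeneralAlphaBeta in
theorem theorem1p2 {n : ℕ} (hn : 3 ≤ n) (κ : ℝ)
    (U : Set (EuclideanSpace ℝ (Fin n))) (hU : IsOpen U) (hUc : IsConnected U)
    (hκ : ∀ x ∈ U, 0 < 1 + κ * ‖x‖ ^ 2)
    (β : EuclideanSpace ℝ (Fin n) → (EuclideanSpace ℝ (Fin n) →L[ℝ] ℝ))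
    (hβ : ContDiffOn ℝ ∞ β U)
    (φ : ℝ → ℝ → ℝ) (Ω : Set (ℝ × ℝ)) (hΩ : IsOpen Ω) (hΩU : valueSet κ U β ⊆ Ω)
    (hφ : ContDiffOn ℝ ∞ (fun p : ℝ × ℝ => φ p.1 p.2) Ω)
    (hF : IsFinslerMetric U (generalMetric κ β φ))
    (hR : ¬ IsRiemannian U (generalMetric κ β φ))
    (hφ₁ : ∀ x ∈ U, d1 φ (bSq κ β x) 0 ≠ 0)
    (hφ₂₂ : ∃ p ∈ valueSet κ U β, d2 (d2 φ) p.1 p.2 ≠ 0)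
    (hpar : ¬ IsParallel κ U β) :
    (IsProjectivelyFlat U (generalMetric κ β φ) ↔
      ∃ (c Λ μ fp fm g : ℝ → ℝ) (ε : ℝ) (a : EuclideanSpace ℝ (Fin n)),
        IsExplicit κ U β φ c Λ μ fp fm g ε a) ∧
    (ReachesVertex κ U β φ →
      (IsProjectivelyFlat U (generalMetric κ β φ) ↔
        ∃ (c Λ μ f g : ℝ → ℝ) (ε : ℝ) (a : EuclideanSpace ℝ (Fin n)),
          IsExplicit κ U β φ c Λ μ f f g ε a)) ∧
    (∀ (c Λ μ fp fm g : ℝ → ℝ) (ε : ℝ) (a : EuclideanSpace ℝ (Fin n)),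
      IsExplicit κ U β φ c Λ μ fp fm g ε a →
      ∀ x ∈ U, β x ≠ 0 → c (bSq κ β x) ≠ 0 ∧
        ∀ y, y ≠ 0 → ∀ i,
          geodesicCoeff (generalMetric κ β φ) x y i =
            geodesicCoeff (alpha κ) x y i +
              Real.exp (-(Λ (bSq κ β x) / 2)) *
                ((ε - κ * inner ℝ a x) /
                  (c (bSq κ β x) * bSq κ β x * Real.sqrt (1 + κ * ‖x‖ ^ 2))) *
                alpha κ x y *
                ((c (bSq κ β x) - 1) *
                    ((bSq κ β x - (β x y / alpha κ x y) ^ 2) *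
                      d2 φ (bSq κ β x) (β x y / alpha κ x y) /
                      (2 * φ (bSq κ β x) (β x y / alpha κ x y))) +
                  bSq κ β x *
                    (2 * (β x y / alpha κ x y) * d1 φ (bSq κ β x) (β x y / alpha κ x y) +
                      d2 φ (bSq κ β x) (β x y / alpha κ x y)) /
                    (2 * φ (bSq κ β x) (β x y / alpha κ x y))) * y i) := by
  have S : Setting κ U β φ Ω :=
    ⟨hn, hU, hUc, hκ, hβ, hΩ, hΩU, hφ, hF, hφ₁, hφ₂₂, hpar⟩
  refine ⟨⟨S.exists_isExplicit, ?_⟩, fun hv =>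
    ⟨fun hflat => S.exists_isExplicit_of_reachesVertex hflat hv, ?_⟩, ?_⟩
  · rintro ⟨c, Λ, μ, fp, fm, g, ε, a, H⟩
    exact S.isProjectivelyFlat_of_isExplicit H
  · rintro ⟨c, Λ, μ, f, g, ε, a, H⟩
    exact S.isProjectivelyFlat_of_isExplicit H
  · intro c Λ μ fp fm g ε a H x hx hb
    have hc := S.coeff_ne_zero H hx
    exact ⟨hc, fun y hy i => S.geodesicCoeff_eq_of_hamel_eq_zero H.conformalData hx hb hc hy
      (S.hamel_eq_zero_of_isExplicit H hx hy) i⟩
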